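/- Let $I=[0,1]$, let $\mathcal R$ be the anticlockwise rotation of $\mathbb R^2$ by $\pi/2$, and let $\varepsilon>0$. For a curve $\gamma\in H^2(I;\mathbb R^2)$ let $L_\gamma$ denote its length and $\kappa_\gamma$ its curvature. The set of admissible curves is $$\mathcal{AC}=\{\gamma\in H^2(I;\mathbb R^2):\ |\gamma_s|\equiv L_\gamma,\ \gamma(0)\ne\gamma(1)\},$$ and for $\tilde\gamma\in\mathcal{AC}$ put $\mathcal{AC}_{\tilde\gamma}=\{\gamma\in\mathcal{AC}:\langle\gamma_s,\tilde\gamma_s\rangle\ge 0 \text{ on } I\}$. For $\gamma,\tilde\gamma\in\mathcal{AC}$ let $$E(\gamma)=L_\gamma+\frac{\varepsilon}{2}\int_\gamma\kappa_\gamma^2\,d\mathcal H^1-\log|\gamma(1)-\gamma(0)|,$$ where the curvature integral is $\int_0^1\kappa_\gamma^2|\gamma_s|\,ds$, and $$D(\gamma,\tilde\gamma)=\frac1{4L_{\tilde\gamma}}\int_0^1\langle\gamma-\tilde\gamma,\mathcal R(\tilde\gamma_s)\rangle^2ds+\frac1{4L_{\gamma}}\int_0^1\langle\gamma-\tilde\gamma,\mathcal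 R(\gamma_s)\rangle^2ds+\frac12|\gamma(0)-\tilde\gamma(0)|^2+\frac12|\gamma(1)-\tilde\gamma(1)|^2 .$$ Let $\gamma_0\in\mathcal{AC}$, and for every $\tau\in(0,1)$ let $(\gamma^\tau_n)_{n\ge0}$ be a sequence of step-by-step minimizers, that is, $\gamma^\tau_0=\gamma_0$ and, for every $n\ge 0$, $\gamma^\tau_{n+1}$ minimizes $\gamma\mapsto E(\gamma)+\frac1\tau D(\gamma,\gamma^\tau_n)$ over $\mathcal{AC}_{\gamma^\tau_n}$. Let $\gamma^\tau(s,t)=\gamma^\tau_{\lceil t/\tau\rceil}(s)$ for $s\in I$, $t\ge0$. Let $(\tau_k)\subset(0,1)$ be a sequence with $\tau_k\to0$. Then: 1. There are a subsequence of $(\tau_k)$, not relabelled, and a limit $\gamma: I\times\mathbb R_+\to\mathbb R^2$ such that $\gamma^{\tau_k}\to\gamma$ in $L^\infty_{\mathrm{loc}}(\mathbb R_+;C^{1,\alpha}(I;\mathbb R^2))$ for all $\alpha\in(0,\frac12)$ and $\gamma^{\tau_k}\to\gamma$ strongly in $L^2_{\mathrm{loc}}(\mathbb R_+;H^2(I;\mathbb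 R^2))$. 2. If $\gamma: I\times\mathbb R_+\to\mathbb R^2$ is any limit such that $\gamma^{\tau_k}\to\gamma$ in $L^\infty_{\mathrm{loc}}(\mathbb R_+;C^{1,\alpha}(I;\mathbb R^2))$ for some $\alpha\in(0,\frac12)$, then, up to a subsequence, $\gamma^{\tau_k}\to\gamma$ strongly in $L^2_{\mathrm{loc}}(\mathbb R_+;H^2(I;\mathbb R^2))$. Here convergence in $L^p_{\mathrm{loc}}(\mathbb R_+;X)$ means convergence in $L^p(0,T;X)$ for every $T>0$. -/

import Mathlib

open MeasureTheory Set Filter Topology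
open scoped ENNReal RealInnerProductSpace

noncomputable section

namespace ElasticFlow

/-- The Euclidean plane `ℝ²`. -/
abbrev Plane : Type := EuclideanSpace ℝ (Fin 2)

/-- The parameter interval `I = [0, 1]`. A curve is given by a function `ℝ → Plane`, of which only
the values on `I` matter: all the notions below depend only on these values. -/
abbrev I : Set ℝ := Icc (0 : ℝ) 1

/-- Anti-clockwise rotation of the plane by `π / 2`. -/
def rot (a : Plane) : Plane := !₂[-(a 1), a 0]

/-- First derivative `γ_s` on `I` (one-sided at the endpoints). -/
def ds (γ : ℝ → Plane) : ℝ → Plane := derivWithin γ I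

/-- Second derivative `γ_ss` on `I`. For `γ ∈ H²(I; ℝ²)` the first derivative is absolutely
continuous, so this is defined almost everywhere and is the weak second derivative of `γ`. -/
def dss (γ : ℝ → Plane) : ℝ → Plane := derivWithin (ds γ) I

/-- Membership in `H²(I; ℝ²)` (for the continuous representative): `γ` is differentiable on `I` and
its first derivative is the primitive of a square integrable function, which is then almost
everywhere the second derivative. -/
structure MemH2 (γ : ℝ → Plane) : Prop where
  differentiableOn : DifferentiableOn ℝ γ I
  memLp_dss : MemLp (dss γ) 2 (volume.restrict I)
  ds_eq : ∀ s ∈ I, ds γ s = ds γ 0 + ∫ r in (0 : ℝ)..s, dss γ r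

/-- The square of the `H²(I; ℝ²)` norm. -/
def h2NormSq (γ : ℝ → Plane) : ℝ≥0∞ :=
  ∫⁻ s in I, (‖γ s‖ₑ ^ 2 + ‖ds γ s‖ₑ ^ 2 + ‖dss γ s‖ₑ ^ 2)

/-- The `C^{1,α}(I; ℝ²)` norm (meaningful for curves of class `C¹` on `I`). -/
def c1HolderNorm (α : ℝ) (γ : ℝ → Plane) : ℝ≥0∞ :=
  (⨆ s ∈ I, ‖γ s‖ₑ) + (⨆ s ∈ I, ‖ds γ s‖ₑ) +
    ⨆ s ∈ I, ⨆ r ∈ I, ‖ds γ s - ds γ r‖ₑ / ENNReal.ofReal (|s - r| ^ α)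

/-- The length of a curve. -/
def length (γ : ℝ → Plane) : ℝ := ∫ s in (0 : ℝ)..1, ‖ds γ s‖

/-- The signed curvature of a curve. -/
def curvature (γ : ℝ → Plane) (s : ℝ) : ℝ := ⟪dss γ s, rot (ds γ s)⟫ / ‖ds γ s‖ ^ 3

/-- The set `AC` of admissible curves: `H²` curves of constant speed (equal to the length) with
distinct endpoints. -/
structure Admissible (γ : ℝ → Plane) : Prop where
  memH2 : MemH2 γ
  norm_ds : ∀ s ∈ I, ‖ds γ s‖ = length γ
  endpoints_ne : γ 0 ≠ γ 1

/-- The set `AC_γ'` of admissible curves `γ` with `⟨γ_s, γ'_s⟩ ≥ 0` on `I`. -/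
def admissibleFrom (γ' : ℝ → Plane) : Set (ℝ → Plane) :=
  {γ | Admissible γ ∧ ∀ s ∈ I, 0 ≤ ⟪ds γ s, ds γ' s⟫}

/-- The energy: length, plus `ε / 2` times the integral of the squared curvature with respect to
arclength, minus the logarithm of the distance of the endpoints. -/
def energy (ε : ℝ) (γ : ℝ → Plane) : ℝ :=
  length γ + ε / 2 * (∫ s in (0 : ℝ)..1, curvature γ s ^ 2 * ‖ds γ s‖) - Real.log ‖γ 1 - γ 0‖

/-- The dissipation `D(γ, γ')`. -/
def dissipation (γ γ' : ℝ → Plane) : ℝ :=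
  1 / (4 * length γ') * (∫ s in (0 : ℝ)..1, ⟪γ s - γ' s, rot (ds γ' s)⟫ ^ 2)
    + 1 / (4 * length γ) * (∫ s in (0 : ℝ)..1, ⟪γ s - γ' s, rot (ds γ s)⟫ ^ 2)
    + 1 / 2 * ‖γ 0 - γ' 0‖ ^ 2 + 1 / 2 * ‖γ 1 - γ' 1‖ ^ 2

/-- `c 0, c 1, c 2, …` is a sequence of step-by-step minimizers with time step `τ` and initial
curve `γ₀`. -/
structure IsMinimizingMovement (ε τ : ℝ) (γ₀ : ℝ → Plane) (c : ℕ → ℝ → Plane) : Prop where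
  initial : EqOn (c 0) γ₀ I
  mem : ∀ n, c (n + 1) ∈ admissibleFrom (c n)
  isMinOn : ∀ n, IsMinOn (fun γ => energy ε γ + 1 / τ * dissipation γ (c n))
    (admissibleFrom (c n)) (c (n + 1))

/-- The piecewise constant interpolation in time `γ^τ(·, t) = γ^τ_⌈t/τ⌉`, for `t ≥ 0`. -/
def interp (τ : ℝ) (c : ℕ → ℝ → Plane) (t : ℝ) : ℝ → Plane := c ⌈t / τ⌉₊

/-- Convergence `u k → γ` in `L^∞_loc(ℝ₊; C^{1,α}(I; ℝ²))`; time is the first argument. -/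
def TendstoLinftyC1 (α : ℝ) (u : ℕ → ℝ → ℝ → Plane) (γ : ℝ → ℝ → Plane) : Prop :=
  (∀ᵐ t ∂(volume.restrict (Ioi (0 : ℝ))), ContDiffOn ℝ 1 (γ t) I) ∧
  ∀ T : ℝ, 0 < T →
    Tendsto (fun k => essSup (fun t => c1HolderNorm α (u k t - γ t)) (volume.restrict (Ioo 0 T)))
      atTop (𝓝 0)

/-- Strong convergence `u k → γ` in `L²_loc(ℝ₊; H²(I; ℝ²))`; time is the first argument. When the
`u k` are step functions of time with values in `H²` this makes `γ` an almost everywhere limit of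
such functions in `H²`, so that `γ` is strongly measurable with values in `H²`. -/
def TendstoL2H2 (u : ℕ → ℝ → ℝ → Plane) (γ : ℝ → ℝ → Plane) : Prop :=
  (∀ᵐ t ∂(volume.restrict (Ioi (0 : ℝ))), MemH2 (γ t)) ∧
  ∀ T : ℝ, 0 < T →
    (∀ k, AEMeasurable (fun t => h2NormSq (u k t - γ t)) (volume.restrict (Ioo 0 T))) ∧
    (∫⁻ t in Ioo 0 T, h2NormSq (γ t)) < ∞ ∧
    Tendsto (fun k => ∫⁻ t in Ioo 0 T, h2NormSq (u k t - γ t)) atTop (𝓝 0)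

end ElasticFlow

end

open ElasticFlow

namespace ElasticFlow

/-! ### Plane geometry -/

/-! In polar form an admissible curve is an initial point, a length `L` and a tangent angle `θ` with
square integrable derivative `ω`, and its energy is `L + ε / 2 * (∫ ω ^ 2) / L - log ‖γ 1 - γ 0‖`.
The sum of the first two terms, call it `F`, is jointly convex in `(L, ω)`, and
`bending_convex_identity` gives the convexity defect exactly, as a multiple of `∫ (ω / L - ω' / L')
^ 2`. Strong convergence rests on this convexity; no Euler–Lagrange equation is needed.

Let `γ` minimize one step of the scheme from `β`, and let `γ'` be within `σ` of `γ` in initial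
point, length and angle. Interpolating the polar data of `γ` and `γ'` with weight `τ` on `γ'` gives
a competitor at distance `O(τσ)` from `γ`. The logarithm then changes by `O(τσ)`, and `D(·, β) / τ`,
being quadratic in the distance to `β`, grows by at most `O(τσ(1 + |γ - β| / τ))`. Minimality
divided by `τ` therefore bounds the convexity defect by `F(γ') - F(γ) + Cσ(1 + |γ - β| / τ)`; this
is `curvature_gap_le_of_isMinOn`. If `γ'` is itself a minimizer, possibly for another time step,
exchanging the roles and adding cancels `F(γ') - F(γ)` (`exists_h2_close`). The discrete speed `|γ -
β| / τ` has bounded time integral, so a sequence of interpolations that is uniformly Cauchy in `C¹`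
is Cauchy in `L²(0, T; H²)` (`cauchy_h2`). A Riesz–Fischer argument identifies the limit
(`exists_subseq_tendstoL2H2`).

The speed bound and the compactness come from the energy inequality. The dissipation sees only
normal displacements and endpoints, but for curves of constant speed whose tangents satisfy the sign
condition it controls the whole displacement (`size_le_of_dissipation`). Telescoping the energy then
gives a discrete Hölder bound of exponent `1/2` in time. With uniform bounds on length and bending,
interpolation upgrades weak closeness to `C¹` closeness, and an Arzelà–Ascoli argument on space-time
grids gives a subsequence converging in `C^{1,α}`. -/

/-- The unit vector of angle `θ`. -/
noncomputable def dir (θ : ℝ) : Plane := !₂[Real.cos θ, Real.sin θ]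

/-- The unit vector of angle `θ + π / 2`. -/
noncomputable def nor (θ : ℝ) : Plane := !₂[-Real.sin θ, Real.cos θ]

lemma plane_inner (a b : Plane) : ⟪a, b⟫ = a 0 * b 0 + a 1 * b 1 := by
  simp [PiLp.inner_apply, Fin.sum_univ_two, mul_comm]

lemma plane_norm_sq (a : Plane) : ‖a‖ ^ 2 = a 0 ^ 2 + a 1 ^ 2 := by
  simp [EuclideanSpace.norm_sq_eq, Fin.sum_univ_two]

@[simp] lemma dir_zero_coord (θ : ℝ) : dir θ 0 = Real.cos θ := rfl
@[simp] lemma dir_one_coord (θ : ℝ) : dir θ 1 = Real.sin θ := rfl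
@[simp] lemma nor_zero_coord (θ : ℝ) : nor θ 0 = -Real.sin θ := rfl
@[simp] lemma nor_one_coord (θ : ℝ) : nor θ 1 = Real.cos θ := rfl
@[simp] lemma rot_zero_coord (a : Plane) : rot a 0 = -(a 1) := rfl
@[simp] lemma rot_one_coord (a : Plane) : rot a 1 = a 0 := rfl

lemma rot_dir (θ : ℝ) : rot (dir θ) = nor θ := by
  ext i; fin_cases i <;> simp

lemma rot_smul (r : ℝ) (a : Plane) : rot (r • a) = r • rot a := by
  ext i; fin_cases i <;> simp

lemma rot_add (a b : Plane) : rot (a + b) = rot a + rot b := by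
  ext i; fin_cases i <;> simp [add_comm]

lemma norm_dir (θ : ℝ) : ‖dir θ‖ = 1 := by
  have := plane_norm_sq (dir θ)
  simp only [dir_zero_coord, dir_one_coord, Real.cos_sq_add_sin_sq] at this
  nlinarith [norm_nonneg (dir θ)]

lemma norm_rot (a : Plane) : ‖rot a‖ = ‖a‖ := by
  have h1 := plane_norm_sq a
  have h2 := plane_norm_sq (rot a)
  simp only [rot_zero_coord, rot_one_coord] at h2
  rw [← abs_of_nonneg (norm_nonneg (rot a)), ← abs_of_nonneg (norm_nonneg a)]
  exact sq_eq_sq_iff_abs_eq_abs _ _ |>.1 (by linarith)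

lemma norm_nor (θ : ℝ) : ‖nor θ‖ = 1 := by
  rw [← rot_dir, norm_rot, norm_dir]

lemma inner_rot_self (a : Plane) : ⟪a, rot a⟫ = 0 := by
  simp [plane_inner]; ring

lemma inner_rot_left (a b : Plane) : ⟪rot a, b⟫ = -⟪a, rot b⟫ := by
  simp [plane_inner]

lemma inner_sq_add_inner_rot_sq (a b : Plane) :
    ⟪a, b⟫ ^ 2 + ⟪a, rot b⟫ ^ 2 = ‖a‖ ^ 2 * ‖b‖ ^ 2 := by
  simp only [plane_inner, plane_norm_sq, rot_zero_coord, rot_one_coord]; ring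

lemma eq_inner_dir_add_inner_nor (v : Plane) (θ : ℝ) :
    v = ⟪v, dir θ⟫ • dir θ + ⟪v, nor θ⟫ • nor θ := by
  have h := Real.sin_sq_add_cos_sq θ
  ext i; fin_cases i
  · simp [plane_inner]; linear_combination -(v 0) * h
  · simp [plane_inner]; linear_combination -(v 1) * h

lemma eq_smul_rot_of_inner_eq_zero {v w : Plane} (hv : v ≠ 0) (h : ⟪w, v⟫ = 0) :
    w = (⟪w, rot v⟫ / ‖v‖ ^ 2) • rot v := by
  have hv' : v 0 ^ 2 + v 1 ^ 2 ≠ 0 := by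
    rw [← plane_norm_sq]; simpa using hv
  rw [plane_inner] at h
  ext i; fin_cases i
  · simp only [plane_inner, plane_norm_sq, Fin.zero_eta, PiLp.smul_apply, smul_eq_mul,
      rot_zero_coord, rot_one_coord]
    field_simp; linear_combination v 0 * h
  · simp only [plane_inner, plane_norm_sq, Fin.mk_one, PiLp.smul_apply, smul_eq_mul,
      rot_zero_coord, rot_one_coord]
    field_simp; linear_combination v 1 * h

lemma dir_sub_norm_sq (a b : ℝ) : ‖dir a - dir b‖ ^ 2 = (2 * Real.sin ((a - b) / 2)) ^ 2 := by
  rw [plane_norm_sq]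
  simp only [PiLp.sub_apply, dir_zero_coord, dir_one_coord]
  have h1 : Real.cos (a - b) = 1 - 2 * Real.sin ((a - b) / 2) ^ 2 := by
    have := Real.cos_two_mul ((a - b) / 2)
    have h2 := Real.sin_sq_add_cos_sq ((a - b) / 2)
    rw [show 2 * ((a - b) / 2) = a - b by ring] at this
    linarith
  rw [Real.cos_sub] at h1
  have := Real.sin_sq_add_cos_sq a
  have := Real.sin_sq_add_cos_sq b
  nlinarith

lemma norm_dir_sub (a b : ℝ) : ‖dir a - dir b‖ = 2 * |Real.sin ((a - b) / 2)| := by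
  have h := dir_sub_norm_sq a b
  have h2 := (sq_eq_sq_iff_abs_eq_abs _ _).1 h
  rwa [abs_of_nonneg (norm_nonneg _), abs_mul, abs_two] at h2

lemma norm_dir_sub_le (a b : ℝ) : ‖dir a - dir b‖ ≤ |a - b| := by
  rw [norm_dir_sub]
  have := Real.abs_sin_le_abs (x := (a - b) / 2)
  rw [abs_div, abs_two] at this
  linarith

lemma norm_nor_sub_le (a b : ℝ) : ‖nor a - nor b‖ ≤ |a - b| := by
  have : nor a - nor b = rot (dir a - dir b) := by
    ext i; fin_cases i <;> simp; ring
  rw [this, norm_rot]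
  exact norm_dir_sub_le a b

lemma exists_eq_smul_dir (v : Plane) : ∃ θ, v = ‖v‖ • dir θ := by
  refine ⟨Complex.arg ⟨v 0, v 1⟩, ?_⟩
  have hn : ‖(⟨v 0, v 1⟩ : ℂ)‖ = ‖v‖ := by
    have h1 := plane_norm_sq v
    have h2 := Complex.sq_norm (⟨v 0, v 1⟩ : ℂ)
    rw [Complex.normSq_mk] at h2
    rw [← abs_of_nonneg (norm_nonneg v), ← abs_of_nonneg (norm_nonneg (⟨v 0, v 1⟩ : ℂ))]
    exact (sq_eq_sq_iff_abs_eq_abs _ _).1 (by rw [h1, h2]; ring)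
  ext i; fin_cases i
  · simp [← hn, Complex.norm_mul_cos_arg]
  · simp [← hn, Complex.norm_mul_sin_arg]

lemma dir_add_two_pi_mul (θ : ℝ) (n : ℤ) : dir (θ + n * (2 * Real.pi)) = dir θ := by
  ext i; fin_cases i <;> simp

/-! ### Primitives on the unit interval -/

/-- `f` is a primitive of the integrable function `g` on `I`. -/
structure IsPrimitive {E : Type*} [NormedAddCommGroup E] [NormedSpace ℝ E] (f g : ℝ → E) :
    Prop where
  intervalIntegrable : IntervalIntegrable g volume 0 1
  eq_integral : ∀ s ∈ I, f s = f 0 + ∫ r in (0 : ℝ)..s, g r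

lemma uIcc_zero_one : uIcc (0 : ℝ) 1 = I := uIcc_of_le zero_le_one

lemma uniqueDiffOn_I : UniqueDiffOn ℝ I := uniqueDiffOn_Icc zero_lt_one

lemma zero_mem_I : (0 : ℝ) ∈ I := ⟨le_rfl, zero_le_one⟩

lemma one_mem_I : (1 : ℝ) ∈ I := ⟨zero_le_one, le_rfl⟩

lemma intervalIntegrable_iff_I {E : Type*} [NormedAddCommGroup E] (f : ℝ → E) :
    IntervalIntegrable f volume 0 1 ↔ Integrable f (volume.restrict I) :=
  intervalIntegrable_iff_integrableOn_Icc_of_le zero_le_one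

lemma intervalIntegral_eq_I {E : Type*} [NormedAddCommGroup E] [NormedSpace ℝ E] (f : ℝ → E) :
    ∫ s in (0 : ℝ)..1, f s = ∫ s in I, f s := by
  rw [intervalIntegral.integral_of_le zero_le_one, integral_Icc_eq_integral_Ioc]

lemma ContinuousOn.intervalIntegrable_I {E : Type*} [NormedAddCommGroup E] {f : ℝ → E}
    (hf : ContinuousOn f I) : IntervalIntegrable f volume 0 1 :=
  ContinuousOn.intervalIntegrable (by rwa [uIcc_zero_one])

lemma intervalIntegrable_sub {E : Type*} [NormedAddCommGroup E] {f : ℝ → E}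
    (hf : IntervalIntegrable f volume 0 1) {a b : ℝ} (ha : a ∈ I) (hb : b ∈ I) :
    IntervalIntegrable f volume a b :=
  hf.mono_set (by rw [uIcc_zero_one]; exact uIcc_subset_Icc ha hb)

lemma ae_restrict_I {p : ℝ → Prop} (h : ∀ᵐ x, x ∈ Ioo (0 : ℝ) 1 → p x) :
    ∀ᵐ x ∂(volume.restrict I), p x := by
  rw [ae_restrict_iff' measurableSet_Icc]
  have h₁ : ∀ᵐ x : ℝ, x ≠ 0 := by simp [ae_iff, measure_singleton]
  have h₂ : ∀ᵐ x : ℝ, x ≠ 1 := by simp [ae_iff, measure_singleton]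
  filter_upwards [h, h₁, h₂] with x hx h1 h2 hI
  exact hx ⟨lt_of_le_of_ne hI.1 (Ne.symm h1), lt_of_le_of_ne hI.2 h2⟩

lemma ae_restrict_I_mem {p : ℝ → Prop} (h : ∀ᵐ x ∂(volume.restrict I), p x) :
    ∀ᵐ x, x ∈ I → p x := (ae_restrict_iff' measurableSet_Icc).1 h

lemma ae_restrict_I_interior : ∀ᵐ x ∂(volume.restrict I), x ∈ Ioo (0 : ℝ) 1 :=
  ae_restrict_I (by simp)

lemma I_mem_nhds {x : ℝ} (hx : x ∈ Ioo (0 : ℝ) 1) : I ∈ 𝓝 x := Icc_mem_nhds hx.1 hx.2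

lemma ds_of_hasDerivWithinAt {γ : ℝ → Plane} {v : Plane} {s : ℝ} (hs : s ∈ I)
    (h : HasDerivWithinAt γ v I s) : ds γ s = v :=
  h.derivWithin (uniqueDiffOn_I s hs)

namespace IsPrimitive

variable {E : Type*} [NormedAddCommGroup E] [NormedSpace ℝ E] {f g : ℝ → E}

lemma sub_eq (h : IsPrimitive f g) {a b : ℝ} (ha : a ∈ I) (hb : b ∈ I) :
    f b - f a = ∫ r in a..b, g r := by
  rw [h.eq_integral b hb, h.eq_integral a ha, add_sub_add_left_eq_sub,
    intervalIntegral.integral_interval_sub_left]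
  · exact intervalIntegrable_sub h.intervalIntegrable zero_mem_I hb
  · exact intervalIntegrable_sub h.intervalIntegrable zero_mem_I ha

lemma continuousOn (h : IsPrimitive f g) : ContinuousOn f I := by
  have := intervalIntegral.continuousOn_primitive_interval'
    (b₁ := (0 : ℝ)) (b₂ := 1) h.intervalIntegrable (a := 0) left_mem_uIcc
  rw [uIcc_zero_one] at this
  exact (continuousOn_const.add this).congr fun s hs => h.eq_integral s hs

variable [CompleteSpace E]

lemma hasDerivAt_ae (h : IsPrimitive f g) :
    ∀ᵐ x ∂(volume.restrict I), HasDerivAt f (g x) x := by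
  apply ae_restrict_I
  filter_upwards [h.intervalIntegrable.ae_hasDerivAt_integral] with x hx hI
  have hx' := (hx (by rw [uIcc_zero_one]; exact Ioo_subset_Icc_self hI) 0 left_mem_uIcc)
  refine (hx'.const_add (f 0)).congr_of_eventuallyEq ?_
  filter_upwards [I_mem_nhds hI] with y hy using h.eq_integral y hy

lemma hasDerivWithinAt (h : IsPrimitive f g) (hg : ContinuousOn g I) {s : ℝ} (hs : s ∈ I) :
    HasDerivWithinAt f (g s) I s := by
  have : Fact (s ∈ Icc (0 : ℝ) 1) := ⟨hs⟩
  have := intervalIntegral.integral_hasDerivWithinAt_right (s := I) (t := I)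
    (intervalIntegrable_sub h.intervalIntegrable zero_mem_I hs)
    (hg.stronglyMeasurableAtFilter_nhdsWithin measurableSet_Icc s) (hg s hs)
  exact (this.const_add (f 0)).congr (fun y hy => h.eq_integral y hy) (h.eq_integral s hs)

lemma of_hasDerivWithinAt (hg : ContinuousOn g I)
    (hf : ∀ s ∈ I, HasDerivWithinAt f (g s) I s) : IsPrimitive f g := by
  refine ⟨hg.intervalIntegrable_I, fun s hs => ?_⟩
  have hsub : Icc 0 s ⊆ I := Icc_subset_Icc le_rfl hs.2
  rw [intervalIntegral.integral_eq_sub_of_hasDerivAt_of_le hs.1 (f := f)]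
  · simp
  · exact fun x hx => ((hf x (hsub hx)).continuousWithinAt).mono hsub
  · intro x hx
    exact (hf x (hsub (Ioo_subset_Icc_self hx))).hasDerivAt
      (I_mem_nhds ⟨hx.1, hx.2.trans_le hs.2⟩)
  · exact intervalIntegrable_sub hg.intervalIntegrable_I zero_mem_I hs

end IsPrimitive

lemma LipschitzWith.comp_absolutelyContinuousOnInterval {φ f : ℝ → ℝ} {a b : ℝ}
    (hφ : LipschitzWith 1 φ) (hf : AbsolutelyContinuousOnInterval f a b) :
    AbsolutelyContinuousOnInterval (fun x => φ (f x)) a b := by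
  rw [absolutelyContinuousOnInterval_iff] at hf ⊢
  intro ε hε
  obtain ⟨δ, hδ, h⟩ := hf ε hε
  refine ⟨δ, hδ, fun E hE hs => lt_of_le_of_lt (Finset.sum_le_sum fun i _ => ?_) (h E hE hs)⟩
  simpa using hφ.dist_le_mul (f (E.2 i).1) (f (E.2 i).2)

lemma AbsolutelyContinuousOnInterval.congr' {f g : ℝ → ℝ} {a b : ℝ}
    (hf : AbsolutelyContinuousOnInterval f a b) (h : EqOn f g (uIcc a b)) :
    AbsolutelyContinuousOnInterval g a b := by
  rw [absolutelyContinuousOnInterval_iff] at hf ⊢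
  intro ε hε
  obtain ⟨δ, hδ, h'⟩ := hf ε hε
  refine ⟨δ, hδ, fun E hE hs => ?_⟩
  convert h' E hE hs using 1
  refine Finset.sum_congr rfl fun i hi => ?_
  have := hE.1 i hi
  rw [h this.1, h this.2]

lemma absolutelyContinuous_const (c : ℝ) : AbsolutelyContinuousOnInterval (fun _ => c) 0 1 := by
  rw [absolutelyContinuousOnInterval_iff]
  intro ε hε
  exact ⟨1, one_pos, fun E _ _ => by simpa using hε⟩

lemma IsPrimitive.absolutelyContinuous {f g : ℝ → ℝ} (h : IsPrimitive f g) :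
    AbsolutelyContinuousOnInterval f 0 1 := by
  refine ((absolutelyContinuous_const (f 0)).fun_add
    (h.intervalIntegrable.absolutelyContinuousOnInterval_intervalIntegral
      (c := 0) left_mem_uIcc)).congr' ?_
  rw [uIcc_zero_one]
  exact fun s hs => (h.eq_integral s hs).symm

/-- Lebesgue's fundamental theorem of calculus. It reduces the product and chain rules below to a
pointwise derivative almost everywhere plus absolute continuity. -/
lemma IsPrimitive.of_absolutelyContinuous {f g : ℝ → ℝ}
    (hf : AbsolutelyContinuousOnInterval f 0 1)
    (h : ∀ᵐ x ∂(volume.restrict I), HasDerivAt f (g x) x) : IsPrimitive f g := by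
  have h' : deriv f =ᵐ[volume.restrict I] g := by
    filter_upwards [h] with x hx using hx.deriv
  refine ⟨?_, fun s hs => ?_⟩
  · have := hf.intervalIntegrable_deriv
    rw [intervalIntegrable_iff_I] at this ⊢
    exact this.congr h'
  · have h1 := (hf.mono (c := 0) (d := s) (by
      rw [uIcc_zero_one]; exact uIcc_subset_Icc zero_mem_I hs)).integral_deriv_eq_sub
    have h2 : ∫ x in (0 : ℝ)..s, deriv f x = ∫ x in (0 : ℝ)..s, g x := by
      apply intervalIntegral.integral_congr_ae
      filter_upwards [ae_restrict_I_mem h'] with x hx hxs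
      rw [uIoc_of_le hs.1] at hxs
      exact hx ⟨hxs.1.le, hxs.2.trans hs.2⟩
    rw [← h2, h1]; ring

lemma IsPrimitive.coord {f g : ℝ → Plane} (h : IsPrimitive f g) (i : Fin 2) :
    IsPrimitive (fun s => f s i) (fun s => g s i) := by
  let π : Plane →L[ℝ] ℝ := EuclideanSpace.proj i
  refine ⟨?_, fun s hs => ?_⟩
  · have := h.intervalIntegrable
    rw [intervalIntegrable_iff_I] at this ⊢
    exact π.integrable_comp this
  · have := congrArg π (h.eq_integral s hs)
    rw [map_add, ← π.intervalIntegral_comp_comm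
      (intervalIntegrable_sub h.intervalIntegrable zero_mem_I hs)] at this
    exact this

lemma IsPrimitive.of_coord {f g : ℝ → Plane}
    (h : ∀ i, IsPrimitive (fun s => f s i) (fun s => g s i)) : IsPrimitive f g := by
  have hint : IntervalIntegrable g volume 0 1 := by
    rw [intervalIntegrable_iff_I]
    have h2 : Integrable (fun s => WithLp.ofLp (g s)) (volume.restrict I) := by
      refine Integrable.of_eval fun i => ?_
      have := (h i).intervalIntegrable
      rwa [intervalIntegrable_iff_I] at this
    exact (PiLp.continuousLinearEquiv 2 ℝ (fun _ : Fin 2 => ℝ)).symm.toContinuousLinearMap.integrable_comp h2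
  refine ⟨hint, fun s hs => ?_⟩
  ext i
  let π : Plane →L[ℝ] ℝ := EuclideanSpace.proj i
  have h1 := (h i).eq_integral s hs
  have h2 : π (∫ r in (0 : ℝ)..s, g r) = ∫ r in (0 : ℝ)..s, π (g r) :=
    (π.intervalIntegral_comp_comm
      (intervalIntegrable_sub hint zero_mem_I hs)).symm
  have h3 : (f 0 + ∫ r in (0 : ℝ)..s, g r) i = f 0 i + π (∫ r in (0 : ℝ)..s, g r) := rfl
  rw [h3, h2]
  exact h1

/-- Sine and cosine are 1-Lipschitz, so their composition with an absolutely continuous angle stays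
absolutely continuous. -/
lemma IsPrimitive.dir_comp {θ ω : ℝ → ℝ} (h : IsPrimitive θ ω) (L : ℝ) :
    IsPrimitive (fun s => L • dir (θ s)) (fun s => (L * ω s) • nor (θ s)) := by
  refine IsPrimitive.of_coord fun i => ?_
  have hd := h.hasDerivAt_ae
  fin_cases i
  · refine IsPrimitive.of_absolutelyContinuous
      ((Real.lipschitzWith_cos.comp_absolutelyContinuousOnInterval
        h.absolutelyContinuous).const_mul L) ?_
    filter_upwards [hd] with x hx
    simpa [mul_assoc, mul_comm, mul_left_comm] using (hx.cos.const_mul L)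
  · refine IsPrimitive.of_absolutelyContinuous
      ((Real.lipschitzWith_sin.comp_absolutelyContinuousOnInterval
        h.absolutelyContinuous).const_mul L) ?_
    filter_upwards [hd] with x hx
    simpa [mul_assoc, mul_comm, mul_left_comm] using (hx.sin.const_mul L)

lemma IsPrimitive.inner {f f' g g' : ℝ → Plane} (hf : IsPrimitive f f') (hg : IsPrimitive g g') :
    IsPrimitive (fun s => ⟪f s, g s⟫) (fun s => ⟪f' s, g s⟫ + ⟪f s, g' s⟫) := by
  have h : AbsolutelyContinuousOnInterval (fun s => ⟪f s, g s⟫) 0 1 := by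
    simp only [plane_inner]
    exact ((hf.coord 0).absolutelyContinuous.fun_mul (hg.coord 0).absolutelyContinuous).fun_add
      ((hf.coord 1).absolutelyContinuous.fun_mul (hg.coord 1).absolutelyContinuous)
  refine IsPrimitive.of_absolutelyContinuous h ?_
  filter_upwards [hf.hasDerivAt_ae, hg.hasDerivAt_ae] with x h1 h2
  rw [add_comm]
  exact h1.inner ℝ h2

lemma IsPrimitive.add {E : Type*} [NormedAddCommGroup E] [NormedSpace ℝ E] {f f' g g' : ℝ → E}
    (hf : IsPrimitive f f') (hg : IsPrimitive g g') :
    IsPrimitive (fun s => f s + g s) (fun s => f' s + g' s) := by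
  refine ⟨hf.1.add hg.1, fun s hs => ?_⟩
  rw [intervalIntegral.integral_add (intervalIntegrable_sub hf.1 zero_mem_I hs)
    (intervalIntegrable_sub hg.1 zero_mem_I hs), hf.2 s hs, hg.2 s hs]
  abel

lemma IsPrimitive.sub {E : Type*} [NormedAddCommGroup E] [NormedSpace ℝ E] {f f' g g' : ℝ → E}
    (hf : IsPrimitive f f') (hg : IsPrimitive g g') :
    IsPrimitive (fun s => f s - g s) (fun s => f' s - g' s) := by
  refine ⟨hf.1.sub hg.1, fun s hs => ?_⟩
  rw [intervalIntegral.integral_sub (intervalIntegrable_sub hf.1 zero_mem_I hs)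
    (intervalIntegrable_sub hg.1 zero_mem_I hs), hf.2 s hs, hg.2 s hs]
  abel

lemma IsPrimitive.const_smul {E : Type*} [NormedAddCommGroup E] [NormedSpace ℝ E]
    {f f' : ℝ → E} (hf : IsPrimitive f f') (r : ℝ) :
    IsPrimitive (fun s => r • f s) (fun s => r • f' s) := by
  refine ⟨hf.1.smul r, fun s hs => ?_⟩
  rw [intervalIntegral.integral_smul, hf.2 s hs, smul_add]


/-! ### Curves of constant speed in polar form -/

/-- `γ` has constant speed `L > 0` and tangent angle `θ`, with square integrable derivative `ω`. -/
structure Polar (γ : ℝ → Plane) (L : ℝ) (θ ω : ℝ → ℝ) : Prop where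
  pos : 0 < L
  memLp : MemLp ω 2 (volume.restrict I)
  angle : IsPrimitive θ ω
  curve : IsPrimitive γ (fun s => L • dir (θ s))

lemma memLp_two_intervalIntegrable {E : Type*} [NormedAddCommGroup E] {ω : ℝ → E}
    (h : MemLp ω 2 (volume.restrict I)) : IntervalIntegrable ω volume 0 1 := by
  rw [intervalIntegrable_iff_I]
  exact h.integrable one_le_two

lemma integrable_sq_I {ω : ℝ → ℝ}
    (h : MemLp ω 2 (volume.restrict I)) : IntervalIntegrable (fun s => ω s ^ 2) volume 0 1 := by
  rw [intervalIntegrable_iff_I]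
  exact h.integrable_sq

lemma memLp_two_of_ae_bound {E F : Type*} [NormedAddCommGroup E] [NormedAddCommGroup F]
    {f : ℝ → E} {g : ℝ → F}
    (hg : MemLp g 2 (volume.restrict I)) (hf : AEStronglyMeasurable f (volume.restrict I))
    (C : ℝ) (h : ∀ᵐ s ∂(volume.restrict I), ‖f s‖ ≤ C * ‖g s‖) :
    MemLp f 2 (volume.restrict I) :=
  hg.of_le_mul hf h

lemma MemH2.ds_isPrimitive {γ : ℝ → Plane} (h : MemH2 γ) : IsPrimitive (ds γ) (dss γ) :=
  ⟨memLp_two_intervalIntegrable h.memLp_dss, h.ds_eq⟩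

lemma MemH2.hasDerivWithinAt {γ : ℝ → Plane} (h : MemH2 γ) {s : ℝ} (hs : s ∈ I) :
    HasDerivWithinAt γ (ds γ s) I s :=
  (h.differentiableOn s hs).hasDerivWithinAt

lemma MemH2.isPrimitive {γ : ℝ → Plane} (h : MemH2 γ) : IsPrimitive γ (ds γ) :=
  IsPrimitive.of_hasDerivWithinAt h.ds_isPrimitive.continuousOn fun _ hs => h.hasDerivWithinAt hs

/-- A primitive of a primitive of a square integrable function lies in `H²`. -/
lemma memH2_of_isPrimitive {γ v w : ℝ → Plane} (hγ : IsPrimitive γ v) (hv : IsPrimitive v w)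
    (hw : MemLp w 2 (volume.restrict I)) :
    MemH2 γ ∧ EqOn (ds γ) v I ∧ dss γ =ᵐ[volume.restrict I] w := by
  have hd : ∀ s ∈ I, HasDerivWithinAt γ (v s) I s :=
    fun s hs => hγ.hasDerivWithinAt hv.continuousOn hs
  have h1 : EqOn (ds γ) v I := fun s hs => ds_of_hasDerivWithinAt hs (hd s hs)
  have h2 : dss γ =ᵐ[volume.restrict I] w := by
    filter_upwards [hv.hasDerivAt_ae, ae_restrict_I_interior] with s hs hI
    have hI' := Ioo_subset_Icc_self hI
    refine HasDerivWithinAt.derivWithin ?_ (uniqueDiffOn_I s hI')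
    exact hs.hasDerivWithinAt.congr (fun y hy => h1 hy) (h1 hI')
  refine ⟨⟨fun s hs => (hd s hs).differentiableWithinAt, (memLp_congr_ae h2).2 hw, ?_⟩, h1, h2⟩
  intro s hs
  rw [h1 hs, h1 zero_mem_I, hv.eq_integral s hs]
  congr 1
  apply intervalIntegral.integral_congr_ae
  filter_upwards [ae_restrict_I_mem h2] with x hx hxs
  rw [uIoc_of_le hs.1] at hxs
  exact (hx ⟨hxs.1.le, hxs.2.trans hs.2⟩).symm

lemma continuous_nor : Continuous nor :=
  (LipschitzWith.of_dist_le_mul (K := 1) fun a b => by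
    simpa [dist_eq_norm] using norm_nor_sub_le a b).continuous

lemma rot_sub (a b : Plane) : rot (a - b) = rot a - rot b := by
  ext i; fin_cases i <;> simp; ring

lemma continuous_rot : Continuous rot :=
  (LipschitzWith.of_dist_le_mul (K := 1) fun a b => by
    simp [dist_eq_norm, ← rot_sub, norm_rot]).continuous

namespace Polar

variable {γ : ℝ → Plane} {L : ℝ} {θ ω : ℝ → ℝ}

lemma tangent (h : Polar γ L θ ω) :
    IsPrimitive (fun s => L • dir (θ s)) (fun s => (L * ω s) • nor (θ s)) :=
  h.angle.dir_comp L

lemma memLp_tangent (h : Polar γ L θ ω) :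
    MemLp (fun s => (L * ω s) • nor (θ s)) 2 (volume.restrict I) := by
  refine memLp_two_of_ae_bound h.memLp ?_ L (ae_of_all _ fun s => ?_)
  · exact ((intervalIntegrable_iff_I _).1 h.tangent.intervalIntegrable).aestronglyMeasurable
  · rw [norm_smul, norm_nor, norm_mul, mul_one, Real.norm_of_nonneg h.pos.le]

lemma memH2 (h : Polar γ L θ ω) : MemH2 γ :=
  (memH2_of_isPrimitive h.curve h.tangent h.memLp_tangent).1

lemma ds_eq (h : Polar γ L θ ω) {s : ℝ} (hs : s ∈ I) : ds γ s = L • dir (θ s) :=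
  (memH2_of_isPrimitive h.curve h.tangent h.memLp_tangent).2.1 hs

lemma dss_ae (h : Polar γ L θ ω) :
    ∀ᵐ s ∂(volume.restrict I), dss γ s = (L * ω s) • nor (θ s) :=
  (memH2_of_isPrimitive h.curve h.tangent h.memLp_tangent).2.2

lemma norm_ds (h : Polar γ L θ ω) {s : ℝ} (hs : s ∈ I) : ‖ds γ s‖ = L := by
  rw [h.ds_eq hs, norm_smul, norm_dir, mul_one, Real.norm_of_nonneg h.pos.le]

lemma length_eq (h : Polar γ L θ ω) : length γ = L := by
  unfold length
  rw [intervalIntegral.integral_congr (g := fun _ => L)]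
  · simp
  · rw [uIcc_zero_one]
    exact fun s hs => h.norm_ds hs

lemma admissible (h : Polar γ L θ ω) (hne : γ 0 ≠ γ 1) : Admissible γ :=
  ⟨h.memH2, fun s hs => by rw [h.norm_ds hs, h.length_eq], hne⟩

/-- Since `dss γ = L ω nor θ` and `‖ds γ‖ = L`, the curvature is `ω / L`; the arclength element
contributes one more factor `L`. -/
lemma bending (h : Polar γ L θ ω) :
    ∫ s in (0 : ℝ)..1, curvature γ s ^ 2 * ‖ds γ s‖ = (∫ s in (0 : ℝ)..1, ω s ^ 2) / L := by
  rw [← intervalIntegral.integral_div, intervalIntegral_eq_I, intervalIntegral_eq_I]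
  apply integral_congr_ae
  filter_upwards [h.dss_ae, ae_restrict_mem measurableSet_Icc] with s hs hI
  have hL := h.pos
  rw [curvature, h.norm_ds hI, hs, h.ds_eq hI, rot_smul, rot_dir, inner_smul_left,
    inner_smul_right, real_inner_self_eq_norm_sq, norm_nor]
  simp only [conj_trivial]
  field_simp

lemma energy_eq (h : Polar γ L θ ω) (ε : ℝ) :
    energy ε γ = L + ε / 2 * ((∫ s in (0 : ℝ)..1, ω s ^ 2) / L) - Real.log ‖γ 1 - γ 0‖ := by
  rw [energy, h.bending, h.length_eq]

lemma integral_sq_nonneg (ω : ℝ → ℝ) : 0 ≤ ∫ s in (0 : ℝ)..1, ω s ^ 2 :=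
  intervalIntegral.integral_nonneg zero_le_one fun _ _ => sq_nonneg _

/-- The angle is determined only up to full turns; this freedom is needed to compare the angles of
two nearby curves. -/
lemma add_two_pi_mul (h : Polar γ L θ ω) (n : ℤ) :
    Polar γ L (fun s => θ s + n * (2 * Real.pi)) ω := by
  refine ⟨h.pos, h.memLp, ⟨h.angle.1, fun s hs => ?_⟩, ?_⟩
  · change θ s + _ = θ 0 + _ + _
    rw [h.angle.2 s hs]; ring
  · simpa only [dir_add_two_pi_mul] using h.curve

end Polar

lemma Admissible.length_pos {γ : ℝ → Plane} (h : Admissible γ) : 0 < length γ := by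
  have h0 : 0 ≤ length γ := by rw [← h.norm_ds 0 zero_mem_I]; exact norm_nonneg _
  refine lt_of_le_of_ne h0 fun hL => h.endpoints_ne ?_
  have h1 := h.memH2.isPrimitive.eq_integral 1 one_mem_I
  rw [intervalIntegral.integral_congr (g := fun _ => (0 : Plane))] at h1
  · simpa using h1.symm
  · rw [uIcc_zero_one]
    intro s hs
    have := h.norm_ds s hs
    rwa [← hL, norm_eq_zero] at this

lemma IsPrimitive.const_of_ae_eq_zero {f f' : ℝ → ℝ} (h : IsPrimitive f f')
    (h0 : ∀ᵐ s ∂(volume.restrict I), f' s = 0) {s : ℝ} (hs : s ∈ I) : f s = f 0 := by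
  rw [h.eq_integral s hs, intervalIntegral.integral_congr_ae (g := fun _ => (0 : ℝ))]
  · simp
  · filter_upwards [ae_restrict_I_mem h0] with x hx hxs
    rw [uIoc_of_le hs.1] at hxs
    exact hx ⟨hxs.1.le, hxs.2.trans hs.2⟩

/-- Constant speed forces `dss γ` to be orthogonal to `ds γ`, hence a multiple `ω` of its rotation.
Integrating `ω` gives an angle whose frame turns together with the tangent, so the coordinates of
the tangent in this frame are constant. -/
lemma Admissible.exists_polar {γ : ℝ → Plane} (h : Admissible γ) :
    ∃ θ ω, Polar γ (length γ) θ ω := by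
  set L := length γ with hLdef
  have hL : 0 < L := h.length_pos
  have hv := h.memH2.ds_isPrimitive
  set v := ds γ with hvdef
  set w := dss γ with hwdef
  have hn : ∀ s ∈ I, ‖v s‖ = L := h.norm_ds
  have hperp : ∀ᵐ s ∂(volume.restrict I), ⟪w s, v s⟫ = 0 := by
    filter_upwards [hv.hasDerivAt_ae, ae_restrict_I_interior] with s hs hI
    have h1 := hs.norm_sq
    have h2 : HasDerivAt (fun s => ‖v s‖ ^ 2) 0 s := by
      refine (hasDerivAt_const s (L ^ 2)).congr_of_eventuallyEq ?_
      filter_upwards [I_mem_nhds hI] with y hy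
      rw [hn y hy]
    have h3 := h1.unique h2
    rw [real_inner_comm]
    linarith
  obtain ⟨θ₀, hθ₀⟩ := exists_eq_smul_dir (v 0)
  rw [hn 0 zero_mem_I] at hθ₀
  let ω : ℝ → ℝ := fun s => ⟪w s, rot (v s)⟫ / L ^ 2
  have hrotv : ContinuousOn (fun s => rot (v s)) I :=
    continuous_rot.comp_continuousOn hv.continuousOn
  have hωL : MemLp ω 2 (volume.restrict I) := by
    refine memLp_two_of_ae_bound h.memH2.memLp_dss ?_ (1 / L) ?_
    · exact (h.memH2.memLp_dss.1.inner
        (hrotv.aestronglyMeasurable measurableSet_Icc)).mul_const _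
    · filter_upwards [ae_restrict_mem measurableSet_Icc] with s hs
      have h1 := norm_inner_le_norm (𝕜 := ℝ) (w s) (rot (v s))
      rw [norm_rot, hn s hs] at h1
      simp only [ω, norm_div, norm_pow, Real.norm_of_nonneg hL.le]
      rw [div_mul_eq_mul_div, one_mul, div_le_div_iff₀ (by positivity) hL]
      nlinarith
  let θ : ℝ → ℝ := fun s => θ₀ + ∫ r in (0 : ℝ)..s, ω r
  have hθ : IsPrimitive θ ω := ⟨memLp_two_intervalIntegrable hωL, fun s hs => by simp [θ]⟩
  have hw : ∀ᵐ s ∂(volume.restrict I), w s = ω s • rot (v s) := by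
    filter_upwards [hperp, ae_restrict_mem measurableSet_Icc] with s hs hI
    have hne : v s ≠ 0 := by
      rw [← norm_ne_zero_iff, hn s hI]; exact hL.ne'
    have := eq_smul_rot_of_inner_eq_zero hne hs
    rwa [hn s hI] at this
  have hdir : IsPrimitive (fun s => dir (θ s)) (fun s => ω s • nor (θ s)) := by
    simpa using hθ.dir_comp 1
  have hnor : IsPrimitive (fun s => nor (θ s)) (fun s => -ω s • dir (θ s)) := by
    have := (IsPrimitive.of_coord (f := fun s => nor (θ s)) (g := fun s => -ω s • dir (θ s))
      fun i => ?_)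
    · exact this
    · fin_cases i
      · simpa using (hdir.coord 1).const_smul (-1)
      · simpa using hdir.coord 0
  -- Both coordinates of `v` in the moving frame have zero derivative almost everywhere; at `0` they
  -- are `L` and `0` by the choice of `θ₀`.
  have hX : ∀ s ∈ I, ⟪v s, dir (θ s)⟫ = L := by
    intro s hs
    rw [(hv.inner hdir).const_of_ae_eq_zero ?_ hs]
    · simp only [θ, intervalIntegral.integral_same, add_zero]
      rw [hθ₀, inner_smul_left, real_inner_self_eq_norm_sq, norm_dir]
      simp
    · filter_upwards [hw] with r hr
      rw [hr, inner_smul_left, inner_smul_right, inner_rot_left, rot_dir]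
      simp
  have hY : ∀ s ∈ I, ⟪v s, nor (θ s)⟫ = 0 := by
    intro s hs
    rw [(hv.inner hnor).const_of_ae_eq_zero ?_ hs]
    · simp only [θ, intervalIntegral.integral_same, add_zero]
      rw [hθ₀, inner_smul_left, ← rot_dir, inner_rot_self, mul_zero]
    · filter_upwards [hw] with r hr
      rw [hr, inner_smul_left, inner_smul_right, ← rot_dir]
      simp [plane_inner]
      ring
  have hvθ : ∀ s ∈ I, v s = L • dir (θ s) := by
    intro s hs
    have := eq_inner_dir_add_inner_nor (v s) (θ s)
    rwa [hX s hs, hY s hs, zero_smul, add_zero] at this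
  refine ⟨θ, ω, hL, hωL, hθ, ?_⟩
  have hc := h.memH2.isPrimitive
  refine ⟨(hθ.dir_comp L).continuousOn.intervalIntegrable_I, fun s hs => ?_⟩
  rw [hc.eq_integral s hs]
  congr 1
  apply intervalIntegral.integral_congr
  intro r hr
  rw [uIcc_of_le hs.1] at hr
  exact hvθ r ⟨hr.1, hr.2.trans hs.2⟩


/-! ### Bounds from the energy and coercivity of the dissipation -/

lemma cauchy_schwarz_I {f g : ℝ → ℝ} (hf : MemLp f 2 (volume.restrict I))
    (hg : MemLp g 2 (volume.restrict I)) :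
    (∫ s in (0 : ℝ)..1, |f s| * |g s|) ^ 2 ≤
      (∫ s in (0 : ℝ)..1, f s ^ 2) * ∫ s in (0 : ℝ)..1, g s ^ 2 := by
  have hff := integrable_sq_I hf
  have hgg := integrable_sq_I hg
  have hfg : IntervalIntegrable (fun s => |f s| * |g s|) volume 0 1 := by
    rw [intervalIntegrable_iff_I]
    exact hf.abs.integrable_mul hg.abs
  have key : ∀ x : ℝ, 0 ≤ (∫ s in (0 : ℝ)..1, f s ^ 2) * (x * x)
      + (2 * ∫ s in (0 : ℝ)..1, |f s| * |g s|) * x + ∫ s in (0 : ℝ)..1, g s ^ 2 := by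
    intro x
    have h : 0 ≤ ∫ s in (0 : ℝ)..1, (|f s| * x + |g s|) ^ 2 :=
      intervalIntegral.integral_nonneg zero_le_one fun _ _ => sq_nonneg _
    have h2 : ∫ s in (0 : ℝ)..1, (|f s| * x + |g s|) ^ 2 =
        ∫ s in (0 : ℝ)..1, (f s ^ 2 * (x * x) + |f s| * |g s| * (2 * x) + g s ^ 2) := by
      refine intervalIntegral.integral_congr fun s _ => ?_
      simp only [← sq_abs (f s), ← sq_abs (g s)]
      ring
    rw [h2, intervalIntegral.integral_add ((hff.mul_const _).add (hfg.mul_const _)) hgg,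
      intervalIntegral.integral_add (hff.mul_const _) (hfg.mul_const _),
      intervalIntegral.integral_mul_const, intervalIntegral.integral_mul_const] at h
    linarith
  have := discrim_le_zero key
  rw [discrim] at this
  linarith

lemma integral_abs_mul_le {f g : ℝ → ℝ} (hf : MemLp f 2 (volume.restrict I))
    (hg : MemLp g 2 (volume.restrict I)) {a b : ℝ} (ha : 0 ≤ a) (hb : 0 ≤ b)
    (hfa : ∫ s in (0 : ℝ)..1, f s ^ 2 ≤ a ^ 2) (hgb : ∫ s in (0 : ℝ)..1, g s ^ 2 ≤ b ^ 2) :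
    ∫ s in (0 : ℝ)..1, |f s| * |g s| ≤ a * b := by
  refine abs_le_of_sq_le_sq' ?_ (by positivity) |>.2
  refine (cauchy_schwarz_I hf hg).trans ?_
  rw [mul_pow]
  exact mul_le_mul hfa hgb (Polar.integral_sq_nonneg g) (by positivity)

lemma ContinuousOn.memLp_I {E : Type*} [NormedAddCommGroup E] {f : ℝ → E}
    (hf : ContinuousOn f I) (p : ℝ≥0∞) : MemLp f p (volume.restrict I) := by
  obtain ⟨C, hC⟩ := isCompact_Icc.exists_bound_of_continuousOn hf
  refine MemLp.of_bound (hf.aestronglyMeasurable_of_isCompact isCompact_Icc measurableSet_Icc) C ?_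
  filter_upwards [ae_restrict_mem measurableSet_Icc] with s hs using hC s hs

lemma integral_norm_le_of_sq {E : Type*} [NormedAddCommGroup E] {f : ℝ → E}
    (hf : ContinuousOn f I) {a : ℝ} (ha : 0 ≤ a)
    (h : ∫ s in (0 : ℝ)..1, ‖f s‖ ^ 2 ≤ a ^ 2) : ∫ s in (0 : ℝ)..1, ‖f s‖ ≤ a := by
  have := integral_abs_mul_le (f := fun s => ‖f s‖) (g := fun _ => 1) (b := 1)
    (ContinuousOn.memLp_I hf.norm 2)
    (ContinuousOn.memLp_I continuousOn_const 2) ha zero_le_one h (by simp)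
  simpa using this

/-- Two-sided bounds for the length, a lower bound for the distance of the endpoints, and an upper
bound for the bending energy. -/
structure Controlled (m M : ℝ) (γ : ℝ → Plane) (L : ℝ) (ω : ℝ → ℝ) : Prop where
  le_dist : m ≤ ‖γ 1 - γ 0‖
  le_length : m ≤ L
  length_le : L ≤ M
  integral_sq_le : ∫ s in (0 : ℝ)..1, ω s ^ 2 ≤ M ^ 2

namespace Polar

variable {γ : ℝ → Plane} {L : ℝ} {θ ω : ℝ → ℝ}

lemma lipschitz (h : Polar γ L θ ω) {a b : ℝ} (ha : a ∈ I) (hb : b ∈ I) :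
    ‖γ b - γ a‖ ≤ L * |b - a| := by
  rw [h.curve.sub_eq ha hb]
  refine intervalIntegral.norm_integral_le_of_norm_le_const fun s _ => ?_
  rw [norm_smul, norm_dir, mul_one, Real.norm_of_nonneg h.pos.le]

lemma dist_endpoints_le (h : Polar γ L θ ω) : ‖γ 1 - γ 0‖ ≤ L := by
  simpa using h.lipschitz zero_mem_I one_mem_I

/-- The chord is at most `L`, and `log L = log (L / 2) + log 2 ≤ L / 2 - 1 + log 2 < L / 2`, so half
of the length absorbs the logarithm. -/
lemma half_length_le (h : Polar γ L θ ω) (hne : γ 0 ≠ γ 1) :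
    L / 2 ≤ L - Real.log ‖γ 1 - γ 0‖ := by
  have hd : 0 < ‖γ 1 - γ 0‖ := by rw [norm_pos_iff, sub_ne_zero]; exact hne.symm
  have h1 := Real.log_le_log hd h.dist_endpoints_le
  have h2 := Real.log_le_sub_one_of_pos (x := L / 2) (by linarith [h.pos])
  rw [Real.log_div h.pos.ne' two_ne_zero] at h2
  linarith [Real.log_two_lt_d9]

lemma half_length_le_energy (h : Polar γ L θ ω) (hne : γ 0 ≠ γ 1) {ε : ℝ} (hε : 0 < ε) :
    L / 2 ≤ energy ε γ := by
  rw [h.energy_eq]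
  have := h.half_length_le hne
  have h2 : 0 ≤ ε / 2 * ((∫ s in (0 : ℝ)..1, ω s ^ 2) / L) :=
    mul_nonneg (by positivity) (div_nonneg (integral_sq_nonneg ω) h.pos.le)
  linarith

/-- The preceding bound gives `L ≤ 2 E`, then `∫ ω ^ 2 ≤ 2 E L / ε ≤ 4 E ^ 2 / ε`, while the
logarithm alone bounds the chord from below. The final `+ 1` makes the upper constant at least `1`,
so that it is below its own square. -/
lemma controlled (h : Polar γ L θ ω) (hne : γ 0 ≠ γ 1) {ε E : ℝ} (hε : 0 < ε)
    (hE : energy ε γ ≤ E) :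
    Controlled (Real.exp (-E)) (2 * E + 4 * E ^ 2 / ε + 1) γ L ω := by
  have hd : 0 < ‖γ 1 - γ 0‖ := by rw [norm_pos_iff, sub_ne_zero]; exact hne.symm
  have h1 := h.half_length_le hne
  have hL := h.pos
  have hw := integral_sq_nonneg ω
  have h2 : 0 ≤ ε / 2 * ((∫ s in (0 : ℝ)..1, ω s ^ 2) / L) := by positivity
  rw [h.energy_eq] at hE
  have hdist : Real.exp (-E) ≤ ‖γ 1 - γ 0‖ := by
    rw [← Real.le_log_iff_exp_le hd]; linarith
  have hE0 : 0 < E := by linarith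
  have h3 : ε / 2 * ((∫ s in (0 : ℝ)..1, ω s ^ 2) / L) ≤ E := by linarith
  have h4 : ∫ s in (0 : ℝ)..1, ω s ^ 2 ≤ 4 * E ^ 2 / ε := by
    rw [le_div_iff₀ hε]
    rw [mul_div_assoc', div_le_iff₀ hL] at h3
    nlinarith
  have h5 : 0 ≤ 4 * E ^ 2 / ε := by positivity
  refine ⟨hdist, hdist.trans h.dist_endpoints_le, by linarith, ?_⟩
  nlinarith

end Polar

/-- Size of the difference of two curves: endpoints and `L¹` norm. -/
noncomputable def size (g : ℝ → Plane) : ℝ := ‖g 0‖ + ‖g 1‖ + ∫ s in (0 : ℝ)..1, ‖g s‖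

lemma size_nonneg (g : ℝ → Plane) : 0 ≤ size g := by
  have : 0 ≤ ∫ s in (0 : ℝ)..1, ‖g s‖ :=
    intervalIntegral.integral_nonneg zero_le_one fun _ _ => norm_nonneg _
  unfold size; positivity

lemma dissipation_terms {γ γ' : ℝ → Plane} {L L' : ℝ} {θ ω θ' ω' : ℝ → ℝ}
    (h : Polar γ L θ ω) (h' : Polar γ' L' θ' ω') :
    dissipation γ γ' =
      1 / (4 * L') * (∫ s in (0 : ℝ)..1, ⟪γ s - γ' s, L' • nor (θ' s)⟫ ^ 2)
      + 1 / (4 * L) * (∫ s in (0 : ℝ)..1, ⟪γ s - γ' s, L • nor (θ s)⟫ ^ 2)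
      + 1 / 2 * ‖γ 0 - γ' 0‖ ^ 2 + 1 / 2 * ‖γ 1 - γ' 1‖ ^ 2 := by
  rw [dissipation, h.length_eq, h'.length_eq]
  have e1 : ∫ s in (0 : ℝ)..1, ⟪γ s - γ' s, rot (ds γ' s)⟫ ^ 2 =
      ∫ s in (0 : ℝ)..1, ⟪γ s - γ' s, L' • nor (θ' s)⟫ ^ 2 := by
    refine intervalIntegral.integral_congr fun s hs => ?_
    rw [uIcc_zero_one] at hs
    simp only [h'.ds_eq hs, rot_smul, rot_dir]
  have e2 : ∫ s in (0 : ℝ)..1, ⟪γ s - γ' s, rot (ds γ s)⟫ ^ 2 =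
      ∫ s in (0 : ℝ)..1, ⟪γ s - γ' s, L • nor (θ s)⟫ ^ 2 := by
    refine intervalIntegral.integral_congr fun s hs => ?_
    rw [uIcc_zero_one] at hs
    simp only [h.ds_eq hs, rot_smul, rot_dir]
  rw [e1, e2]

lemma dissipation_nonneg {γ γ' : ℝ → Plane} {L L' : ℝ} {θ ω θ' ω' : ℝ → ℝ}
    (h : Polar γ L θ ω) (h' : Polar γ' L' θ' ω') : 0 ≤ dissipation γ γ' := by
  rw [dissipation_terms h h']
  have := h.pos
  have := h'.pos
  have h1 : 0 ≤ ∫ s in (0 : ℝ)..1, ⟪γ s - γ' s, L' • nor (θ' s)⟫ ^ 2 :=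
    Polar.integral_sq_nonneg _
  have h2 : 0 ≤ ∫ s in (0 : ℝ)..1, ⟪γ s - γ' s, L • nor (θ s)⟫ ^ 2 :=
    Polar.integral_sq_nonneg _
  positivity

lemma integral_norm_sq_le_of_pointwise {δ : ℝ → Plane} {x y : ℝ → ℝ} (hδ : ContinuousOn δ I)
    (hx : ContinuousOn x I) (hy : ContinuousOn y I) {a b k : ℝ}
    (h : ∀ s ∈ I, a * ‖δ s‖ ^ 2 ≤ k + (2 * x s ^ 2 + 2 * y s ^ 2))
    (hxb : ∫ s in (0 : ℝ)..1, x s ^ 2 ≤ b) (hyb : ∫ s in (0 : ℝ)..1, y s ^ 2 ≤ b) :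
    a * ∫ s in (0 : ℝ)..1, ‖δ s‖ ^ 2 ≤ k + 4 * b := by
  have ix : IntervalIntegrable (fun s => 2 * x s ^ 2) volume 0 1 :=
    ContinuousOn.intervalIntegrable_I (continuousOn_const.mul (hx.pow 2))
  have iy : IntervalIntegrable (fun s => 2 * y s ^ 2) volume 0 1 :=
    ContinuousOn.intervalIntegrable_I (continuousOn_const.mul (hy.pow 2))
  have iδ : IntervalIntegrable (fun s => a * ‖δ s‖ ^ 2) volume 0 1 :=
    ContinuousOn.intervalIntegrable_I (continuousOn_const.mul (hδ.norm.pow 2))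
  have ik : IntervalIntegrable (fun _ => k) volume (0 : ℝ) 1 := by simp
  have e1 := intervalIntegral.integral_mono_on zero_le_one iδ (ik.add (ix.add iy)) h
  rw [intervalIntegral.integral_const_mul, intervalIntegral.integral_add ik (ix.add iy),
    intervalIntegral.integral_add ix iy, intervalIntegral.integral_const_mul,
    intervalIntegral.integral_const_mul, intervalIntegral.integral_const] at e1
  simp only [sub_zero, one_smul] at e1
  linarith

-- Coercivity of the dissipation. The normal components `x`, `x'` of the displacement `δ = γ - γ'`
-- are bounded in `L²` by the dissipation. Pairing `δ` with the sum `w` of the two tangents gives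
-- the missing component: its derivative is `L ^ 2 - L' ^ 2` plus terms in `x` and `x'`, and its
-- endpoint values are controlled. The sign condition keeps `w` away from zero, so the components of
-- `δ` along `w` and `rot w` bound `δ`.
set_option maxHeartbeats 800000 in
lemma size_le_of_dissipation {m M : ℝ} (hm : 0 < m) (hM : 1 ≤ M) {γ γ' : ℝ → Plane} {L L' : ℝ}
    {θ ω θ' ω' : ℝ → ℝ} (h : Polar γ L θ ω) (h' : Polar γ' L' θ' ω')
    (hc : Controlled m M γ L ω) (hc' : Controlled m M γ' L' ω')
    (hpos : ∀ s ∈ I, 0 ≤ ⟪ds γ s, ds γ' s⟫) :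
    size (fun s => γ s - γ' s) ≤ (4 + 15 * M ^ 2 / m) * √(dissipation γ γ') := by
  set d := √(dissipation γ γ') with hd
  have hd0 : 0 ≤ d := Real.sqrt_nonneg _
  have hD : dissipation γ γ' = d ^ 2 := (Real.sq_sqrt (dissipation_nonneg h h')).symm
  rw [dissipation_terms h h'] at hD
  have hL := h.pos
  have hL' := h'.pos
  set x : ℝ → ℝ := fun s => ⟪γ s - γ' s, L • nor (θ s)⟫ with hx
  set x' : ℝ → ℝ := fun s => ⟪γ s - γ' s, L' • nor (θ' s)⟫ with hx'
  have hδ := h.curve.sub h'.curve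
  have hxc : ContinuousOn x I := hδ.continuousOn.inner
    ((continuous_nor.comp_continuousOn h.angle.continuousOn).const_smul L)
  have hxc' : ContinuousOn x' I := hδ.continuousOn.inner
    ((continuous_nor.comp_continuousOn h'.angle.continuousOn).const_smul L')
  have ix := Polar.integral_sq_nonneg x
  have ix' := Polar.integral_sq_nonneg x'
  have i1 : 0 ≤ 1 / (4 * L') * (∫ s in (0 : ℝ)..1, x' s ^ 2) := by positivity
  have i2 : 0 ≤ 1 / (4 * L) * (∫ s in (0 : ℝ)..1, x s ^ 2) := by positivity
  have i3 := sq_nonneg ‖γ 0 - γ' 0‖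
  have i4 := sq_nonneg ‖γ 1 - γ' 1‖
  have bx : ∫ s in (0 : ℝ)..1, x s ^ 2 ≤ (2 * M * d) ^ 2 := by
    have : 1 / (4 * L) * (∫ s in (0 : ℝ)..1, x s ^ 2) ≤ d ^ 2 := by linarith
    rw [div_mul_eq_mul_div, one_mul, div_le_iff₀ (by positivity)] at this
    nlinarith [hc.length_le, sq_nonneg d, mul_nonneg (sq_nonneg d) (sub_nonneg.2 hc.length_le),
      mul_nonneg (mul_nonneg (sq_nonneg d) (sub_nonneg.2 hM)) (zero_le_one.trans hM)]
  have bx' : ∫ s in (0 : ℝ)..1, x' s ^ 2 ≤ (2 * M * d) ^ 2 := by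
    have : 1 / (4 * L') * (∫ s in (0 : ℝ)..1, x' s ^ 2) ≤ d ^ 2 := by linarith
    rw [div_mul_eq_mul_div, one_mul, div_le_iff₀ (by positivity)] at this
    nlinarith [hc'.length_le, sq_nonneg d, mul_nonneg (sq_nonneg d) (sub_nonneg.2 hc'.length_le),
      mul_nonneg (mul_nonneg (sq_nonneg d) (sub_nonneg.2 hM)) (zero_le_one.trans hM)]
  have b0 : ‖γ 0 - γ' 0‖ ≤ 2 * d :=
    (abs_le_of_sq_le_sq' (by nlinarith) (by positivity)).2
  have b1 : ‖γ 1 - γ' 1‖ ≤ 2 * d :=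
    (abs_le_of_sq_le_sq' (by nlinarith) (by positivity)).2
  have p1 := integral_abs_mul_le h.memLp (ContinuousOn.memLp_I hxc 2) (a := M) (b := 2 * M * d)
    (by linarith) (by positivity) hc.integral_sq_le bx
  have p2 := integral_abs_mul_le h'.memLp (ContinuousOn.memLp_I hxc' 2) (a := M) (b := 2 * M * d)
    (by linarith) (by positivity) hc'.integral_sq_le bx'
  have q1 : IntervalIntegrable (fun s => |ω s| * |x s|) volume 0 1 := by
    rw [intervalIntegrable_iff_I]
    exact h.memLp.abs.integrable_mul (ContinuousOn.memLp_I hxc 2).abs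
  have q2 : IntervalIntegrable (fun s => |ω' s| * |x' s|) volume 0 1 := by
    rw [intervalIntegrable_iff_I]
    exact h'.memLp.abs.integrable_mul (ContinuousOn.memLp_I hxc' 2).abs
  have r1 : IntervalIntegrable (fun s => ω s * x s) volume 0 1 := by
    rw [intervalIntegrable_iff_I]
    exact h.memLp.integrable_mul (ContinuousOn.memLp_I hxc 2)
  have r2 : IntervalIntegrable (fun s => ω' s * x' s) volume 0 1 := by
    rw [intervalIntegrable_iff_I]
    exact h'.memLp.integrable_mul (ContinuousOn.memLp_I hxc' 2)
  set w : ℝ → Plane := fun s => L • dir (θ s) + L' • dir (θ' s) with hw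
  set f : ℝ → ℝ := fun s => ⟪γ s - γ' s, w s⟫ with hf
  -- Constant speed makes the product of the difference and the sum of the tangents the constant `L
  -- ^ 2 - L' ^ 2`; differentiating `w` produces exactly the normal components.
  have hfp : IsPrimitive f (fun s => (L ^ 2 - L' ^ 2) + (ω s * x s + ω' s * x' s)) := by
    have := hδ.inner (h.tangent.add h'.tangent)
    convert this using 2 with s
    have n1 : ⟪dir (θ s), dir (θ s)⟫ = 1 := by rw [real_inner_self_eq_norm_sq, norm_dir]; simp
    have n2 : ⟪dir (θ' s), dir (θ' s)⟫ = 1 := by rw [real_inner_self_eq_norm_sq, norm_dir]; simp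
    have n3 : ⟪dir (θ' s), dir (θ s)⟫ = ⟪dir (θ s), dir (θ' s)⟫ := real_inner_comm _ _
    simp only [hx, hx', inner_add_right, inner_sub_left, real_inner_smul_left,
      real_inner_smul_right, n1, n2, n3]
    ring
  have hint : ∀ s ∈ I, |∫ r in (0 : ℝ)..s, (ω r * x r + ω' r * x' r)| ≤ 4 * M ^ 2 * d := by
    intro s hs
    have e1 : |∫ r in (0 : ℝ)..s, (ω r * x r + ω' r * x' r)| ≤
        ∫ r in (0 : ℝ)..s, (|ω r| * |x r| + |ω' r| * |x' r|) := by
      rw [← Real.norm_eq_abs]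
      refine intervalIntegral.norm_integral_le_of_norm_le hs.1 (ae_of_all _ fun r _ => ?_)
        (intervalIntegrable_sub (q1.add q2) zero_mem_I hs)
      rw [Real.norm_eq_abs, ← abs_mul, ← abs_mul]
      exact abs_add_le _ _
    have e2 : ∫ r in (0 : ℝ)..s, (|ω r| * |x r| + |ω' r| * |x' r|) ≤
        ∫ r in (0 : ℝ)..1, (|ω r| * |x r| + |ω' r| * |x' r|) :=
      intervalIntegral.integral_mono_interval le_rfl hs.1 hs.2
        (ae_of_all _ fun r => by positivity) (q1.add q2)
    rw [intervalIntegral.integral_add q1 q2] at e2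
    nlinarith
  have hfs : ∀ s ∈ I, f s = f 0 + (s * (L ^ 2 - L' ^ 2)
      + ∫ r in (0 : ℝ)..s, (ω r * x r + ω' r * x' r)) := by
    intro s hs
    rw [hfp.eq_integral s hs, intervalIntegral.integral_add (by simp)
      (intervalIntegrable_sub (r1.add r2) zero_mem_I hs),
      intervalIntegral.integral_const, sub_zero, smul_eq_mul]
  have hwn : ∀ s, ‖w s‖ ≤ 2 * M := by
    intro s
    refine (norm_add_le _ _).trans ?_
    rw [norm_smul, norm_smul, norm_dir, norm_dir, Real.norm_of_nonneg hL.le,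
      Real.norm_of_nonneg hL'.le]
    linarith [hc.length_le, hc'.length_le]
  have hf0 : |f 0| ≤ 4 * M * d := by
    refine (abs_real_inner_le_norm _ _).trans ?_
    nlinarith [mul_le_mul b0 (hwn 0) (norm_nonneg _) (by positivity)]
  have hf1 : |f 1| ≤ 4 * M * d := by
    refine (abs_real_inner_le_norm _ _).trans ?_
    nlinarith [mul_le_mul b1 (hwn 1) (norm_nonneg _) (by positivity)]
  have hMM : M * d ≤ M ^ 2 * d :=
    mul_le_mul_of_nonneg_right (by nlinarith) hd0
  -- Evaluating `f` at the second endpoint leaves the difference of squared lengths as the only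
  -- uncontrolled term.
  have hLL : |L ^ 2 - L' ^ 2| ≤ 12 * M ^ 2 * d := by
    have e1 := hfs 1 one_mem_I
    have e2 := hint 1 one_mem_I
    rw [abs_le] at *
    constructor <;> linarith [hf0.1, hf0.2, hf1.1, hf1.2, e2.1, e2.2]
  have hfb : ∀ s ∈ I, |f s| ≤ 20 * M ^ 2 * d := by
    intro s hs
    have e1 := hfs s hs
    have e2 := hint s hs
    have e3 : |s * (L ^ 2 - L' ^ 2)| ≤ 12 * M ^ 2 * d := by
      rw [abs_mul, abs_of_nonneg hs.1]
      nlinarith [hs.2, abs_nonneg (L ^ 2 - L' ^ 2)]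
    rw [abs_le] at *
    constructor <;> linarith [hf0.1, hf0.2, e3.1, e3.2, e2.1, e2.2]
  have hpt : ∀ s ∈ I, 2 * m ^ 2 * ‖γ s - γ' s‖ ^ 2 ≤
      (20 * M ^ 2 * d) ^ 2 + (2 * x s ^ 2 + 2 * x' s ^ 2) := by
    intro s hs
    have e1 := inner_sq_add_inner_rot_sq (γ s - γ' s) (w s)
    have e2 : ⟪γ s - γ' s, rot (w s)⟫ = x s + x' s := by
      simp only [hw, rot_add, rot_smul, rot_dir, inner_add_right, hx, hx']
    -- Here the sign condition is used: the cross term in `‖w‖ ^ 2` is nonnegative.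
    have e3 : 2 * m ^ 2 ≤ ‖w s‖ ^ 2 := by
      have e4 := hpos s hs
      rw [h.ds_eq hs, h'.ds_eq hs] at e4
      simp only [hw]
      rw [norm_add_sq_real, norm_smul, norm_smul, norm_dir, norm_dir, Real.norm_of_nonneg hL.le,
        Real.norm_of_nonneg hL'.le]
      have e5 := pow_le_pow_left₀ hm.le hc.le_length 2
      have e6 := pow_le_pow_left₀ hm.le hc'.le_length 2
      linarith
    have e5 : f s ^ 2 ≤ (20 * M ^ 2 * d) ^ 2 := sq_le_sq' (abs_le.1 (hfb s hs)).1
      (abs_le.1 (hfb s hs)).2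
    rw [e2] at e1
    have e6 := mul_le_mul_of_nonneg_left e3 (sq_nonneg ‖γ s - γ' s‖)
    have e7 : (x s + x' s) ^ 2 ≤ 2 * (x s ^ 2 + x' s ^ 2) := add_sq_le
    have e8 : f s = ⟪γ s - γ' s, w s⟫ := rfl
    rw [e8] at e5
    linarith
  have hδc := hδ.continuousOn
  -- The constant is `(20 ^ 2 + 16) / 2 = 208`, rounded up to `15 ^ 2`.
  have hsq : ∫ s in (0 : ℝ)..1, ‖γ s - γ' s‖ ^ 2 ≤ (15 * M ^ 2 * d / m) ^ 2 := by
    have e1 := integral_norm_sq_le_of_pointwise hδc hxc hxc' hpt bx bx'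
    rw [div_pow, le_div_iff₀ (by positivity)]
    have e2 : M ^ 2 * d ^ 2 ≤ M ^ 4 * d ^ 2 :=
      mul_le_mul_of_nonneg_right (pow_le_pow_right₀ hM (by norm_num)) (sq_nonneg d)
    have e3 : 0 ≤ M ^ 4 * d ^ 2 := by positivity
    nlinarith
  have hfin := integral_norm_le_of_sq hδc (by positivity) hsq
  unfold size
  have : (4 + 15 * M ^ 2 / m) * d = 2 * d + 2 * d + 15 * M ^ 2 * d / m := by ring
  rw [this]
  linarith


/-! ### Interpolation estimates -/

lemma exists_subinterval {s ℓ : ℝ} (hs : s ∈ I) (hℓ0 : 0 < ℓ) (hℓ : ℓ ≤ 1) :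
    ∃ a, a ∈ I ∧ a + ℓ ∈ I ∧ s ∈ Icc a (a + ℓ) := by
  rcases le_total (s + ℓ) 1 with h | h
  · exact ⟨s, hs, ⟨by linarith [hs.1], h⟩, le_rfl, by linarith⟩
  · exact ⟨1 - ℓ, ⟨by linarith, by linarith⟩, ⟨by linarith, by linarith⟩, by linarith,
      by linarith [hs.2]⟩

/-- Average over an interval of length `r` containing `s`: the mean is at most `r ^ 2 / r = r`, and
the Lipschitz oscillation is at most `K r`. -/
lemma norm_le_of_integral_norm {g : ℝ → Plane} {K r : ℝ} (hr0 : 0 < r)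
    (hr : r ≤ 1) (hg : ∀ a ∈ I, ∀ b ∈ I, ‖g b - g a‖ ≤ K * |b - a|)
    (hgc : ContinuousOn g I) (hint : ∫ s in (0 : ℝ)..1, ‖g s‖ ≤ r ^ 2) {s : ℝ} (hs : s ∈ I)
    (hK : 0 ≤ K) : ‖g s‖ ≤ (K + 1) * r := by
  obtain ⟨a, ha, hb, hsa⟩ := exists_subinterval hs hr0 hr
  have hgi : IntervalIntegrable (fun s => ‖g s‖) volume 0 1 :=
    ContinuousOn.intervalIntegrable_I hgc.norm
  have e1 : ∫ x in a..(a + r), ‖g s‖ ≤ ∫ x in a..(a + r), (‖g x‖ + K * r) := by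
    refine intervalIntegral.integral_mono_on (by linarith) (by simp)
      ((intervalIntegrable_sub hgi ha hb).add (by simp)) fun x hx => ?_
    have hxI : x ∈ I := ⟨ha.1.trans hx.1, hx.2.trans hb.2⟩
    have h1 := hg x hxI s hs
    have h2 : |s - x| ≤ r := by
      rw [abs_le]; constructor <;> linarith [hx.1, hx.2, hsa.1, hsa.2]
    have h3 := norm_le_norm_add_norm_sub (g x) (g s)
    rw [norm_sub_rev] at h3
    nlinarith
  rw [intervalIntegral.integral_add (intervalIntegrable_sub hgi ha hb) (by simp)] at e1
  simp only [intervalIntegral.integral_const, add_sub_cancel_left, smul_eq_mul] at e1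
  have e2 : ∫ x in a..(a + r), ‖g x‖ ≤ ∫ x in (0 : ℝ)..1, ‖g x‖ :=
    intervalIntegral.integral_mono_interval ha.1 (by linarith) hb.2
      (ae_of_all _ fun x => norm_nonneg _) hgi
  have e3 : r * ‖g s‖ ≤ r * ((K + 1) * r) := by nlinarith
  exact le_of_mul_le_mul_left e3 hr0

/-- On an interval of length `r ^ 2` the increment of `g` is at most `2 r ^ 3`, so the mean of `v`
is at most `2 r`, and `v` oscillates by at most `K r`. -/
lemma norm_deriv_le_of_norm_le {g v : ℝ → Plane} {K r ρ : ℝ} (hr0 : 0 < r) (hr : r ≤ 1)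
    (hgv : IsPrimitive g v) (hv : ∀ a ∈ I, ∀ b ∈ I, ‖v b - v a‖ ≤ K * √|b - a|)
    (hρ : ρ ≤ r ^ 3) (hg : ∀ s ∈ I, ‖g s‖ ≤ ρ) (hK : 0 ≤ K) {s : ℝ} (hs : s ∈ I) :
    ‖v s‖ ≤ (K + 2) * r := by
  have hr2 : 0 < r ^ 2 := by positivity
  obtain ⟨a, ha, hb, hsa⟩ := exists_subinterval hs hr2 (by nlinarith)
  have e1 := hgv.sub_eq ha hb
  have hvi := intervalIntegrable_sub hgv.intervalIntegrable ha hb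
  have e2 : ∫ x in a..(a + r ^ 2), (v s - v x) = r ^ 2 • v s - (g (a + r ^ 2) - g a) := by
    rw [intervalIntegral.integral_sub (by simp) hvi, ← e1]
    simp
  have e3 : ‖∫ x in a..(a + r ^ 2), (v s - v x)‖ ≤ (K * r) * |a + r ^ 2 - a| := by
    refine intervalIntegral.norm_integral_le_of_norm_le_const fun x hx => ?_
    rw [uIoc_of_le (by linarith)] at hx
    refine (hv x ⟨ha.1.trans hx.1.le, hx.2.trans hb.2⟩ s hs).trans ?_
    have : √|s - x| ≤ r := by
      rw [Real.sqrt_le_left hr0.le, abs_le]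
      constructor <;> linarith [hx.1, hx.2, hsa.1, hsa.2]
    exact mul_le_mul_of_nonneg_left this hK
  rw [e2, add_sub_cancel_left, abs_of_pos hr2] at e3
  have e4 := norm_sub_norm_le (r ^ 2 • v s) (g (a + r ^ 2) - g a)
  rw [norm_smul, Real.norm_of_nonneg hr2.le] at e4
  have e5 : ‖g (a + r ^ 2) - g a‖ ≤ ρ + ρ := (norm_sub_le _ _).trans (add_le_add (hg _ hb) (hg _ ha))
  have e6 : r ^ 2 * ‖v s‖ ≤ r ^ 2 * ((K + 2) * r) := by nlinarith
  exact le_of_mul_le_mul_left e6 hr2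

/-- Curves of constant speed with uniform bounds. -/
def Tame (m M : ℝ) (γ : ℝ → Plane) : Prop :=
  ∃ θ ω, Polar γ (length γ) θ ω ∧ Controlled m M γ (length γ) ω

/-- This is the Hölder bound of exponent `1/2` for a function with square integrable derivative. -/
lemma Polar.abs_angle_sub_le {m M : ℝ} (hM : 0 < M) {γ : ℝ → Plane} {L : ℝ} {θ ω : ℝ → ℝ}
    (h : Polar γ L θ ω) (hc : Controlled m M γ L ω) {a b : ℝ} (ha : a ∈ I) (hb : b ∈ I)
    (hab : a < b) : |θ b - θ a| ≤ M * √(b - a) := by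
  have hq : 0 < b - a := by linarith
  set q := √(b - a) with hqd
  have hq0 : 0 < q := Real.sqrt_pos.2 hq
  have hqq : q ^ 2 = b - a := Real.sq_sqrt hq.le
  rw [h.angle.sub_eq ha hb, ← Real.norm_eq_abs]
  have hi := integrable_sq_I h.memLp
  have hi' := intervalIntegrable_sub hi ha hb
  -- Young's inequality, weighted so that both terms integrate to at most `M q / 2`; it replaces
  -- Cauchy–Schwarz on the subinterval.
  have e1 : ‖∫ r in a..b, ω r‖ ≤ ∫ r in a..b, (q / (2 * M) * ω r ^ 2 + M / (2 * q)) := by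
    refine intervalIntegral.norm_integral_le_of_norm_le hab.le (ae_of_all _ fun r _ => ?_)
      ((hi'.const_mul _).add (by simp))
    rw [Real.norm_eq_abs]
    have e : q / (2 * M) * ω r ^ 2 + M / (2 * q) - |ω r| =
        (q * |ω r| - M) ^ 2 / (2 * M * q) := by
      rw [← sq_abs (ω r)]; field_simp; ring
    have : 0 ≤ (q * |ω r| - M) ^ 2 / (2 * M * q) := by positivity
    linarith
  rw [intervalIntegral.integral_add (hi'.const_mul _) (by simp),
    intervalIntegral.integral_const_mul, intervalIntegral.integral_const, smul_eq_mul, ← hqq] at e1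
  have e2 : ∫ r in a..b, ω r ^ 2 ≤ M ^ 2 :=
    (intervalIntegral.integral_mono_interval ha.1 hab.le hb.2
      (ae_of_all _ fun x => sq_nonneg _) hi).trans hc.integral_sq_le
  have e3 : q / (2 * M) * ∫ r in a..b, ω r ^ 2 ≤ q / (2 * M) * M ^ 2 :=
    mul_le_mul_of_nonneg_left e2 (by positivity)
  have e4 : q / (2 * M) * M ^ 2 + q ^ 2 * (M / (2 * q)) = M * q := by field_simp; norm_num
  linarith

lemma Polar.norm_ds_sub_le {m M : ℝ} (hM : 0 < M) {γ : ℝ → Plane} {L : ℝ} {θ ω : ℝ → ℝ}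
    (h : Polar γ L θ ω) (hc : Controlled m M γ L ω) {a b : ℝ} (ha : a ∈ I) (hb : b ∈ I) :
    ‖ds γ b - ds γ a‖ ≤ M ^ 2 * √|b - a| := by
  wlog hab : a ≤ b generalizing a b
  · rw [norm_sub_rev, abs_sub_comm]
    exact this hb ha (le_of_not_ge hab)
  rcases hab.eq_or_lt with rfl | hab
  · simp
  rw [h.ds_eq ha, h.ds_eq hb, ← smul_sub, norm_smul, Real.norm_of_nonneg h.pos.le,
    abs_of_pos (by linarith : 0 < b - a)]
  have e1 := (norm_dir_sub_le (θ b) (θ a)).trans (h.abs_angle_sub_le hM hc ha hb hab)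
  calc L * ‖dir (θ b) - dir (θ a)‖ ≤ M * (M * √(b - a)) :=
        mul_le_mul hc.length_le e1 (norm_nonneg _) hM.le
    _ = _ := by ring

lemma Tame.ds_sub_le {m M : ℝ} (hM : 0 < M) {γ : ℝ → Plane} (h : Tame m M γ) {a b : ℝ}
    (ha : a ∈ I) (hb : b ∈ I) : ‖ds γ b - ds γ a‖ ≤ M ^ 2 * √|b - a| := by
  obtain ⟨θ, ω, hp, hc⟩ := h
  exact hp.norm_ds_sub_le hM hc ha hb

lemma Tame.memH2 {m M : ℝ} {γ : ℝ → Plane} (h : Tame m M γ) : MemH2 γ := by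
  obtain ⟨θ, ω, hp, hc⟩ := h
  exact hp.memH2

lemma Tame.lipschitz {m M : ℝ} {γ : ℝ → Plane} (h : Tame m M γ) {a b : ℝ}
    (ha : a ∈ I) (hb : b ∈ I) : ‖γ b - γ a‖ ≤ M * |b - a| := by
  obtain ⟨θ, ω, hp, hc⟩ := h
  exact (hp.lipschitz ha hb).trans (mul_le_mul_of_nonneg_right hc.length_le (abs_nonneg _))

lemma Tame.norm_sub_le_of_size {m M : ℝ} (hM : 0 < M) {γ γ' : ℝ → Plane} (h : Tame m M γ)
    (h' : Tame m M γ') {r : ℝ} (hr0 : 0 < r) (hr : r ≤ 1)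
    (hs : size (fun s => γ s - γ' s) ≤ r ^ 2) {s : ℝ} (hsI : s ∈ I) :
    ‖γ s - γ' s‖ ≤ (2 * M + 1) * r := by
  refine norm_le_of_integral_norm (g := fun s => γ s - γ' s) hr0 hr (fun a ha b hb => ?_) ?_ ?_ hsI
    (by positivity)
  · have h1 := h.lipschitz ha hb
    have h2 := h'.lipschitz ha hb
    rw [show γ b - γ' b - (γ a - γ' a) = (γ b - γ a) - (γ' b - γ' a) by abel]
    linarith [norm_sub_le (γ b - γ a) (γ' b - γ' a)]
  · exact h.memH2.isPrimitive.continuousOn.sub h'.memH2.isPrimitive.continuousOn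
  · unfold size at hs
    linarith [norm_nonneg (γ 0 - γ' 0), norm_nonneg (γ 1 - γ' 1)]

lemma Tame.norm_ds_sub_ds_le {m M : ℝ} (hM : 0 < M) {γ γ' : ℝ → Plane} (h : Tame m M γ)
    (h' : Tame m M γ') {r : ℝ} (hr0 : 0 < r) (hr : r ≤ 1)
    (hs : ∀ s ∈ I, ‖γ s - γ' s‖ ≤ r ^ 3) {s : ℝ} (hsI : s ∈ I) :
    ‖ds γ s - ds γ' s‖ ≤ (2 * M ^ 2 + 2) * r := by
  refine norm_deriv_le_of_norm_le hr0 hr (h.memH2.isPrimitive.sub h'.memH2.isPrimitive)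
    (fun a ha b hb => ?_) le_rfl hs (by positivity) hsI
  have h1 := h.ds_sub_le hM ha hb
  have h2 := h'.ds_sub_le hM ha hb
  rw [show ds γ b - ds γ' b - (ds γ a - ds γ' a) = (ds γ b - ds γ a) - (ds γ' b - ds γ' a) by abel]
  linarith [norm_sub_le (ds γ b - ds γ a) (ds γ' b - ds γ' a)]

lemma Tame.norm_sub_lt_of_size {m M : ℝ} (hM : 0 < M) {η : ℝ} (hη : 0 < η) :
    ∃ ρ > 0, ∀ γ γ' : ℝ → Plane, Tame m M γ → Tame m M γ' →
      size (fun s => γ s - γ' s) ≤ ρ → ∀ s ∈ I, ‖γ s - γ' s‖ ≤ η := by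
  set r := min 1 (η / (2 * M + 1)) with hr
  have hr0 : 0 < r := by positivity
  refine ⟨r ^ 2, by positivity, fun γ γ' h h' hs s hsI => ?_⟩
  refine (h.norm_sub_le_of_size hM h' hr0 (min_le_left _ _) hs hsI).trans ?_
  have := min_le_right 1 (η / (2 * M + 1))
  rw [le_div_iff₀ (by positivity)] at this
  linarith

lemma Tame.norm_ds_sub_ds_le_of_norm {m M : ℝ} (hM : 0 < M) {η : ℝ} (hη : 0 < η) :
    ∃ ρ > 0, ∀ γ γ' : ℝ → Plane, Tame m M γ → Tame m M γ' →
      (∀ s ∈ I, ‖γ s - γ' s‖ ≤ ρ) → ∀ s ∈ I, ‖ds γ s - ds γ' s‖ ≤ η := by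
  set r := min 1 (η / (2 * M ^ 2 + 2)) with hr
  have hr0 : 0 < r := by positivity
  refine ⟨r ^ 3, by positivity, fun γ γ' h h' hs s hsI => ?_⟩
  refine (h.norm_ds_sub_ds_le hM h' hr0 (min_le_left _ _) hs hsI).trans ?_
  have := min_le_right 1 (η / (2 * M ^ 2 + 2))
  rw [le_div_iff₀ (by positivity)] at this
  linarith

/-! ### A priori estimates for step-by-step minimizers -/

/-- Needed because the zeroth iterate is only required to agree with the initial curve on `I`. -/
lemma Admissible.congr {γ γ' : ℝ → Plane} (h : Admissible γ) (hE : EqOn γ' γ I) :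
    Admissible γ' := by
  obtain ⟨θ, ω, hp⟩ := h.exists_polar
  refine Polar.admissible (L := length γ) (θ := θ) (ω := ω)
    ⟨hp.pos, hp.memLp, hp.angle, hp.curve.1, fun s hs => ?_⟩ ?_
  · rw [hE hs, hE zero_mem_I, hp.curve.2 s hs]
  · rw [hE zero_mem_I, hE one_mem_I]; exact h.endpoints_ne

lemma ds_congr {γ γ' : ℝ → Plane} (hE : EqOn γ' γ I) : EqOn (ds γ') (ds γ) I :=
  fun _ hs => derivWithin_congr hE (hE hs)

lemma dss_congr {γ γ' : ℝ → Plane} (hE : EqOn γ' γ I) : EqOn (dss γ') (dss γ) I :=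
  fun _ hs => derivWithin_congr (ds_congr hE) (ds_congr hE hs)

lemma energy_congr {γ γ' : ℝ → Plane} (hE : EqOn γ' γ I) (ε : ℝ) :
    energy ε γ' = energy ε γ := by
  have h1 : length γ' = length γ := by
    refine intervalIntegral.integral_congr fun s hs => ?_
    rw [uIcc_zero_one] at hs
    simp only [ds_congr hE hs]
  have h2 : ∫ s in (0 : ℝ)..1, curvature γ' s ^ 2 * ‖ds γ' s‖ =
      ∫ s in (0 : ℝ)..1, curvature γ s ^ 2 * ‖ds γ s‖ := by
    refine intervalIntegral.integral_congr fun s hs => ?_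
    rw [uIcc_zero_one] at hs
    simp only [curvature, ds_congr hE hs, dss_congr hE hs]
  rw [energy, energy, h1, h2, hE zero_mem_I, hE one_mem_I]

lemma Admissible.energy_pos {γ : ℝ → Plane} (h : Admissible γ) {ε : ℝ} (hε : 0 < ε) :
    0 < energy ε γ := by
  obtain ⟨θ, ω, hp⟩ := h.exists_polar
  have := hp.half_length_le_energy h.endpoints_ne hε
  linarith [hp.pos]

lemma Admissible.tame {γ : ℝ → Plane} (h : Admissible γ) {ε E : ℝ} (hε : 0 < ε)
    (hE : energy ε γ ≤ E) : Tame (Real.exp (-E)) (2 * E + 4 * E ^ 2 / ε + 1) γ := by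
  obtain ⟨θ, ω, hp⟩ := h.exists_polar
  exact ⟨θ, ω, hp, hp.controlled h.endpoints_ne hε hE⟩

lemma dissipation_self (γ : ℝ → Plane) : dissipation γ γ = 0 := by
  simp [dissipation]

lemma Admissible.self_mem {γ : ℝ → Plane} (h : Admissible γ) : γ ∈ admissibleFrom γ :=
  ⟨h, fun s _ => by rw [real_inner_self_eq_norm_sq]; positivity⟩

lemma size_comm (γ γ' : ℝ → Plane) :
    size (fun s => γ s - γ' s) = size (fun s => γ' s - γ s) := by
  unfold size
  simp only [norm_sub_rev]

lemma size_sub_le {f g h : ℝ → Plane} (hf : ContinuousOn f I) (hg : ContinuousOn g I)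
    (hh : ContinuousOn h I) :
    size (fun s => f s - h s) ≤ size (fun s => f s - g s) + size (fun s => g s - h s) := by
  have i1 : IntervalIntegrable (fun s => ‖f s - g s‖) volume 0 1 :=
    ContinuousOn.intervalIntegrable_I (hf.sub hg).norm
  have i2 : IntervalIntegrable (fun s => ‖g s - h s‖) volume 0 1 :=
    ContinuousOn.intervalIntegrable_I (hg.sub hh).norm
  have i3 : IntervalIntegrable (fun s => ‖f s - h s‖) volume 0 1 :=
    ContinuousOn.intervalIntegrable_I (hf.sub hh).norm
  have e := intervalIntegral.integral_mono_on zero_le_one i3 (i1.add i2)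
    fun s _ => norm_sub_le_norm_sub_add_norm_sub (f s) (g s) (h s)
  rw [intervalIntegral.integral_add i1 i2] at e
  unfold size
  linarith [norm_sub_le_norm_sub_add_norm_sub (f 0) (g 0) (h 0),
    norm_sub_le_norm_sub_add_norm_sub (f 1) (g 1) (h 1)]

namespace IsMinimizingMovement

variable {ε τ : ℝ} {γ₀ : ℝ → Plane} {c : ℕ → ℝ → Plane}

lemma admissible (h : IsMinimizingMovement ε τ γ₀ c) (h₀ : Admissible γ₀) (n : ℕ) :
    Admissible (c n) := by
  cases n with
  | zero => exact h₀.congr h.initial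
  | succ n => exact (h.mem n).1

lemma step (h : IsMinimizingMovement ε τ γ₀ c) (h₀ : Admissible γ₀) (n : ℕ) :
    energy ε (c (n + 1)) + 1 / τ * dissipation (c (n + 1)) (c n) ≤ energy ε (c n) := by
  have := h.isMinOn n (h.admissible h₀ n).self_mem
  simpa [dissipation_self] using this

lemma dissipation_nonneg (h : IsMinimizingMovement ε τ γ₀ c) (h₀ : Admissible γ₀) (n : ℕ) :
    0 ≤ dissipation (c (n + 1)) (c n) := by
  obtain ⟨θ, ω, hp⟩ := (h.admissible h₀ n).exists_polar
  obtain ⟨θ', ω', hp'⟩ := (h.admissible h₀ (n + 1)).exists_polar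
  exact ElasticFlow.dissipation_nonneg hp' hp

lemma energy_le (h : IsMinimizingMovement ε τ γ₀ c) (h₀ : Admissible γ₀) (hτ : 0 < τ) (n : ℕ) :
    energy ε (c n) ≤ energy ε γ₀ := by
  induction n with
  | zero => exact (energy_congr h.initial ε).le
  | succ n ih =>
    have h1 := h.step h₀ n
    have h2 : 0 ≤ 1 / τ * dissipation (c (n + 1)) (c n) :=
      mul_nonneg (by positivity) (h.dissipation_nonneg h₀ n)
    linarith

/-- The energy inequality telescopes, and the final energy can be dropped because energies are
positive. -/
lemma sum_dissipation_le (h : IsMinimizingMovement ε τ γ₀ c) (h₀ : Admissible γ₀) (hτ : 0 < τ)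
    (hε : 0 < ε) (n k : ℕ) :
    ∑ i ∈ Finset.range k, dissipation (c (n + i + 1)) (c (n + i)) ≤ τ * energy ε γ₀ := by
  have h1 : ∑ i ∈ Finset.range k, dissipation (c (n + i + 1)) (c (n + i)) ≤
      τ * (energy ε (c n) - energy ε (c (n + k))) := by
    induction k with
    | zero => simp
    | succ k ih =>
      rw [Finset.sum_range_succ]
      have h2 := h.step h₀ (n + k)
      rw [div_mul_eq_mul_div, one_mul] at h2
      have h3 : dissipation (c (n + k + 1)) (c (n + k)) ≤
          τ * (energy ε (c (n + k)) - energy ε (c (n + k + 1))) := by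
        rw [← div_le_iff₀' hτ]; linarith
      rw [← add_assoc]
      linarith
  have h2 := (h.admissible h₀ (n + k)).energy_pos hε
  have h3 := h.energy_le h₀ hτ n
  exact h1.trans (mul_le_mul_of_nonneg_left (by linarith) hτ.le)

lemma tame (h : IsMinimizingMovement ε τ γ₀ c) (h₀ : Admissible γ₀) (hτ : 0 < τ)
    (hε : 0 < ε) (n : ℕ) :
    Tame (Real.exp (-energy ε γ₀)) (2 * energy ε γ₀ + 4 * energy ε γ₀ ^ 2 / ε + 1) (c n) :=
  (h.admissible h₀ n).tame hε (h.energy_le h₀ hτ n)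

end IsMinimizingMovement

/-- Each displacement is at most a constant times the square root of its dissipation. Cauchy–Schwarz
over the `k` steps, together with the bound `τ E` on the total dissipation, gives the rate `√(k τ)`.
-/
lemma exists_size_bound {ε : ℝ} (hε : 0 < ε) {γ₀ : ℝ → Plane} (h₀ : Admissible γ₀) :
    ∃ C > 0, ∀ τ > 0, ∀ c, IsMinimizingMovement ε τ γ₀ c → ∀ n k : ℕ,
      ∑ i ∈ Finset.range k, size (fun s => c (n + i + 1) s - c (n + i) s) ≤ C * √(k * τ) := by
  set E := energy ε γ₀ with hE
  have hE0 : 0 < E := h₀.energy_pos hε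
  set m := Real.exp (-E) with hm
  set M := 2 * E + 4 * E ^ 2 / ε + 1 with hM
  have hm0 : 0 < m := Real.exp_pos _
  have hM1 : 1 ≤ M := by
    have : 0 ≤ 4 * E ^ 2 / ε := by positivity
    linarith
  refine ⟨(4 + 15 * M ^ 2 / m) * √E, by positivity, fun τ hτ c h n k => ?_⟩
  have h1 : ∀ i, size (fun s => c (n + i + 1) s - c (n + i) s) ≤
      (4 + 15 * M ^ 2 / m) * √(dissipation (c (n + i + 1)) (c (n + i))) := by
    intro i
    obtain ⟨θ, ω, hp, hc⟩ := h.tame h₀ hτ hε (n + i)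
    obtain ⟨θ', ω', hp', hc'⟩ := h.tame h₀ hτ hε (n + i + 1)
    exact size_le_of_dissipation hm0 hM1 hp' hp hc' hc (h.mem (n + i)).2
  refine (Finset.sum_le_sum fun i _ => h1 i).trans ?_
  rw [← Finset.mul_sum, mul_assoc]
  refine mul_le_mul_of_nonneg_left ?_ (by positivity)
  rw [← Real.sqrt_mul hE0.le]
  apply Real.le_sqrt_of_sq_le
  refine sq_sum_le_card_mul_sum_sq.trans ?_
  rw [Finset.card_range]
  have h2 : ∑ i ∈ Finset.range k, √(dissipation (c (n + i + 1)) (c (n + i))) ^ 2 ≤ τ * E := by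
    rw [Finset.sum_congr rfl fun i _ => Real.sq_sqrt (h.dissipation_nonneg h₀ (n + i))]
    exact h.sum_dissipation_le h₀ hτ hε n k
  calc (k : ℝ) * _ ≤ k * (τ * E) := mul_le_mul_of_nonneg_left h2 (Nat.cast_nonneg k)
    _ = _ := by ring

lemma size_sub_le_sum {c : ℕ → ℝ → Plane} (hc : ∀ n, ContinuousOn (c n) I) (n k : ℕ) :
    size (fun s => c (n + k) s - c n s) ≤
      ∑ i ∈ Finset.range k, size (fun s => c (n + i + 1) s - c (n + i) s) := by
  induction k with
  | zero => simp [size]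
  | succ k ih =>
    rw [Finset.sum_range_succ]
    have := size_sub_le (hc (n + (k + 1))) (hc (n + k)) (hc n)
    rw [← add_assoc] at this ⊢
    linarith

/-- The additional `τ` pays for the jumps of the interpolation: arbitrarily close times may be one
step apart. -/
lemma size_interp_sub_le {c : ℕ → ℝ → Plane} (hc : ∀ n, ContinuousOn (c n) I) {C τ : ℝ}
    (hC : 0 < C) (hτ : 0 < τ)
    (h : ∀ n k : ℕ, ∑ i ∈ Finset.range k, size (fun s => c (n + i + 1) s - c (n + i) s) ≤
      C * √(k * τ)) {t t' : ℝ} (ht : 0 ≤ t) (ht' : 0 ≤ t') :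
    size (fun s => interp τ c t s - interp τ c t' s) ≤ C * √(|t - t'| + τ) := by
  wlog htt : t' ≤ t generalizing t t'
  · rw [size_comm, abs_sub_comm]
    exact this ht' ht (le_of_not_ge htt)
  have hle : ⌈t' / τ⌉₊ ≤ ⌈t / τ⌉₊ := Nat.ceil_mono (by gcongr)
  obtain ⟨k, hk⟩ := Nat.exists_eq_add_of_le hle
  unfold interp
  rw [hk]
  refine ((size_sub_le_sum hc _ k).trans (h _ k)).trans ?_
  refine mul_le_mul_of_nonneg_left (Real.sqrt_le_sqrt ?_) hC.le
  have h1 : (⌈t / τ⌉₊ : ℝ) < t / τ + 1 := Nat.ceil_lt_add_one (by positivity)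
  have h2 := Nat.le_ceil (t' / τ)
  rw [hk] at h1
  push_cast at h1
  rw [abs_of_nonneg (by linarith)]
  have h3 : (k : ℝ) ≤ t / τ - t' / τ + 1 := by linarith
  calc (k : ℝ) * τ ≤ (t / τ - t' / τ + 1) * τ := by gcongr
    _ = _ := by field_simp


/-! ### Comparison of two minimizers -/

/-- Interpolating lengths and angles, rather than positions, keeps the speed constant and makes the
bending energy convex along the path. -/
lemma Polar.exists_convex_combination {γ γ' : ℝ → Plane} {L L' : ℝ} {θ ω θ' ω' : ℝ → ℝ}
    (hp : Polar γ L θ ω) (hp' : Polar γ' L' θ' ω') {h : ℝ} (h0 : 0 ≤ h) (h1 : h ≤ 1) :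
    ∃ ζ, Polar ζ (L + h * (L' - L)) (fun s => θ s + h * (θ' s - θ s))
      (fun s => ω s + h * (ω' s - ω s)) ∧ ζ 0 = γ 0 + h • (γ' 0 - γ 0) := by
  have ha : IsPrimitive (fun s => θ s + h * (θ' s - θ s)) (fun s => ω s + h * (ω' s - ω s)) :=
    hp.angle.add ((hp'.angle.sub hp.angle).const_smul h)
  refine ⟨fun s => γ 0 + h • (γ' 0 - γ 0) + ∫ r in (0 : ℝ)..s,
    (L + h * (L' - L)) • dir (θ r + h * (θ' r - θ r)), ⟨?_, ?_, ha, ?_, ?_⟩, by simp⟩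
  · have := hp.pos
    have := hp'.pos
    nlinarith [mul_nonneg h0 hp'.pos.le, mul_nonneg (sub_nonneg.2 h1) hp.pos.le]
  · exact hp.memLp.add ((hp'.memLp.sub hp.memLp).const_mul h)
  · exact (ha.dir_comp _).continuousOn.intervalIntegrable_I
  · intro s _
    simp

/-- The identity behind the joint convexity of `(L, ω) ↦ ω² / L`. -/
lemma bending_convex_identity {ω ω' : ℝ → ℝ} (hω : MemLp ω 2 (volume.restrict I))
    (hω' : MemLp ω' 2 (volume.restrict I)) {L L' h : ℝ} (hL : 0 < L) (hL' : 0 < L')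
    (hLh : 0 < L + h * (L' - L)) :
    (∫ s in (0 : ℝ)..1, (ω s + h * (ω' s - ω s)) ^ 2) / (L + h * (L' - L)) -
      (∫ s in (0 : ℝ)..1, ω s ^ 2) / L =
    h * ((∫ s in (0 : ℝ)..1, ω' s ^ 2) / L' - (∫ s in (0 : ℝ)..1, ω s ^ 2) / L) -
      h * (1 - h) * (L * L' / (L + h * (L' - L))) *
        ∫ s in (0 : ℝ)..1, (ω s / L - ω' s / L') ^ 2 := by
  have i1 := integrable_sq_I hω
  have i2 := integrable_sq_I hω'
  have i3 : IntervalIntegrable (fun s => ω s * ω' s) volume 0 1 := by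
    rw [intervalIntegrable_iff_I]
    exact hω.integrable_mul hω'
  have e : ∀ a b d : ℝ, ∫ s in (0 : ℝ)..1, (ω s ^ 2 * a + ω s * ω' s * b + ω' s ^ 2 * d) =
      (∫ s in (0 : ℝ)..1, ω s ^ 2) * a + (∫ s in (0 : ℝ)..1, ω s * ω' s) * b
        + (∫ s in (0 : ℝ)..1, ω' s ^ 2) * d := by
    intro a b d
    rw [intervalIntegral.integral_add ((i1.mul_const _).add (i3.mul_const _)) (i2.mul_const _),
      intervalIntegral.integral_add (i1.mul_const _) (i3.mul_const _),
      intervalIntegral.integral_mul_const, intervalIntegral.integral_mul_const,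
      intervalIntegral.integral_mul_const]
  have e1 : ∫ s in (0 : ℝ)..1, (ω s + h * (ω' s - ω s)) ^ 2 =
      ∫ s in (0 : ℝ)..1,
        (ω s ^ 2 * (1 - h) ^ 2 + ω s * ω' s * (2 * h * (1 - h)) + ω' s ^ 2 * h ^ 2) :=
    intervalIntegral.integral_congr fun s _ => by ring
  have e2 : ∫ s in (0 : ℝ)..1, (ω s / L - ω' s / L') ^ 2 =
      ∫ s in (0 : ℝ)..1,
        (ω s ^ 2 * (1 / L ^ 2) + ω s * ω' s * (-2 / (L * L')) + ω' s ^ 2 * (1 / L' ^ 2)) :=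
    intervalIntegral.integral_congr fun s _ => by
      field_simp
      ring
  rw [e1, e2, e, e]
  generalize (∫ s in (0 : ℝ)..1, ω s ^ 2) = P
  generalize (∫ s in (0 : ℝ)..1, ω s * ω' s) = Q
  generalize (∫ s in (0 : ℝ)..1, ω' s ^ 2) = R
  set K := L + h * (L' - L) with hK
  have hKe : L' * h = K - L * (1 - h) := by rw [hK]; ring
  field_simp
  rw [hK]
  ring

lemma weighted_sq_sub_le {x y d q ℓ ℓ' M : ℝ} (hq0 : 0 ≤ q) (hq : q ≤ 1) (hd : d ≤ 1)
    (hM : 1 ≤ M) (hℓ0 : 0 ≤ ℓ) (hℓM : ℓ ≤ M) (hℓ : |ℓ' - ℓ| ≤ q) (hx : |x| ≤ d)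
    (hy : |y - x| ≤ 2 * q) : ℓ' * y ^ 2 ≤ ℓ * x ^ 2 + 10 * M * q * (d + q) := by
  have hd0 : 0 ≤ d := (abs_nonneg x).trans hx
  have e1 : |y| ≤ d + 2 * q := by
    have := abs_add_le (y - x) x
    rw [sub_add_cancel] at this
    linarith
  have e2 : |y + x| ≤ 2 * (d + q) := by
    have := abs_add_le y x
    linarith
  have e3 : y ^ 2 ≤ 6 * (d + q) := by
    rw [← sq_abs]
    nlinarith [abs_nonneg y]
  have e4 : (ℓ' - ℓ) * y ^ 2 ≤ q * (6 * (d + q)) :=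
    (mul_le_mul_of_nonneg_right (le_abs_self _) (sq_nonneg y)).trans
      (mul_le_mul hℓ e3 (sq_nonneg y) hq0)
  have e5 : (y - x) * (y + x) ≤ 2 * q * (2 * (d + q)) := by
    refine (le_abs_self _).trans ?_
    rw [abs_mul]
    exact mul_le_mul hy e2 (abs_nonneg _) (by positivity)
  have e6 : ℓ * ((y - x) * (y + x)) ≤ M * (2 * q * (2 * (d + q))) :=
    (mul_le_mul_of_nonneg_left e5 hℓ0).trans (mul_le_mul_of_nonneg_right hℓM (by positivity))
  have e7 : q * (6 * (d + q)) ≤ M * (q * (6 * (d + q))) :=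
    le_mul_of_one_le_left (by positivity) hM
  nlinarith

lemma dissipation_eq_angle {γ γ' : ℝ → Plane} {L L' : ℝ} {θ ω θ' ω' : ℝ → ℝ}
    (h : Polar γ L θ ω) (h' : Polar γ' L' θ' ω') :
    dissipation γ γ' =
      1 / 4 * (∫ s in (0 : ℝ)..1, L' * ⟪γ s - γ' s, nor (θ' s)⟫ ^ 2)
      + 1 / 4 * (∫ s in (0 : ℝ)..1, L * ⟪γ s - γ' s, nor (θ s)⟫ ^ 2)
      + 1 / 2 * ‖γ 0 - γ' 0‖ ^ 2 + 1 / 2 * ‖γ 1 - γ' 1‖ ^ 2 := by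
  rw [dissipation_terms h h']
  have hL := h.pos.ne'
  have hL' := h'.pos.ne'
  simp only [real_inner_smul_right, mul_pow, intervalIntegral.integral_const_mul]
  congr 3
  · field_simp
  · field_simp

lemma integral_le_add_of_le {f g : ℝ → ℝ} {d : ℝ → Plane} (hf : ContinuousOn f I)
    (hg : ContinuousOn g I) (hd : ContinuousOn d I) {a b : ℝ}
    (h : ∀ s ∈ I, f s ≤ g s + a * (‖d s‖ + b)) :
    ∫ s in (0 : ℝ)..1, f s ≤ (∫ s in (0 : ℝ)..1, g s) + a * ((∫ s in (0 : ℝ)..1, ‖d s‖) + b) := by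
  have id : IntervalIntegrable (fun s => ‖d s‖) volume 0 1 :=
    ContinuousOn.intervalIntegrable_I hd.norm
  have ib : IntervalIntegrable (fun _ => b) volume (0 : ℝ) 1 := by simp
  have e := intervalIntegral.integral_mono_on zero_le_one
    (ContinuousOn.intervalIntegrable_I hf)
    ((ContinuousOn.intervalIntegrable_I hg).add ((id.add ib).const_mul a)) h
  rw [intervalIntegral.integral_add (ContinuousOn.intervalIntegrable_I hg)
    ((id.add ib).const_mul a), intervalIntegral.integral_const_mul,
    intervalIntegral.integral_add id ib, intervalIntegral.integral_const] at e
  simpa using e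

/-- The dissipation is quadratic in the displacement from `β`, so a perturbation of size `q` costs
`q` times (displacement plus `q`). This extra factor survives the division by `τ ^ 2` later on: with
`q` of order `τ`, it becomes the discrete speed. -/
lemma dissipation_le_of_close {M q : ℝ} (hM : 1 ≤ M) (hq0 : 0 ≤ q) (hq : q ≤ 1)
    {β γ ζ : ℝ → Plane} {K L N : ℝ} {α φ θ ω ψ χ : ℝ → ℝ}
    (hβ : Polar β K α φ) (hγ : Polar γ L θ ω) (hζ : Polar ζ N ψ χ) (hK : K ≤ M) (hL : L ≤ M)
    (hδ : ∀ s ∈ I, ‖γ s - β s‖ ≤ 1) (hN : |N - L| ≤ q) (hc : ∀ s ∈ I, ‖ζ s - γ s‖ ≤ q)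
    (ha : ∀ s ∈ I, |ψ s - θ s| ≤ q) :
    dissipation ζ β ≤ dissipation γ β + 7 * M * q * (size (fun s => γ s - β s) + q) := by
  have cγ := hγ.curve.continuousOn
  have cβ := hβ.curve.continuousOn
  have cζ := hζ.curve.continuousOn
  have nβ : ContinuousOn (fun s => nor (α s)) I :=
    continuous_nor.comp_continuousOn hβ.angle.continuousOn
  have nγ : ContinuousOn (fun s => nor (θ s)) I :=
    continuous_nor.comp_continuousOn hγ.angle.continuousOn
  have nζ : ContinuousOn (fun s => nor (ψ s)) I :=
    continuous_nor.comp_continuousOn hζ.angle.continuousOn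
  have hx : ∀ s t, |⟪γ s - β s, nor t⟫| ≤ ‖γ s - β s‖ := by
    intro s t
    simpa [norm_nor] using abs_real_inner_le_norm (γ s - β s) (nor t)
  have i1 := integral_le_add_of_le
    (f := fun s => K * ⟪ζ s - β s, nor (α s)⟫ ^ 2) (g := fun s => K * ⟪γ s - β s, nor (α s)⟫ ^ 2)
    (d := fun s => γ s - β s) (a := 10 * M * q) (b := q)
    (continuousOn_const.mul (((cζ.sub cβ).inner nβ).pow 2))
    (continuousOn_const.mul (((cγ.sub cβ).inner nβ).pow 2)) (cγ.sub cβ) (by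
      intro s hs
      refine weighted_sq_sub_le hq0 hq (hδ s hs) hM hβ.pos.le hK (by simpa using hq0) (hx _ _) ?_
      rw [← inner_sub_left, sub_sub_sub_cancel_right]
      refine (abs_real_inner_le_norm _ _).trans ?_
      rw [norm_nor, mul_one]
      linarith [hc s hs])
  have i2 := integral_le_add_of_le
    (f := fun s => N * ⟪ζ s - β s, nor (ψ s)⟫ ^ 2) (g := fun s => L * ⟪γ s - β s, nor (θ s)⟫ ^ 2)
    (d := fun s => γ s - β s) (a := 10 * M * q) (b := q)
    (continuousOn_const.mul (((cζ.sub cβ).inner nζ).pow 2))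
    (continuousOn_const.mul (((cγ.sub cβ).inner nγ).pow 2)) (cγ.sub cβ) (by
      intro s hs
      refine weighted_sq_sub_le hq0 hq (hδ s hs) hM hγ.pos.le hL hN (hx _ _) ?_
      have e : ⟪ζ s - β s, nor (ψ s)⟫ - ⟪γ s - β s, nor (θ s)⟫ =
          ⟪ζ s - γ s, nor (ψ s)⟫ + ⟪γ s - β s, nor (ψ s) - nor (θ s)⟫ := by
        simp only [inner_sub_left, inner_sub_right]; ring
      rw [e]
      refine (abs_add_le _ _).trans ?_
      have e1 := abs_real_inner_le_norm (ζ s - γ s) (nor (ψ s))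
      have e2 := abs_real_inner_le_norm (γ s - β s) (nor (ψ s) - nor (θ s))
      have e3 := (norm_nor_sub_le (ψ s) (θ s)).trans (ha s hs)
      rw [norm_nor, mul_one] at e1
      have e4 := mul_le_mul (hδ s hs) e3 (norm_nonneg _) zero_le_one
      linarith [hc s hs])
  have hend : ∀ s ∈ I, 1 / 2 * ‖ζ s - β s‖ ^ 2 ≤
      1 / 2 * ‖γ s - β s‖ ^ 2 + q * (‖γ s - β s‖ + q) := by
    intro s hs
    have e1 : ‖ζ s - β s‖ ≤ q + ‖γ s - β s‖ := by
      have := norm_sub_le_norm_sub_add_norm_sub (ζ s) (γ s) (β s)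
      linarith [hc s hs]
    have e2 := pow_le_pow_left₀ (norm_nonneg _) e1 2
    nlinarith
  have j0 := hend 0 zero_mem_I
  have j1 := hend 1 one_mem_I
  rw [dissipation_eq_angle hζ hβ, dissipation_eq_angle hγ hβ, size]
  have k0 := norm_nonneg (γ 0 - β 0)
  have k1 := norm_nonneg (γ 1 - β 1)
  have k2 : 0 ≤ ∫ s in (0 : ℝ)..1, ‖γ s - β s‖ :=
    intervalIntegral.integral_nonneg zero_le_one fun _ _ => norm_nonneg _
  have l1 : q * (‖γ 0 - β 0‖ + ‖γ 1 - β 1‖ + 2 * q) ≤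
      M * (q * (‖γ 0 - β 0‖ + ‖γ 1 - β 1‖ + 2 * q)) :=
    le_mul_of_one_le_left (by positivity) hM
  have l2 : 0 ≤ M * q * (‖γ 0 - β 0‖ + ‖γ 1 - β 1‖ + ∫ s in (0 : ℝ)..1, ‖γ s - β s‖) := by
    positivity
  have l3 : 0 ≤ M * q * (‖γ 0 - β 0‖ + ‖γ 1 - β 1‖) := by positivity
  have l4 : 0 ≤ M * q * (∫ s in (0 : ℝ)..1, ‖γ s - β s‖) := by positivity
  nlinarith

-- Minimality of `γ` is tested against the interpolation `ζ` towards `γ'`. The integral on the left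
-- is the squared `L²` distance of the curvatures, produced by the convexity identity; the last term
-- on the right collects the changes in the logarithm and the dissipation.
set_option maxHeartbeats 800000 in
lemma curvature_gap_le_of_isMinOn {m M ε : ℝ} (hm : 0 < m) (hM : 1 ≤ M) (hε : 0 < ε) {τ σ : ℝ}
    (hτ0 : 0 < τ) (hτ2 : τ ≤ 1 / 2) (hτ1 : τ * (2 + M) ≤ 1) (hτm : τ * (2 + M) ≤ m / 4)
    (hσ0 : 0 ≤ σ) (hσ : σ ≤ 1) {β γ γ' : ℝ → Plane} {K L L' : ℝ} {α φ θ ω θ' ω' : ℝ → ℝ}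
    (hβ : Polar β K α φ) (hp : Polar γ L θ ω) (hp' : Polar γ' L' θ' ω')
    (hcβ : Controlled m M β K φ) (hc : Controlled m M γ L ω) (hc' : Controlled m M γ' L' ω')
    (hmin : IsMinOn (fun γ => energy ε γ + 1 / τ * dissipation γ β) (admissibleFrom β) γ)
    (hδ : ∀ s ∈ I, ‖γ s - β s‖ ≤ 1) (hds : ∀ s ∈ I, ‖ds γ s - ds β s‖ ≤ m / 4)
    (h0 : ‖γ' 0 - γ 0‖ ≤ σ) (hLσ : |L' - L| ≤ σ) (hθ : ∀ s ∈ I, |θ' s - θ s| ≤ σ) :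
    ε * m ^ 2 / (4 * M) * ∫ s in (0 : ℝ)..1, (ω s / L - ω' s / L') ^ 2 ≤
      (L' - L) + ε / 2 * ((∫ s in (0 : ℝ)..1, ω' s ^ 2) / L' - (∫ s in (0 : ℝ)..1, ω s ^ 2) / L)
      + (2 + M) * (7 * M * (2 + M) + 4 / m) * σ * (1 + size (fun s => γ s - β s) / τ) := by
  -- The weight is the time step itself: the quadratic part `q ^ 2 / τ` of the dissipation error
  -- then remains of order `τ`.
  obtain ⟨ζ, hζ, hζ0⟩ := hp.exists_convex_combination hp' hτ0.le (by linarith)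
  set N := L + τ * (L' - L) with hN
  set ψ : ℝ → ℝ := fun s => θ s + τ * (θ' s - θ s) with hψ
  set χ : ℝ → ℝ := fun s => ω s + τ * (ω' s - ω s) with hχ
  set A := (2 + M) * σ with hA
  have hA0 : 0 ≤ A := by positivity
  have hσA : 2 * σ ≤ A := by rw [hA]; nlinarith
  set q := τ * A with hq
  have hq0 : 0 ≤ q := by positivity
  have hqle : q ≤ τ * (2 + M) := by
    rw [hq, hA]
    nlinarith [mul_nonneg hτ0.le (by linarith : (0 : ℝ) ≤ 2 + M)]
  have hτσ : τ * σ ≤ q := mul_le_mul_of_nonneg_left (by linarith) hτ0.le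
  have hNL : |N - L| ≤ τ * σ := by
    rw [hN, add_sub_cancel_left, abs_mul, abs_of_pos hτ0]
    exact mul_le_mul_of_nonneg_left hLσ hτ0.le
  have hψθ : ∀ s ∈ I, |ψ s - θ s| ≤ τ * σ := by
    intro s hs
    simp only [hψ, add_sub_cancel_left]
    rw [abs_mul, abs_of_pos hτ0]
    exact mul_le_mul_of_nonneg_left (hθ s hs) hτ0.le
  have htan : ∀ s ∈ I, ‖N • dir (ψ s) - L • dir (θ s)‖ ≤ (1 + M) * (τ * σ) := by
    intro s hs
    have e : N • dir (ψ s) - L • dir (θ s) =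
        (N - L) • dir (ψ s) + L • (dir (ψ s) - dir (θ s)) := by
      rw [sub_smul, smul_sub]; abel
    rw [e]
    refine (norm_add_le _ _).trans ?_
    rw [norm_smul, norm_smul, norm_dir, mul_one, Real.norm_eq_abs, Real.norm_of_nonneg hp.pos.le]
    have e1 := (norm_dir_sub_le (ψ s) (θ s)).trans (hψθ s hs)
    have e2 := mul_le_mul hc.length_le e1 (norm_nonneg _) (by linarith)
    linarith
  have hclose : ∀ s ∈ I, ‖ζ s - γ s‖ ≤ q := by
    intro s hs
    have e := (hζ.curve.sub hp.curve).eq_integral s hs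
    rw [e, hζ0, add_sub_cancel_left]
    have e1 : ‖τ • (γ' 0 - γ 0)‖ ≤ τ * σ := by
      rw [norm_smul, Real.norm_of_nonneg hτ0.le]
      exact mul_le_mul_of_nonneg_left h0 hτ0.le
    have e2 : ‖∫ r in (0 : ℝ)..s, (N • dir (ψ r) - L • dir (θ r))‖ ≤
        (1 + M) * (τ * σ) * |s - 0| := by
      refine intervalIntegral.norm_integral_le_of_norm_le_const fun r hr => ?_
      rw [uIoc_of_le hs.1] at hr
      exact htan r ⟨hr.1.le, hr.2.trans hs.2⟩
    rw [sub_zero, abs_of_nonneg hs.1] at e2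
    have e3 : (1 + M) * (τ * σ) * s ≤ (1 + M) * (τ * σ) := by
      apply mul_le_of_le_one_right (by positivity) hs.2
    refine (norm_add_le _ _).trans ?_
    have e4 : q = τ * σ + (1 + M) * (τ * σ) := by rw [hq, hA]; ring
    linarith
  have hdist : ‖γ 1 - γ 0‖ - 2 * q ≤ ‖ζ 1 - ζ 0‖ := by
    have e : γ 1 - γ 0 = (ζ 1 - ζ 0) + ((ζ 0 - γ 0) - (ζ 1 - γ 1)) := by abel
    have e1 := norm_add_le (ζ 1 - ζ 0) ((ζ 0 - γ 0) - (ζ 1 - γ 1))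
    rw [← e] at e1
    have e2 := norm_sub_le (ζ 0 - γ 0) (ζ 1 - γ 1)
    linarith [hclose 0 zero_mem_I, hclose 1 one_mem_I]
  have hζd : m / 2 ≤ ‖ζ 1 - ζ 0‖ := by linarith [hc.le_dist]
  have hζpos : 0 < ‖ζ 1 - ζ 0‖ := by linarith
  have hγpos : 0 < ‖γ 1 - γ 0‖ := by linarith [hc.le_dist]
  -- The endpoints of `ζ` stay at distance `m / 2`. Its tangent is within `m / 4 + m / 4` of that of
  -- `β`, whose norm is at least `m`, so the sign condition holds.
  have hζadm : ζ ∈ admissibleFrom β := by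
    refine ⟨hζ.admissible fun h => ?_, fun s hs => ?_⟩
    · rw [h, sub_self, norm_zero] at hζpos
      exact lt_irrefl _ hζpos
    · have e1 : ‖ds ζ s - ds β s‖ ≤ m / 2 := by
        have e2 : ‖ds ζ s - ds γ s‖ ≤ (1 + M) * (τ * σ) := by
          rw [hζ.ds_eq hs, hp.ds_eq hs]
          exact htan s hs
        have e3 : q = τ * σ + (1 + M) * (τ * σ) := by rw [hq, hA]; ring
        have e4 : 0 ≤ τ * σ := by positivity
        have := norm_sub_le_norm_sub_add_norm_sub (ds ζ s) (ds γ s) (ds β s)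
        linarith [hds s hs]
      have e2 := abs_real_inner_le_norm (ds ζ s - ds β s) (ds β s)
      have e3 : ‖ds β s‖ = K := hβ.norm_ds hs
      rw [inner_sub_left, real_inner_self_eq_norm_sq, e3] at e2
      have e4 := mul_le_mul_of_nonneg_right e1 hβ.pos.le
      have e5 := (abs_le.1 e2).1
      have e6 := hcβ.le_length
      have e7 := hβ.pos
      have e8 : m / 2 * K ≤ K * K := mul_le_mul_of_nonneg_right (by linarith) e7.le
      rw [sq] at e5
      linarith
  have hle := hmin hζadm
  simp only [mem_ofPred_eq] at hle
  have hdiss := dissipation_le_of_close hM hq0 (by linarith) hβ hp hζ hcβ.length_le hc.length_le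
    hδ (by linarith) hclose (fun s hs => (hψθ s hs).trans hτσ)
  have hlog : Real.log ‖γ 1 - γ 0‖ - Real.log ‖ζ 1 - ζ 0‖ ≤ 4 * q / m := by
    rw [← Real.log_div hγpos.ne' hζpos.ne']
    refine (Real.log_le_sub_one_of_pos (by positivity)).trans ?_
    rw [div_sub_one hζpos.ne', div_le_div_iff₀ hζpos hm]
    have e1 := mul_le_mul_of_nonneg_left hζd (by positivity : 0 ≤ 4 * q)
    have e2 : (‖γ 1 - γ 0‖ - ‖ζ 1 - ζ 0‖) * m ≤ 2 * q * m :=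
      mul_le_mul_of_nonneg_right (by linarith) hm.le
    linarith
  have hbend := bending_convex_identity hp.memLp hp'.memLp hp.pos hp'.pos hζ.pos
  rw [hζ.energy_eq, hp.energy_eq] at hle
  set S := size (fun s => γ s - β s) with hS
  have hS0 : 0 ≤ S := size_nonneg _
  set X := ∫ s in (0 : ℝ)..1, (ω s / L - ω' s / L') ^ 2 with hX
  have hX0 : 0 ≤ X := Polar.integral_sq_nonneg _
  set B' := (∫ s in (0 : ℝ)..1, ω' s ^ 2) / L' with hB'
  set B := (∫ s in (0 : ℝ)..1, ω s ^ 2) / L with hB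
  set Bζ := (∫ s in (0 : ℝ)..1, χ s ^ 2) / N with hBζ
  have hdiv : 1 / τ * dissipation ζ β ≤ 1 / τ * dissipation γ β + 7 * M * A * (S + q) := by
    have := mul_le_mul_of_nonneg_left hdiss (by positivity : 0 ≤ 1 / τ)
    have e : 1 / τ * (dissipation γ β + 7 * M * q * (S + q)) =
        1 / τ * dissipation γ β + 7 * M * A * (S + q) := by
      rw [hq]; field_simp
    linarith
  have hcoef : m ^ 2 / M ≤ L * L' / N := by
    have hNM : N ≤ M := by
      have e1 := mul_le_mul_of_nonneg_left hc.length_le (by linarith : 0 ≤ 1 - τ)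
      have e2 := mul_le_mul_of_nonneg_left hc'.length_le hτ0.le
      rw [hN]
      linarith
    have hmm : m ^ 2 ≤ L * L' := by
      rw [sq]
      exact mul_le_mul hc.le_length hc'.le_length hm.le hp.pos.le
    exact div_le_div₀ (mul_pos hp.pos hp'.pos).le hmm hζ.pos hNM
  have hgap : m ^ 2 / (2 * M) * X ≤ (1 - τ) * (L * L' / N) * X := by
    refine mul_le_mul_of_nonneg_right ?_ hX0
    have e : m ^ 2 / (2 * M) = 1 / 2 * (m ^ 2 / M) := by field_simp
    rw [e]
    exact mul_le_mul (by linarith) hcoef (by positivity) (by linarith)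
  -- Every contribution to the energy comparison carries a factor `τ`, which is now divided out.
  have hmain : 0 ≤ τ * ((L' - L) + ε / 2 * (B' - B) - ε / 2 * ((1 - τ) * (L * L' / N) * X)
      + 4 * A / m + 7 * M * A * (S / τ + A)) := by
    have e1 : 4 * q / m = τ * (4 * A / m) := by rw [hq]; ring
    have e2 : 7 * M * A * (S + q) = τ * (7 * M * A * (S / τ + A)) := by
      rw [hq]; field_simp
    have e3 : N - L = τ * (L' - L) := by rw [hN]; ring
    rw [e1] at hlog
    rw [e2] at hdiv
    have e4 : ε / 2 * Bζ - ε / 2 * B =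
        τ * (ε / 2 * (B' - B)) - τ * (ε / 2 * ((1 - τ) * (L * L' / N) * X)) := by
      rw [← mul_sub, hbend]; ring
    linarith
  have hmain' := nonneg_of_mul_nonneg_right hmain hτ0
  have e1 : ε * m ^ 2 / (4 * M) * X ≤ ε / 2 * ((1 - τ) * (L * L' / N) * X) := by
    have := mul_le_mul_of_nonneg_left hgap (by positivity : 0 ≤ ε / 2)
    have e : ε / 2 * (m ^ 2 / (2 * M) * X) = ε * m ^ 2 / (4 * M) * X := by field_simp; ring
    linarith
  have hAM : A ≤ 2 + M := mul_le_of_le_one_right (by linarith) hσ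
  have hSτ : 0 ≤ S / τ := by positivity
  have e2 : 7 * M * A * (S / τ + A) ≤ 7 * M * A * ((2 + M) * (1 + S / τ)) := by
    refine mul_le_mul_of_nonneg_left ?_ (by positivity)
    have : S / τ ≤ (2 + M) * (S / τ) := le_mul_of_one_le_left hSτ (by linarith)
    linarith
  have e3 : 4 * A / m ≤ 4 * A / m * (1 + S / τ) :=
    le_mul_of_one_le_right (by positivity) (by linarith)
  have e4 : (2 + M) * (7 * M * (2 + M) + 4 / m) * σ * (1 + S / τ) =
      7 * M * A * ((2 + M) * (1 + S / τ)) + 4 * A / m * (1 + S / τ) := by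
    rw [hA]; ring
  rw [e4]
  linarith

/-- Close tangents make the sine of half the angle difference small. After the right full turn is
chosen at `0`, continuity keeps that half difference on the branch around zero. -/
lemma exists_angle_close {m M : ℝ} (hm : 0 < m) {γ γ' : ℝ → Plane} {L L' : ℝ}
    {θ ω θ' ω' : ℝ → ℝ} (hp : Polar γ L θ ω) (hp' : Polar γ' L' θ' ω')
    (hc : Controlled m M γ L ω) {η : ℝ} (hη : η ≤ m / 4)
    (hds : ∀ s ∈ I, ‖ds γ s - ds γ' s‖ ≤ η) :
    |L' - L| ≤ η ∧ ∃ n : ℤ, ∀ s ∈ I, |θ' s + n * (2 * Real.pi) - θ s| ≤ 4 * η / m := by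
  have hL : |L' - L| ≤ η := by
    have e := (abs_norm_sub_norm_le (ds γ 0) (ds γ' 0)).trans (hds 0 zero_mem_I)
    rwa [hp.norm_ds zero_mem_I, hp'.norm_ds zero_mem_I, abs_sub_comm] at e
  have hη0 : 0 ≤ η := (abs_nonneg _).trans hL
  -- Rounding selects a lift for which the angles at `0` differ by at most `π`.
  refine ⟨hL, -round ((θ' 0 - θ 0) / (2 * Real.pi)), ?_⟩
  set n : ℤ := -round ((θ' 0 - θ 0) / (2 * Real.pi)) with hn
  have hq := hp'.add_two_pi_mul n
  set x : ℝ → ℝ := fun s => (θ' s + n * (2 * Real.pi) - θ s) / 2 with hx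
  have hxc : ContinuousOn x I := (hq.angle.continuousOn.sub hp.angle.continuousOn).div_const 2
  have hpi := Real.pi_pos
  have hx0 : |x 0| ≤ Real.pi / 2 := by
    have e := abs_sub_round ((θ' 0 - θ 0) / (2 * Real.pi))
    have e1 : x 0 = Real.pi * ((θ' 0 - θ 0) / (2 * Real.pi) -
        round ((θ' 0 - θ 0) / (2 * Real.pi))) := by
      simp only [hx, hn]; push_cast; field_simp; ring
    rw [e1, abs_mul, abs_of_pos hpi]
    nlinarith
  have hsin : ∀ s ∈ I, |Real.sin (x s)| ≤ η / m := by
    intro s hs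
    have e1 := hds s hs
    rw [hp.ds_eq hs, hq.ds_eq hs] at e1
    have e2 := norm_dir_sub (θ' s + n * (2 * Real.pi)) (θ s)
    have e3 : L • (dir (θ' s + n * (2 * Real.pi)) - dir (θ s)) =
        -(L • dir (θ s) - L' • dir (θ' s + n * (2 * Real.pi))) -
          (L' - L) • dir (θ' s + n * (2 * Real.pi)) := by
      rw [smul_sub, sub_smul]; abel
    have e4 := norm_sub_le (-(L • dir (θ s) - L' • dir (θ' s + n * (2 * Real.pi))))
      ((L' - L) • dir (θ' s + n * (2 * Real.pi)))
    rw [← e3, norm_neg, norm_smul, norm_smul, norm_dir, mul_one, Real.norm_of_nonneg hp.pos.le,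
      Real.norm_eq_abs, e2] at e4
    change L * (2 * |Real.sin (x s)|) ≤ _ at e4
    rw [le_div_iff₀ hm]
    have e5 := mul_le_mul_of_nonneg_right hc.le_length (abs_nonneg (Real.sin (x s)))
    linarith
  -- To exceed `π / 2`, the function `|x|` would have to take that value, where the sine has modulus
  -- `1`; but the sine is bounded by `η / m ≤ 1 / 4`.
  have hsmall : ∀ s ∈ I, |x s| ≤ Real.pi / 2 := by
    intro s hs
    by_contra! hcon
    have hsub : uIcc 0 s ⊆ I := uIcc_subset_Icc zero_mem_I hs
    have hiv := intermediate_value_uIcc (hxc.abs.mono hsub)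
    obtain ⟨r, hr, hr2⟩ := hiv (show Real.pi / 2 ∈ uIcc |x 0| |x s| by
      rw [uIcc_of_le (hx0.trans hcon.le)]; exact ⟨hx0, hcon.le⟩)
    have e1 := hsin r (hsub hr)
    have e2 : |Real.sin (x r)| = 1 := by
      simp only at hr2
      rcases abs_choice (x r) with h | h
      · rw [h] at hr2; rw [hr2, Real.sin_pi_div_two, abs_one]
      · rw [h] at hr2
        rw [show x r = -(Real.pi / 2) by linarith, Real.sin_neg, Real.sin_pi_div_two, abs_neg,
          abs_one]
    rw [e2, le_div_iff₀ hm] at e1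
    linarith
  intro s hs
  -- Jordan's inequality inverts the sine on this branch.
  have e1 := Real.mul_abs_le_abs_sin (hsmall s hs)
  have e2 := e1.trans (hsin s hs)
  have e3 : |θ' s + n * (2 * Real.pi) - θ s| = 2 * |x s| := by
    simp only [hx]; rw [abs_div, abs_two]; ring
  rw [e3]
  have e4 : 2 * |x s| = Real.pi * (2 / Real.pi * |x s|) := by field_simp
  rw [e4]
  calc Real.pi * (2 / Real.pi * |x s|) ≤ Real.pi * (η / m) := by gcongr
    _ ≤ 4 * (η / m) := mul_le_mul_of_nonneg_right Real.pi_le_four (by positivity)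
    _ = _ := by ring


/-! ### The `H²` distance -/

lemma MemH2.sub {γ γ' : ℝ → Plane} (h : MemH2 γ) (h' : MemH2 γ') :
    MemH2 (γ - γ') ∧ EqOn (ds (γ - γ')) (fun s => ds γ s - ds γ' s) I ∧
      dss (γ - γ') =ᵐ[volume.restrict I] fun s => dss γ s - dss γ' s :=
  memH2_of_isPrimitive (h.isPrimitive.sub h'.isPrimitive)
    (h.ds_isPrimitive.sub h'.ds_isPrimitive) (h.memLp_dss.sub h'.memLp_dss)

lemma h2NormSq_eq {γ : ℝ → Plane} (h : MemH2 γ) :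
    h2NormSq γ = (∫⁻ s in I, ‖γ s‖ₑ ^ 2) + (∫⁻ s in I, ‖ds γ s‖ₑ ^ 2)
      + ∫⁻ s in I, ‖dss γ s‖ₑ ^ 2 := by
  have m1 : AEMeasurable (fun s => ‖γ s‖ₑ ^ 2) (volume.restrict I) :=
    (h.isPrimitive.continuousOn.aestronglyMeasurable_of_isCompact isCompact_Icc
      measurableSet_Icc).enorm.pow_const 2
  have m2 : AEMeasurable (fun s => ‖ds γ s‖ₑ ^ 2) (volume.restrict I) :=
    (h.ds_isPrimitive.continuousOn.aestronglyMeasurable_of_isCompact isCompact_Icc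
      measurableSet_Icc).enorm.pow_const 2
  have m3 : AEMeasurable (fun s => ‖γ s‖ₑ ^ 2 + ‖ds γ s‖ₑ ^ 2) (volume.restrict I) := m1.add m2
  unfold h2NormSq
  rw [lintegral_add_left' m3, lintegral_add_left' m1]

lemma lintegral_const_I (a : ℝ≥0∞) : ∫⁻ _ in I, a = a := by
  simp

lemma h2NormSq_le {γ : ℝ → Plane} (h : MemH2 γ) {a : ℝ≥0∞} (h1 : ∀ s ∈ I, ‖γ s‖ₑ ≤ a)
    (h2 : ∀ s ∈ I, ‖ds γ s‖ₑ ≤ a) :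
    h2NormSq γ ≤ 2 * a ^ 2 + ∫⁻ s in I, ‖dss γ s‖ₑ ^ 2 := by
  rw [h2NormSq_eq h, two_mul]
  gcongr
  · refine (setLIntegral_mono' measurableSet_Icc fun s hs =>
      pow_le_pow_left' (h1 s hs) 2).trans_eq (lintegral_const_I _)
  · refine (setLIntegral_mono' measurableSet_Icc fun s hs =>
      pow_le_pow_left' (h2 s hs) 2).trans_eq (lintegral_const_I _)

lemma lintegral_enorm_sq_eq {f : ℝ → Plane} (hf : MemLp f 2 (volume.restrict I)) :
    ∫⁻ s in I, ‖f s‖ₑ ^ 2 = ENNReal.ofReal (∫ s in (0 : ℝ)..1, ‖f s‖ ^ 2) := by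
  rw [intervalIntegral_eq_I, ofReal_integral_eq_lintegral_ofReal]
  · refine lintegral_congr fun s => ?_
    rw [ENNReal.ofReal_pow (norm_nonneg _), ofReal_norm]
  · exact hf.norm.integrable_sq
  · exact ae_of_all _ fun s => sq_nonneg _

lemma eLpNorm_two_sq (f : ℝ → Plane) :
    eLpNorm f 2 (volume.restrict I) ^ 2 = ∫⁻ s in I, ‖f s‖ₑ ^ 2 := by
  have := eLpNorm_nnreal_pow_eq_lintegral (f := f) (μ := volume.restrict I) (p := 2) two_ne_zero
  simpa using this

lemma tendsto_lintegral_enorm_sub_sq {a b : ℝ → Plane} {f : ℕ → ℝ → Plane}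
    (ha : MemLp a 2 (volume.restrict I)) (hb : MemLp b 2 (volume.restrict I))
    (hf : ∀ m, MemLp (f m) 2 (volume.restrict I))
    (h : Tendsto (fun m => ∫⁻ s in I, ‖f m s - b s‖ₑ ^ 2) atTop (𝓝 0)) :
    Tendsto (fun m => ∫⁻ s in I, ‖a s - f m s‖ₑ ^ 2) atTop (𝓝 (∫⁻ s in I, ‖a s - b s‖ₑ ^ 2)) := by
  have e : ∀ {x y : ℝ → Plane} (hx : MemLp x 2 (volume.restrict I))
      (hy : MemLp y 2 (volume.restrict I)),
      ∫⁻ s in I, ‖x s - y s‖ₑ ^ 2 = edist (hx.toLp x) (hy.toLp y) ^ 2 := by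
    intro x y hx hy
    rw [Lp.edist_toLp_toLp, eLpNorm_two_sq]
    rfl
  simp only [e ha hb, fun m => e ha (hf m), fun m => e (hf m) hb] at h ⊢
  have h2 : Tendsto (fun m => edist ((hf m).toLp (f m)) (hb.toLp b)) atTop (𝓝 0) := by
    have h4 := ((ENNReal.continuous_rpow_const (y := 1 / 2)).tendsto 0).comp h
    rw [ENNReal.zero_rpow_of_pos (by norm_num)] at h4
    refine h4.congr fun m => ?_
    rw [Function.comp_apply, ← ENNReal.rpow_natCast, ← ENNReal.rpow_mul]
    norm_num
  have h3 : Tendsto (fun m => (hf m).toLp (f m)) atTop (𝓝 (hb.toLp b)) :=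
    tendsto_iff_edist_tendsto_0.2 h2
  exact ((ENNReal.continuous_pow 2).tendsto _).comp (tendsto_const_nhds.edist h3)

lemma h2NormSq_sub_eq {γ γ' : ℝ → Plane} (h : MemH2 γ) (h' : MemH2 γ') :
    h2NormSq (γ - γ') = (∫⁻ s in I, ‖γ s - γ' s‖ₑ ^ 2) + (∫⁻ s in I, ‖ds γ s - ds γ' s‖ₑ ^ 2)
      + ∫⁻ s in I, ‖dss γ s - dss γ' s‖ₑ ^ 2 := by
  obtain ⟨h1, h2, h3⟩ := h.sub h'
  rw [h2NormSq_eq h1]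
  congr 1
  · congr 1
    exact setLIntegral_congr_fun measurableSet_Icc fun s hs => by simp only [h2 hs]
  · refine lintegral_congr_ae ?_
    filter_upwards [h3] with s hs
    rw [hs]

lemma MemH2.memLp {γ : ℝ → Plane} (h : MemH2 γ) : MemLp γ 2 (volume.restrict I) :=
  ContinuousOn.memLp_I h.isPrimitive.continuousOn 2

lemma MemH2.memLp_ds {γ : ℝ → Plane} (h : MemH2 γ) : MemLp (ds γ) 2 (volume.restrict I) :=
  ContinuousOn.memLp_I h.ds_isPrimitive.continuousOn 2

/-- Continuity of the distance, applied to each of the three squared `L²` distances. It serves both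
the measurability of the distance to the limit and the Fatou argument below. -/
lemma tendsto_h2NormSq_sub {w γ : ℝ → Plane} {v : ℕ → ℝ → Plane} (hw : MemH2 w) (hγ : MemH2 γ)
    (hv : ∀ m, MemH2 (v m)) (h : Tendsto (fun m => h2NormSq (v m - γ)) atTop (𝓝 0)) :
    Tendsto (fun m => h2NormSq (w - v m)) atTop (𝓝 (h2NormSq (w - γ))) := by
  simp only [fun m => h2NormSq_sub_eq (hv m) hγ] at h
  simp only [fun m => h2NormSq_sub_eq hw (hv m), h2NormSq_sub_eq hw hγ]
  refine ((tendsto_lintegral_enorm_sub_sq hw.memLp hγ.memLp (fun m => (hv m).memLp) ?_).add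
    (tendsto_lintegral_enorm_sub_sq hw.memLp_ds hγ.memLp_ds (fun m => (hv m).memLp_ds) ?_)).add
    (tendsto_lintegral_enorm_sub_sq hw.memLp_dss hγ.memLp_dss (fun m => (hv m).memLp_dss) ?_)
  · exact tendsto_of_tendsto_of_tendsto_of_le_of_le tendsto_const_nhds h (fun _ => zero_le)
      fun m => le_add_right le_self_add
  · exact tendsto_of_tendsto_of_tendsto_of_le_of_le tendsto_const_nhds h (fun _ => zero_le)
      fun m => le_add_right le_add_self
  · exact tendsto_of_tendsto_of_tendsto_of_le_of_le tendsto_const_nhds h (fun _ => zero_le)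
      fun m => le_add_self

lemma lintegral_enorm_sq_le {a b : ℝ → Plane}
    (ha : AEStronglyMeasurable a (volume.restrict I)) :
    ∫⁻ s in I, ‖b s‖ₑ ^ 2 ≤
      2 * (∫⁻ s in I, ‖a s‖ₑ ^ 2) + 2 * ∫⁻ s in I, ‖a s - b s‖ₑ ^ 2 := by
  rw [← lintegral_const_mul' _ _ ENNReal.ofNat_ne_top,
    ← lintegral_const_mul' _ _ ENNReal.ofNat_ne_top,
    ← lintegral_add_left' ((ha.enorm.pow_const 2).const_mul 2)]
  refine lintegral_mono fun s => ?_
  have e : ‖b s‖ ^ 2 ≤ 2 * ‖a s‖ ^ 2 + 2 * ‖a s - b s‖ ^ 2 := by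
    have h1 : ‖b s‖ ≤ ‖a s‖ + ‖a s - b s‖ := by
      have := norm_sub_le (a s) (a s - b s)
      rwa [sub_sub_cancel] at this
    have h2 := pow_le_pow_left₀ (norm_nonneg _) h1 2
    have h3 := add_sq_le (a := ‖a s‖) (b := ‖a s - b s‖)
    linarith
  have := ENNReal.ofReal_le_ofReal e
  rw [ENNReal.ofReal_add (by positivity) (by positivity), ENNReal.ofReal_mul zero_le_two,
    ENNReal.ofReal_mul zero_le_two] at this
  simpa [ENNReal.ofReal_pow, ofReal_norm] using this

lemma h2NormSq_le_two_mul {u γ : ℝ → Plane} (hu : MemH2 u) (hγ : MemH2 γ) :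
    h2NormSq γ ≤ 2 * h2NormSq u + 2 * h2NormSq (u - γ) := by
  rw [h2NormSq_eq hu, h2NormSq_eq hγ, h2NormSq_sub_eq hu hγ]
  have e1 := lintegral_enorm_sq_le (b := γ) hu.memLp.1
  have e2 := lintegral_enorm_sq_le (b := ds γ) hu.memLp_ds.1
  have e3 := lintegral_enorm_sq_le (b := dss γ) hu.memLp_dss.1
  refine (add_le_add (add_le_add e1 e2) e3).trans_eq ?_
  ring

lemma h2NormSq_lt_top {γ : ℝ → Plane} (h : MemH2 γ) : h2NormSq γ < ∞ := by
  rw [h2NormSq_eq h, lintegral_enorm_sq_eq h.memLp, lintegral_enorm_sq_eq h.memLp_ds,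
    lintegral_enorm_sq_eq h.memLp_dss]
  simp

/-! ### Completeness -/

lemma isPrimitive_of_contDiffOn {γ : ℝ → Plane} (h : ContDiffOn ℝ 1 γ I) :
    IsPrimitive γ (ds γ) :=
  IsPrimitive.of_hasDerivWithinAt (h.continuousOn_derivWithin uniqueDiffOn_I le_rfl)
    fun s hs => (h.differentiableOn one_ne_zero s hs).hasDerivWithinAt

lemma ds_sub_of_contDiffOn {u γ : ℝ → Plane} (hu : MemH2 u) (h : ContDiffOn ℝ 1 γ I) {s : ℝ}
    (hs : s ∈ I) : ds (u - γ) s = ds u s - ds γ s :=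
  derivWithin_sub (hu.differentiableOn s hs) (h.differentiableOn one_ne_zero s hs)

instance : IsProbabilityMeasure (volume.restrict I) := ⟨by simp⟩

lemma intervalIntegral_eq_setIntegral_I (f : ℝ → Plane) {s : ℝ} (hs : s ∈ I) :
    ∫ r in (0 : ℝ)..s, f r = ∫ r in Ioc 0 s, f r ∂(volume.restrict I) := by
  rw [intervalIntegral.integral_of_le hs.1, Measure.restrict_restrict measurableSet_Ioc,
    inter_eq_left.2 (Ioc_subset_Icc_self.trans (Icc_subset_Icc le_rfl hs.2))]

/-- The second derivatives are Cauchy in `L²` at a geometric rate. Since the first derivatives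
converge to that of `γ`, passing to the limit in the integral formula shows that the `L²` limit is
the second derivative of `γ`. -/
lemma memH2_of_cauchy {v : ℕ → ℝ → Plane} {γ : ℝ → Plane} (hv : ∀ m, MemH2 (v m))
    (hγ : ContDiffOn ℝ 1 γ I) {a : ℕ → ℝ≥0∞} (ha : Tendsto a atTop (𝓝 0))
    (h1 : ∀ m, ∀ s ∈ I, ‖(v m - γ) s‖ₑ ≤ a m) (h2 : ∀ m, ∀ s ∈ I, ‖ds (v m - γ) s‖ₑ ≤ a m)
    {C : ℝ≥0∞} (hC : C ≠ ∞) (h3 : ∀ m, h2NormSq (v m - v (m + 1)) ≤ C / 4 ^ m) :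
    MemH2 γ ∧ Tendsto (fun m => h2NormSq (v m - γ)) atTop (𝓝 0) := by
  set w : ℕ → Lp Plane 2 (volume.restrict I) := fun m => (hv m).memLp_dss.toLp (dss (v m)) with hw
  have hstep : ∀ m, edist (w m) (w (m + 1)) ≤ C ^ (1 / 2 : ℝ) / 2 ^ m := by
    intro m
    have e1 : edist (w m) (w (m + 1)) ^ 2 ≤ C / 4 ^ m := by
      rw [hw, Lp.edist_toLp_toLp, eLpNorm_two_sq]
      refine le_trans ?_ (h3 m)
      rw [h2NormSq_sub_eq (hv m) (hv (m + 1))]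
      exact le_add_self
    have e2 : (C ^ (1 / 2 : ℝ) / 2 ^ m) ^ 2 = C / 4 ^ m := by
      rw [div_eq_mul_inv, mul_pow, div_eq_mul_inv, ← ENNReal.inv_pow, ← pow_mul, mul_comm m 2,
        pow_mul, ← ENNReal.rpow_natCast, ← ENNReal.rpow_mul]
      norm_num [div_eq_mul_inv]
    rw [← e2] at e1
    exact (ENNReal.pow_le_pow_left_iff two_ne_zero).1 e1
  obtain ⟨g', hg'⟩ := cauchySeq_tendsto_of_complete
    (cauchySeq_of_edist_le_geometric_two (C ^ (1 / 2 : ℝ))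
      (ENNReal.rpow_ne_top_of_nonneg (by norm_num) hC) hstep)
  set g : ℝ → Plane := ⇑g' with hg
  have hgm : MemLp g 2 (volume.restrict I) := Lp.memLp g'
  have hL2 : Tendsto (fun m => eLpNorm (dss (v m) - g) 2 (volume.restrict I)) atTop (𝓝 0) := by
    have := tendsto_iff_edist_tendsto_0.1 hg'
    refine this.congr fun m => ?_
    have e : g' = hgm.toLp g := (Lp.toLp_coeFn g' hgm).symm
    rw [e, hw, Lp.edist_toLp_toLp]
  have hL1 : Tendsto (fun m => eLpNorm (dss (v m) - g) 1 (volume.restrict I)) atTop (𝓝 0) :=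
    tendsto_of_tendsto_of_tendsto_of_le_of_le tendsto_const_nhds hL2 (fun _ => zero_le)
      fun m => eLpNorm_le_eLpNorm_of_exponent_le one_le_two ((hv m).memLp_dss.sub hgm).1
  have hds : ∀ s ∈ I, Tendsto (fun m => ds (v m) s) atTop (𝓝 (ds γ s)) := by
    intro s hs
    rw [tendsto_iff_edist_tendsto_0]
    refine tendsto_of_tendsto_of_tendsto_of_le_of_le tendsto_const_nhds ha (fun _ => zero_le)
      fun m => ?_
    rw [edist_eq_enorm_sub, ← ds_sub_of_contDiffOn (hv m) hγ hs]
    exact h2 m s hs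
  have hprim : IsPrimitive (ds γ) g := by
    refine ⟨memLp_two_intervalIntegrable hgm, fun s hs => ?_⟩
    have e1 := tendsto_setIntegral_of_L1' g hgm.1
      (Eventually.of_forall fun m => (hv m).memLp_dss.integrable one_le_two) hL1 (Ioc 0 s)
    have e2 := (hds 0 zero_mem_I).add e1
    rw [← intervalIntegral_eq_setIntegral_I g hs] at e2
    refine tendsto_nhds_unique (hds s hs) (e2.congr fun m => ?_)
    rw [← intervalIntegral_eq_setIntegral_I _ hs, ← (hv m).ds_eq s hs]
  obtain ⟨hH2, -, hae⟩ := memH2_of_isPrimitive (isPrimitive_of_contDiffOn hγ) hprim hgm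
  refine ⟨hH2, ?_⟩
  have hlim : Tendsto (fun m => 2 * a m ^ 2 + eLpNorm (dss (v m) - g) 2 (volume.restrict I) ^ 2)
      atTop (𝓝 0) := by
    have e1 := ENNReal.Tendsto.const_mul (a := 2) (((ENNReal.continuous_pow 2).tendsto 0).comp ha)
      (Or.inr ENNReal.ofNat_ne_top)
    have e2 := e1.add (((ENNReal.continuous_pow 2).tendsto 0).comp hL2)
    simpa [Function.comp_def] using e2
  refine tendsto_of_tendsto_of_tendsto_of_le_of_le tendsto_const_nhds hlim (fun _ => zero_le)
    fun m => ?_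
  refine (h2NormSq_le ((hv m).sub hH2).1 (h1 m) (h2 m)).trans_eq ?_
  rw [eLpNorm_two_sq]
  congr 1
  refine lintegral_congr_ae ?_
  filter_upwards [((hv m).sub hH2).2.2, hae] with s e1 e2
  rw [e1, e2]; rfl

lemma ae_Ioi_of_ae_Ioo {p : ℝ → Prop}
    (h : ∀ N : ℕ, ∀ᵐ t ∂(volume.restrict (Ioo (0 : ℝ) N)), p t) :
    ∀ᵐ t ∂(volume.restrict (Ioi (0 : ℝ))), p t := by
  have e : Ioi (0 : ℝ) = ⋃ N : ℕ, Ioo (0 : ℝ) N := by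
    ext t
    simp only [mem_Ioi, mem_iUnion, mem_Ioo, exists_and_left, iff_self_and]
    exact fun _ => exists_nat_gt t
  rw [e, ae_restrict_iUnion_iff]
  exact h

lemma ae_Ioo_of_ae_Ioi {p : ℝ → Prop} (h : ∀ᵐ t ∂(volume.restrict (Ioi (0 : ℝ))), p t) (T : ℝ) :
    ∀ᵐ t ∂(volume.restrict (Ioo 0 T)), p t :=
  ae_restrict_of_ae_restrict_of_subset (fun _ ht => ht.1) h

/-- Riesz–Fischer for `H²`-valued functions of time: a rapidly Cauchy subsequence converges in `H²`
at almost every time, the `C¹` convergence identifies its limit, and Fatou's lemma turns the Cauchy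
property into convergence. -/
lemma exists_subseq_tendstoL2H2 {u : ℕ → ℝ → ℝ → Plane} {γ : ℝ → ℝ → Plane}
    (hu : ∀ k, ∀ t > 0, MemH2 (u k t))
    (hmeas : ∀ k j, Measurable fun t => h2NormSq (u k t - u j t))
    (hmeas' : ∀ k, Measurable fun t => h2NormSq (u k t))
    (hfin : ∀ k, ∀ T > 0, ∫⁻ t in Ioo 0 T, h2NormSq (u k t) < ∞)
    (hcau : ∀ T > 0, ∀ η > 0, ∃ K : ℕ, ∀ k ≥ K, ∀ j ≥ K,
      ∫⁻ t in Ioo 0 T, h2NormSq (u k t - u j t) ≤ η)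
    (hγ : ∀ᵐ t ∂(volume.restrict (Ioi (0 : ℝ))), ContDiffOn ℝ 1 (γ t) I)
    (hlim : ∀ᵐ t ∂(volume.restrict (Ioi (0 : ℝ))), ∃ a : ℕ → ℝ≥0∞, Tendsto a atTop (𝓝 0) ∧
      ∀ m, ∀ s ∈ I, ‖(u m t - γ t) s‖ₑ ≤ a m ∧ ‖ds (u m t - γ t) s‖ₑ ≤ a m) :
    ∃ φ : ℕ → ℕ, StrictMono φ ∧ TendstoL2H2 (fun k => u (φ k)) γ := by
  -- The rate `8⁻¹ ^ m` still sums after multiplication by `4 ^ m`; finiteness of that weighted sum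
  -- at a given time bounds squared increments by `C / 4 ^ m`. The horizon `m + 1` grows so that one
  -- subsequence serves every `T`.
  obtain ⟨φ, hφ, hφb⟩ := extraction_forall_of_eventually
    (P := fun m k => ∀ i ≥ k, ∀ j ≥ k,
      ∫⁻ t in Ioo 0 ((m : ℝ) + 1), h2NormSq (u i t - u j t) ≤ (8⁻¹ : ℝ≥0∞) ^ m) (by
    intro m
    obtain ⟨K, hK⟩ := hcau ((m : ℝ) + 1) (by positivity) ((8⁻¹ : ℝ≥0∞) ^ m)
      (ENNReal.pow_pos (by simp) m)
    filter_upwards [eventually_ge_atTop K] with k hk i hi j hj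
    exact hK i (hk.trans hi) j (hk.trans hj))
  have hmain : ∀ᵐ t ∂(volume.restrict (Ioi (0 : ℝ))),
      MemH2 (γ t) ∧ Tendsto (fun m => h2NormSq (u (φ m) t - γ t)) atTop (𝓝 0) := by
    refine ae_Ioi_of_ae_Ioo fun N => ?_
    -- Shifting the index by `N` makes all the time horizons involved contain `(0, N)`.
    have hsum : ∫⁻ t in Ioo (0 : ℝ) N,
        ∑' m, 4 ^ m * h2NormSq (u (φ (m + N)) t - u (φ (m + N + 1)) t) ≠ ∞ := by
      rw [lintegral_tsum fun m => ((hmeas _ _).const_mul _).aemeasurable]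
      refine ne_top_of_le_ne_top (b := ∑' m : ℕ, (2⁻¹ : ℝ≥0∞) ^ m) ?_ ?_
      · rw [ENNReal.tsum_geometric, ENNReal.one_sub_inv_two]; simp
      refine ENNReal.tsum_le_tsum fun m => ?_
      rw [lintegral_const_mul _ (hmeas _ _)]
      have e1 : ∫⁻ t in Ioo (0 : ℝ) N, h2NormSq (u (φ (m + N)) t - u (φ (m + N + 1)) t) ≤
          (8⁻¹ : ℝ≥0∞) ^ (m + N) := by
        refine le_trans (lintegral_mono_set (Ioo_subset_Ioo le_rfl ?_))
          (hφb (m + N) _ le_rfl _ (hφ.monotone (Nat.le_succ _)))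
        push_cast
        linarith [(Nat.cast_nonneg m : (0 : ℝ) ≤ m)]
      have e2 : (8⁻¹ : ℝ≥0∞) ^ (m + N) ≤ 8⁻¹ ^ m :=
        pow_le_pow_right_of_le_one' (by simp) (Nat.le_add_right _ _)
      calc _ ≤ (4 : ℝ≥0∞) ^ m * 8⁻¹ ^ m := by gcongr; exact e1.trans e2
        _ = (4 * 8⁻¹) ^ m := (mul_pow _ _ _).symm
        _ = 2⁻¹ ^ m := by
          congr 1
          rw [show (8 : ℝ≥0∞) = 4 * 2 by norm_num, ENNReal.mul_inv (by simp) (by simp),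
            ← mul_assoc, ENNReal.mul_inv_cancel (by simp) (by simp), one_mul]
    have hae := ae_lt_top' (AEMeasurable.tsum fun m =>
      ((hmeas (φ (m + N)) (φ (m + N + 1))).const_mul (4 ^ m)).aemeasurable) hsum
    filter_upwards [hae, ae_Ioo_of_ae_Ioi hγ N, ae_Ioo_of_ae_Ioi hlim N,
      ae_restrict_mem measurableSet_Ioo] with t ht hγt ⟨a, ha, hb⟩ htI
    have hshift : Tendsto (fun m => φ (m + N)) atTop atTop :=
      hφ.tendsto_atTop.comp (tendsto_add_atTop_nat N)
    have key := memH2_of_cauchy (v := fun m => u (φ (m + N)) t) (γ := γ t)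
      (fun m => hu _ t htI.1) hγt (ha.comp hshift) (fun m s hs => (hb _ s hs).1)
      (fun m s hs => (hb _ s hs).2) ht.ne (fun m => by
        rw [ENNReal.le_div_iff_mul_le (by simp) (by simp), mul_comm, add_right_comm]
        exact ENNReal.le_tsum (f := fun m => 4 ^ m *
          h2NormSq (u (φ (m + N)) t - u (φ (m + N + 1)) t)) m)
    exact ⟨key.1, (tendsto_add_atTop_iff_nat N).1 key.2⟩
  refine ⟨φ, hφ, hmain.mono fun t ht => ht.1, fun T hT => ?_⟩
  have hconv : ∀ k, ∀ᵐ t ∂(volume.restrict (Ioo 0 T)),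
      Tendsto (fun m => h2NormSq (u (φ k) t - u (φ m) t)) atTop
        (𝓝 (h2NormSq (u (φ k) t - γ t))) := by
    intro k
    filter_upwards [ae_Ioo_of_ae_Ioi hmain T, ae_restrict_mem measurableSet_Ioo] with t ht htI
    exact tendsto_h2NormSq_sub (hu _ t htI.1) ht.1 (fun m => hu _ t htI.1) ht.2
  -- Measurability of the distance to the limit is inherited from distances between members of the
  -- subsequence.
  have hmeasT : ∀ k, AEMeasurable (fun t => h2NormSq (u (φ k) t - γ t))
      (volume.restrict (Ioo 0 T)) := fun k =>
    aemeasurable_of_tendsto_metrizable_ae atTop (fun m => (hmeas (φ k) (φ m)).aemeasurable)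
      (hconv k)
  have hfatou : ∀ η > 0, ∃ K : ℕ, ∀ k ≥ K,
      ∫⁻ t in Ioo 0 T, h2NormSq (u (φ k) t - γ t) ≤ η := by
    intro η hη
    obtain ⟨K, hK⟩ := hcau T hT η hη
    refine ⟨K, fun k hk => ?_⟩
    have e1 : ∫⁻ t in Ioo 0 T, h2NormSq (u (φ k) t - γ t) =
        ∫⁻ t in Ioo 0 T, liminf (fun m => h2NormSq (u (φ k) t - u (φ m) t)) atTop := by
      refine lintegral_congr_ae ?_
      filter_upwards [hconv k] with t ht
      exact ht.liminf_eq.symm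
    rw [e1]
    refine (lintegral_liminf_le fun m => hmeas (φ k) (φ m)).trans ?_
    refine liminf_le_of_frequently_le' (Eventually.frequently ?_)
    filter_upwards [eventually_ge_atTop K] with m hm
    exact hK _ (hk.trans (hφ.id_le k)) _ (hm.trans (hφ.id_le m))
  refine ⟨hmeasT, ?_, ?_⟩
  · obtain ⟨K, hK⟩ := hfatou 1 one_pos
    have e1 : ∫⁻ t in Ioo 0 T, h2NormSq (γ t) ≤
        ∫⁻ t in Ioo 0 T, (2 * h2NormSq (u (φ K) t) + 2 * h2NormSq (u (φ K) t - γ t)) := by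
      refine lintegral_mono_ae ?_
      filter_upwards [ae_Ioo_of_ae_Ioi hmain T, ae_restrict_mem measurableSet_Ioo] with t ht htI
      exact h2NormSq_le_two_mul (hu _ t htI.1) ht.1
    refine e1.trans_lt ?_
    rw [lintegral_add_left ((hmeas' _).const_mul 2), lintegral_const_mul _ (hmeas' _),
      lintegral_const_mul' _ _ ENNReal.ofNat_ne_top]
    exact ENNReal.add_lt_top.2 ⟨ENNReal.mul_lt_top ENNReal.ofNat_lt_top (hfin _ T hT),
      ENNReal.mul_lt_top ENNReal.ofNat_lt_top ((hK K le_rfl).trans_lt ENNReal.one_lt_top)⟩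
  · rw [ENNReal.tendsto_atTop_zero]
    exact hfatou


/-! ### Strong convergence from convergence in `C¹` -/

/-- With `κ = ω / L` the second derivative is `L ^ 2 κ nor θ`. The difference splits into those of
curvature, length and normal; the last two are of order `σ`. -/
lemma integral_dss_sub_sq_le {m M σ : ℝ} (hm : 0 < m) (hM : 1 ≤ M) (hσ0 : 0 ≤ σ) (hσ : σ ≤ 1)
    {γ γ' : ℝ → Plane} {L L' : ℝ} {θ ω θ' ω' : ℝ → ℝ} (hp : Polar γ L θ ω)
    (hp' : Polar γ' L' θ' ω') (hc : Controlled m M γ L ω) (hc' : Controlled m M γ' L' ω')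
    (hLσ : |L' - L| ≤ σ) (hθ : ∀ s ∈ I, |θ' s - θ s| ≤ σ) :
    ∫ s in (0 : ℝ)..1, ‖dss γ s - dss γ' s‖ ^ 2 ≤
      2 * M ^ 4 * (∫ s in (0 : ℝ)..1, (ω s / L - ω' s / L') ^ 2) + 18 * M ^ 6 * σ / m ^ 2 := by
  have hL := hp.pos
  have hL' := hp'.pos
  have hpt : ∀ᵐ s ∂(volume.restrict I), ‖dss γ s - dss γ' s‖ ^ 2 ≤
      2 * M ^ 4 * (ω s / L - ω' s / L') ^ 2 + 18 * M ^ 4 * σ / m ^ 2 * ω' s ^ 2 := by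
    filter_upwards [hp.dss_ae, hp'.dss_ae, ae_restrict_mem measurableSet_Icc] with s h1 h2 hs
    rw [h1, h2]
    set κ := ω s / L with hκ
    set κ' := ω' s / L' with hκ'
    have e1 : (L * ω s) • nor (θ s) - (L' * ω' s) • nor (θ' s) =
        (L ^ 2 * (κ - κ')) • nor (θ s) + ((L ^ 2 - L' ^ 2) * κ') • nor (θ s)
          + (L' ^ 2 * κ') • (nor (θ s) - nor (θ' s)) := by
      have f1 : ω s = L * κ := by rw [hκ]; field_simp
      have f2 : ω' s = L' * κ' := by rw [hκ']; field_simp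
      rw [f1, f2]; module
    have e2 : ‖(L * ω s) • nor (θ s) - (L' * ω' s) • nor (θ' s)‖ ≤
        M ^ 2 * |κ - κ'| + 3 * M ^ 2 * σ * |κ'| := by
      rw [e1]
      refine (norm_add₃_le).trans ?_
      rw [norm_smul, norm_smul, norm_smul, norm_nor, mul_one, mul_one, Real.norm_eq_abs,
        Real.norm_eq_abs, Real.norm_eq_abs, abs_mul, abs_mul, abs_mul, abs_of_nonneg (sq_nonneg L),
        abs_of_nonneg (sq_nonneg L')]
      have g1 : L ^ 2 ≤ M ^ 2 := pow_le_pow_left₀ hL.le hc.length_le 2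
      have g2 : L' ^ 2 ≤ M ^ 2 := pow_le_pow_left₀ hL'.le hc'.length_le 2
      have g3 : |L ^ 2 - L' ^ 2| ≤ 2 * M ^ 2 * σ := by
        rw [show L ^ 2 - L' ^ 2 = -((L' - L) * (L + L')) by ring, abs_neg, abs_mul,
          abs_of_pos (by linarith : 0 < L + L')]
        have : L + L' ≤ 2 * M ^ 2 := by nlinarith [hc.length_le, hc'.length_le]
        calc |L' - L| * (L + L') ≤ σ * (2 * M ^ 2) :=
              mul_le_mul hLσ this (by linarith) hσ0
          _ = _ := by ring
      have g4 : ‖nor (θ s) - nor (θ' s)‖ ≤ σ := by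
        refine (norm_nor_sub_le _ _).trans ?_
        rw [abs_sub_comm]; exact hθ s hs
      have g5 := mul_le_mul_of_nonneg_right g1 (abs_nonneg (κ - κ'))
      have g6 := mul_le_mul_of_nonneg_right g3 (abs_nonneg κ')
      have g7 : L' ^ 2 * |κ'| * ‖nor (θ s) - nor (θ' s)‖ ≤ M ^ 2 * |κ'| * σ :=
        mul_le_mul (mul_le_mul_of_nonneg_right g2 (abs_nonneg _)) g4 (norm_nonneg _)
          (by positivity)
      linarith
    have e3 : |κ'| ≤ |ω' s| / m := by
      rw [hκ', abs_div, abs_of_pos hL']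
      exact div_le_div_of_nonneg_left (abs_nonneg _) hm hc'.le_length
    have e4 : 3 * M ^ 2 * σ * |κ'| ≤ 3 * M ^ 2 * σ * (|ω' s| / m) :=
      mul_le_mul_of_nonneg_left e3 (by positivity)
    have e5 := pow_le_pow_left₀ (norm_nonneg _) (e2.trans (add_le_add le_rfl e4)) 2
    refine (e5.trans add_sq_le).trans ?_
    have e6 : σ ^ 2 ≤ σ := by nlinarith
    have e7 : (3 * M ^ 2 * σ * (|ω' s| / m)) ^ 2 = 9 * M ^ 4 * ω' s ^ 2 / m ^ 2 * σ ^ 2 := by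
      rw [← sq_abs (ω' s)]; field_simp; ring
    have e8 : (M ^ 2 * |κ - κ'|) ^ 2 = M ^ 4 * (κ - κ') ^ 2 := by
      rw [← sq_abs (κ - κ')]; ring
    have e9 : 9 * M ^ 4 * ω' s ^ 2 / m ^ 2 * σ ^ 2 ≤ 9 * M ^ 4 * ω' s ^ 2 / m ^ 2 * σ :=
      mul_le_mul_of_nonneg_left e6 (by positivity)
    rw [e7, e8]
    calc _ ≤ 2 * (M ^ 4 * (κ - κ') ^ 2 + 9 * M ^ 4 * ω' s ^ 2 / m ^ 2 * σ) := by linarith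
      _ = _ := by ring
  have i1 : IntervalIntegrable (fun s => ‖dss γ s - dss γ' s‖ ^ 2) volume 0 1 := by
    rw [intervalIntegrable_iff_I]
    exact (hp.memH2.memLp_dss.sub hp'.memH2.memLp_dss).norm.integrable_sq
  have i2 : IntervalIntegrable (fun s => (ω s / L - ω' s / L') ^ 2) volume 0 1 := by
    simp only [div_eq_mul_inv]
    exact integrable_sq_I ((hp.memLp.mul_const L⁻¹).sub (hp'.memLp.mul_const L'⁻¹))
  have i3 := integrable_sq_I hp'.memLp
  have e : ∫ s in (0 : ℝ)..1, ‖dss γ s - dss γ' s‖ ^ 2 ≤ ∫ s in (0 : ℝ)..1,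
      (2 * M ^ 4 * (ω s / L - ω' s / L') ^ 2 + 18 * M ^ 4 * σ / m ^ 2 * ω' s ^ 2) :=
    intervalIntegral.integral_mono_ae_restrict zero_le_one i1
      ((i2.const_mul _).add (i3.const_mul _)) hpt
  rw [intervalIntegral.integral_add (i2.const_mul _) (i3.const_mul _),
    intervalIntegral.integral_const_mul, intervalIntegral.integral_const_mul] at e
  refine e.trans (add_le_add le_rfl ?_)
  calc _ ≤ 18 * M ^ 4 * σ / m ^ 2 * M ^ 2 :=
        mul_le_mul_of_nonneg_left hc'.integral_sq_le (by positivity)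
    _ = _ := by ring

/-- A step of the minimization scheme from `β` to a nearby `γ`, with uniform bounds. -/
structure MinStep (ε m M τ : ℝ) (β γ : ℝ → Plane) : Prop where
  tame_prev : Tame m M β
  tame : Tame m M γ
  isMinOn : IsMinOn (fun γ => energy ε γ + 1 / τ * dissipation γ β) (admissibleFrom β) γ
  close : ∀ s ∈ I, ‖γ s - β s‖ ≤ 1
  ds_close : ∀ s ∈ I, ‖ds γ s - ds β s‖ ≤ m / 4

-- The comparison inequality is used twice, with the two minimizers exchanged; the differences of
-- length and bending cancel in the sum.
set_option maxHeartbeats 400000 in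
lemma exists_h2_close {ε m M : ℝ} (hε : 0 < ε) (hm : 0 < m) (hM : 1 ≤ M) :
    ∃ C > 0, ∃ τ₀ > 0, ∃ η₀ > 0, ∀ τ τ' η : ℝ, 0 < τ → τ ≤ τ₀ → 0 < τ' → τ' ≤ τ₀ →
      0 ≤ η → η ≤ η₀ → ∀ β γ β' γ' : ℝ → Plane, MinStep ε m M τ β γ → MinStep ε m M τ' β' γ' →
      (∀ s ∈ I, ‖γ s - γ' s‖ ≤ η) → (∀ s ∈ I, ‖ds γ s - ds γ' s‖ ≤ η) →
      h2NormSq (γ - γ') ≤ ENNReal.ofReal (C * η * (1 + size (fun s => γ s - β s) / τ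
        + size (fun s => γ' s - β' s) / τ')) := by
  set k := ε * m ^ 2 / (4 * M) with hk
  have hk0 : 0 < k := by positivity
  set D := (2 + M) * (7 * M * (2 + M) + 4 / m) with hD
  have hD0 : 0 < D := by positivity
  -- With this factor, `σ = η a` dominates both `η`, for initial points and lengths, and `4 η / m`,
  -- for the angles.
  set a := 1 + 4 / m with ha
  have ha0 : 0 < a := by positivity
  have ha1 : 1 ≤ a := by
    have : 0 < 4 / m := by positivity
    linarith
  refine ⟨2 + 2 * M ^ 4 * (D * a / k) + 18 * M ^ 6 * a / m ^ 2, by positivity,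
    min (1 / 2) (min (1 / (2 + M)) (m / 4 / (2 + M))), by positivity, min (m / 4) (1 / a),
    by positivity, ?_⟩
  intro τ τ' η hτ hτle hτ' hτle' hη0 hη β γ β' γ' h h' hcl hds
  obtain ⟨t1, t2⟩ := le_min_iff.1 hτle
  obtain ⟨t2, t3⟩ := le_min_iff.1 t2
  obtain ⟨t1', t2'⟩ := le_min_iff.1 hτle'
  obtain ⟨t2', t3'⟩ := le_min_iff.1 t2'
  rw [le_div_iff₀ (by positivity)] at t2 t3 t2' t3'
  obtain ⟨hη1, hη2⟩ := le_min_iff.1 hη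
  rw [le_div_iff₀ ha0] at hη2
  obtain ⟨α, φ, hβ, hcβ⟩ := h.tame_prev
  obtain ⟨α', φ', hβ', hcβ'⟩ := h'.tame_prev
  obtain ⟨θ, ω, hp, hc⟩ := h.tame
  obtain ⟨θ', ω', hp', hc'⟩ := h'.tame
  obtain ⟨hL, n, hn⟩ := exists_angle_close hm hp hp' hc hη1 hds
  have hq := hp'.add_two_pi_mul n
  set L := length γ with hLd
  set L' := length γ' with hLd'
  set ψ : ℝ → ℝ := fun s => θ' s + n * (2 * Real.pi) with hψ
  set σ := η * a with hσ
  have hσ0 : 0 ≤ σ := by positivity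
  have hησ : η ≤ σ := le_mul_of_one_le_right hη0 ha1
  have hψσ : ∀ s ∈ I, |ψ s - θ s| ≤ σ := by
    intro s hs
    refine (hn s hs).trans ?_
    rw [hσ, ha]
    have : 4 * η / m = η * (4 / m) := by ring
    rw [this]
    linarith
  have m1 := curvature_gap_le_of_isMinOn hm hM hε hτ t1 t2 t3 hσ0 hη2 hβ hp hq hcβ hc hc'
    h.isMinOn h.close h.ds_close
    (by rw [norm_sub_rev]; exact (hcl 0 zero_mem_I).trans hησ) (hL.trans hησ) hψσ
  have m2 := curvature_gap_le_of_isMinOn hm hM hε hτ' t1' t2' t3' hσ0 hη2 hβ' hq hp hcβ' hc' hc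
    h'.isMinOn h'.close h'.ds_close ((hcl 0 zero_mem_I).trans hησ)
    (by rw [abs_sub_comm]; exact hL.trans hησ)
    (fun s hs => by rw [abs_sub_comm]; exact hψσ s hs)
  have hX : ∫ s in (0 : ℝ)..1, (ω' s / L' - ω s / L) ^ 2 =
      ∫ s in (0 : ℝ)..1, (ω s / L - ω' s / L') ^ 2 :=
    intervalIntegral.integral_congr fun s _ => by ring
  rw [hX] at m2
  have m3 := integral_dss_sub_sq_le hm hM hσ0 hη2 hp hq hc hc' (hL.trans hησ) hψσ
  set X := ∫ s in (0 : ℝ)..1, (ω s / L - ω' s / L') ^ 2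
  set V := size (fun s => γ s - β s) / τ
  set V' := size (fun s => γ' s - β' s) / τ'
  have hV : 0 ≤ V := div_nonneg (size_nonneg _) hτ.le
  have hV' : 0 ≤ V' := div_nonneg (size_nonneg _) hτ'.le
  have m4 : X ≤ D * a / k * η * (1 + V + V') := by
    -- Sum of the two comparison inequalities.
    have e1 : 2 * (k * X) ≤ D * σ * (2 + V + V') := by linarith
    have e2 : D * σ * (2 + V + V') ≤ D * σ * (2 * (1 + V + V')) :=
      mul_le_mul_of_nonneg_left (by linarith) (by positivity)
    have e3 : D * a / k * η * (1 + V + V') = D * σ * (1 + V + V') / k := by rw [hσ]; ring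
    rw [e3, le_div_iff₀ hk0]
    linarith
  have hH := hp.memH2.sub hp'.memH2
  have hb := h2NormSq_le (a := ENNReal.ofReal η) hH.1
    (fun s hs => by
      rw [← ofReal_norm]; exact ENNReal.ofReal_le_ofReal (hcl s hs))
    (fun s hs => by
      rw [hH.2.1 hs, ← ofReal_norm]; exact ENNReal.ofReal_le_ofReal (hds s hs))
  refine hb.trans ?_
  have e1 : ∫⁻ s in I, ‖dss (γ - γ') s‖ₑ ^ 2 =
      ENNReal.ofReal (∫ s in (0 : ℝ)..1, ‖dss γ s - dss γ' s‖ ^ 2) := by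
    rw [← lintegral_enorm_sq_eq (f := fun s => dss γ s - dss γ' s)
      (hp.memH2.memLp_dss.sub hp'.memH2.memLp_dss)]
    refine lintegral_congr_ae ?_
    filter_upwards [hH.2.2] with s hs
    rw [hs]
  have e2 : 2 * ENNReal.ofReal (η ^ 2) = ENNReal.ofReal (2 * η ^ 2) := by
    rw [ENNReal.ofReal_mul zero_le_two, ENNReal.ofReal_ofNat]
  rw [e1, ← ENNReal.ofReal_pow hη0, e2,
    ← ENNReal.ofReal_add (by positivity)
      (intervalIntegral.integral_nonneg zero_le_one fun _ _ => sq_nonneg _)]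
  refine ENNReal.ofReal_le_ofReal ?_
  have f1 : η ^ 2 ≤ η * (1 + V + V') := by
    rw [sq]
    exact mul_le_mul_of_nonneg_left (by linarith) hη0
  have f2 : 2 * M ^ 4 * X ≤ 2 * M ^ 4 * (D * a / k * η * (1 + V + V')) :=
    mul_le_mul_of_nonneg_left m4 (by positivity)
  have f3 : 18 * M ^ 6 * σ / m ^ 2 ≤ 18 * M ^ 6 * σ / m ^ 2 * (1 + V + V') :=
    le_mul_of_one_le_right (by positivity) (by linarith)
  calc 2 * η ^ 2 + ∫ s in (0 : ℝ)..1, ‖dss γ s - dss γ' s‖ ^ 2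
      ≤ 2 * (η * (1 + V + V')) + (2 * M ^ 4 * (D * a / k * η * (1 + V + V'))
        + 18 * M ^ 6 * σ / m ^ 2 * (1 + V + V')) := by linarith
    _ = _ := by rw [hσ]; ring

/-- A single step moves the curve by `O(√τ)` in `size`; interpolation makes it a small step in `C¹`
once `τ` is small. -/
lemma exists_minStep {ε : ℝ} (hε : 0 < ε) {γ₀ : ℝ → Plane} (h₀ : Admissible γ₀) :
    ∃ m > 0, ∃ M ≥ 1, ∃ τ₁ > 0, ∀ τ > 0, ∀ c, IsMinimizingMovement ε τ γ₀ c →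
      (∀ n, Tame m M (c n)) ∧ (τ ≤ τ₁ → ∀ n, MinStep ε m M τ (c n) (c (n + 1))) := by
  set E := energy ε γ₀ with hE
  have hE0 : 0 < E := h₀.energy_pos hε
  set m := Real.exp (-E) with hm
  set M := 2 * E + 4 * E ^ 2 / ε + 1 with hM
  have hm0 : 0 < m := Real.exp_pos _
  have hM1 : 1 ≤ M := by
    have : 0 ≤ 4 * E ^ 2 / ε := by positivity
    linarith
  have hMp : 0 < M := by linarith
  obtain ⟨C, hC, hsize⟩ := exists_size_bound hε h₀
  obtain ⟨ρ₁, hρ₁, h1⟩ := Tame.norm_ds_sub_ds_le_of_norm (m := m) hMp (by positivity : 0 < m / 4)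
  obtain ⟨ρ₂, hρ₂, h2⟩ := Tame.norm_sub_lt_of_size (m := m) hMp
    (lt_min hρ₁ one_pos : 0 < min ρ₁ 1)
  refine ⟨m, hm0, M, hM1, (ρ₂ / C) ^ 2, by positivity, fun τ hτ c hc => ?_⟩
  have ht : ∀ n, Tame m M (c n) := hc.tame h₀ hτ hε
  refine ⟨ht, fun hτ1 n => ?_⟩
  have e1 : size (fun s => c (n + 1) s - c n s) ≤ ρ₂ := by
    have e2 := hsize τ hτ c hc n 1
    simp only [Finset.range_one, Finset.sum_singleton, add_zero, Nat.cast_one, one_mul] at e2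
    refine e2.trans ?_
    have e3 := Real.sqrt_le_sqrt hτ1
    rw [Real.sqrt_sq (by positivity), le_div_iff₀ hC] at e3
    linarith
  have e2 := h2 _ _ (ht (n + 1)) (ht n) e1
  exact ⟨ht n, ht (n + 1), hc.isMinOn n, fun s hs => (e2 s hs).trans (min_le_right _ _),
    h1 _ _ (ht (n + 1)) (ht n) fun s hs => (e2 s hs).trans (min_le_left _ _)⟩

/-! ### Step functions in time and the Cauchy property in `L²(0, T; H²)` -/

lemma measurable_step (F : ℕ → ℝ≥0∞) (τ : ℝ) : Measurable fun t : ℝ => F ⌈t / τ⌉₊ :=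
  (measurable_from_top (f := F)).comp (Nat.measurable_ceil.comp (measurable_id.div_const τ))

lemma lintegral_step_le (F : ℕ → ℝ≥0∞) {τ T : ℝ} (hτ : 0 < τ) :
    ∫⁻ t in Ioo 0 T, F ⌈t / τ⌉₊ ≤
      ∑ i ∈ Finset.range ⌈T / τ⌉₊, ENNReal.ofReal τ * F (i + 1) := by
  have hsub : Ioo 0 T ⊆ ⋃ i : Fin ⌈T / τ⌉₊, Ioc ((i : ℕ) * τ) (((i : ℕ) + 1) * τ) := by
    intro t ht
    have h0 : 0 < t / τ := div_pos ht.1 hτ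
    obtain ⟨n, hn⟩ := Nat.exists_eq_succ_of_ne_zero (Nat.ceil_pos.2 h0).ne'
    have h1 : n < ⌈T / τ⌉₊ := by
      have : ⌈t / τ⌉₊ ≤ ⌈T / τ⌉₊ := Nat.ceil_mono (div_le_div_of_nonneg_right ht.2.le hτ.le)
      omega
    rw [Nat.succ_eq_add_one, Nat.ceil_eq_iff (Nat.succ_ne_zero n)] at hn
    refine mem_iUnion.2 ⟨⟨n, h1⟩, ?_, ?_⟩
    · have := hn.1
      rw [Nat.succ_sub_one, lt_div_iff₀ hτ] at this
      exact this
    · have := hn.2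
      rw [div_le_iff₀ hτ] at this
      push_cast at this
      exact this
  refine (lintegral_mono_set hsub).trans ((lintegral_iUnion_le _ _).trans ?_)
  rw [tsum_fintype, Finset.sum_range]
  refine Finset.sum_le_sum fun i _ => ?_
  have e : ∫⁻ t in Ioc ((i : ℕ) * τ) (((i : ℕ) + 1) * τ), F ⌈t / τ⌉₊ =
      ∫⁻ _ in Ioc ((i : ℕ) * τ) (((i : ℕ) + 1) * τ), F (i + 1) := by
    refine setLIntegral_congr_fun measurableSet_Ioc fun t ht => ?_
    have : ⌈t / τ⌉₊ = (i : ℕ) + 1 := by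
      rw [Nat.ceil_eq_iff (Nat.succ_ne_zero _), Nat.succ_sub_one]
      push_cast
      exact ⟨(lt_div_iff₀ hτ).2 ht.1, (div_le_iff₀ hτ).2 ht.2⟩
    simp only [this]
  rw [e, setLIntegral_const, Real.volume_Ioc, mul_comm]
  refine le_of_eq ?_
  congr 2
  ring

/-- The difference quotient in time of a step-by-step minimizer, measured by `size`. -/
noncomputable def speed (τ : ℝ) (c : ℕ → ℝ → Plane) (n : ℕ) : ℝ :=
  size (fun s => c n s - c (n - 1) s) / τ

/-- The time integral of the speed is at most the total displacement over `⌈T / τ⌉` steps, which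
cover a time of at most `T + 1`. -/
lemma lintegral_speed_le {c : ℕ → ℝ → Plane} {C τ T : ℝ} (hC : 0 < C) (hτ : 0 < τ) (hτ1 : τ ≤ 1)
    (hT : 0 < T)
    (h : ∀ n k : ℕ, ∑ i ∈ Finset.range k, size (fun s => c (n + i + 1) s - c (n + i) s) ≤
      C * √(k * τ)) :
    ∫⁻ t in Ioo 0 T, ENNReal.ofReal (speed τ c ⌈t / τ⌉₊) ≤ ENNReal.ofReal (C * √(T + 1)) := by
  refine (lintegral_step_le (fun n => ENNReal.ofReal (speed τ c n)) hτ).trans ?_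
  have e : ∀ i, ENNReal.ofReal τ * ENNReal.ofReal (speed τ c (i + 1)) =
      ENNReal.ofReal (size (fun s => c (0 + i + 1) s - c (0 + i) s)) := by
    intro i
    rw [← ENNReal.ofReal_mul hτ.le, speed, mul_div_cancel₀ _ hτ.ne', zero_add,
      Nat.add_sub_cancel]
  rw [Finset.sum_congr rfl fun i _ => e i, ← ENNReal.ofReal_sum_of_nonneg fun _ _ => size_nonneg _]
  refine ENNReal.ofReal_le_ofReal ((h 0 _).trans ?_)
  refine mul_le_mul_of_nonneg_left (Real.sqrt_le_sqrt ?_) hC.le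
  have h1 := Nat.ceil_lt_add_one (a := T / τ) (by positivity)
  calc (⌈T / τ⌉₊ : ℝ) * τ ≤ (T / τ + 1) * τ := by gcongr
    _ = T + τ := by field_simp
    _ ≤ T + 1 := by linarith

lemma interp_of_pos {τ t : ℝ} (hτ : 0 < τ) (ht : 0 < t) :
    ∃ n, ⌈t / τ⌉₊ = n + 1 :=
  Nat.exists_eq_succ_of_ne_zero (Nat.ceil_pos.2 (div_pos ht hτ)).ne'

lemma cauchy_h2 {ε : ℝ} (hε : 0 < ε) {γ₀ : ℝ → Plane} (h₀ : Admissible γ₀)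
    {τ : ℕ → ℝ} {c : ℕ → ℕ → ℝ → Plane} (hτ : ∀ k, τ k ∈ Ioo (0 : ℝ) 1)
    (hτ0 : Tendsto τ atTop (𝓝 0)) (hc : ∀ k, IsMinimizingMovement ε (τ k) γ₀ (c k))
    (hclose : ∀ T > 0, ∀ η > 0, ∃ K : ℕ, ∀ k ≥ K, ∀ j ≥ K, ∀ᵐ t ∂(volume.restrict (Ioo (0 : ℝ) T)),
      ∀ s ∈ I, ‖interp (τ k) (c k) t s - interp (τ j) (c j) t s‖ ≤ η ∧
        ‖ds (interp (τ k) (c k) t) s - ds (interp (τ j) (c j) t) s‖ ≤ η) :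
    ∀ T > 0, ∀ η > 0, ∃ K : ℕ, ∀ k ≥ K, ∀ j ≥ K,
      ∫⁻ t in Ioo 0 T, h2NormSq (interp (τ k) (c k) t - interp (τ j) (c j) t) ≤ η := by
  intro T hT η hη
  obtain ⟨m, hm, M, hM, τ₁, hτ₁, hstep⟩ := exists_minStep hε h₀
  obtain ⟨C, hC, τ₀, hτ₀, η₀, hη₀, hpair⟩ := exists_h2_close hε hm hM
  obtain ⟨C', hC', hsize⟩ := exists_size_bound hε h₀
  set B := T + 2 * (C' * √(T + 1)) with hB
  have hB0 : 0 < B := by positivity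
  -- The tolerance may be infinite, hence the truncation before passing to a real number.
  set e := (min η 1).toReal with he
  have he1 : min η 1 ≠ ∞ := ne_top_of_le_ne_top ENNReal.one_ne_top (min_le_right _ _)
  have he0 : 0 < e := ENNReal.toReal_pos (lt_min hη one_pos).ne' he1
  -- The number `B` bounds the time integral of one plus both speeds, so `C η' B ≤ e`.
  set η' := min η₀ (e / (C * B)) with hη'
  have hη'0 : 0 < η' := by positivity
  obtain ⟨K₁, hK₁⟩ := hclose T hT η' hη'0
  obtain ⟨K₂, hK₂⟩ := eventually_atTop.1 (hτ0.eventually (eventually_le_nhds (lt_min hτ₀ hτ₁)))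
  refine ⟨max K₁ K₂, fun k hk j hj => ?_⟩
  have hk2 := le_min_iff.1 (hK₂ k (le_of_max_le_right hk))
  have hj2 := le_min_iff.1 (hK₂ j (le_of_max_le_right hj))
  have hpt : ∀ᵐ t ∂(volume.restrict (Ioo (0 : ℝ) T)),
      h2NormSq (interp (τ k) (c k) t - interp (τ j) (c j) t) ≤
        ENNReal.ofReal (C * η') * (1 + ENNReal.ofReal (speed (τ k) (c k) ⌈t / τ k⌉₊)
          + ENNReal.ofReal (speed (τ j) (c j) ⌈t / τ j⌉₊)) := by
    filter_upwards [hK₁ k (le_of_max_le_left hk) j (le_of_max_le_left hj),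
      ae_restrict_mem measurableSet_Ioo] with t ht htI
    obtain ⟨n, hn⟩ := interp_of_pos (hτ k).1 htI.1
    obtain ⟨l, hl⟩ := interp_of_pos (hτ j).1 htI.1
    unfold interp at ht ⊢
    rw [hn, hl] at ht ⊢
    have e1 := hpair (τ k) (τ j) η' (hτ k).1 hk2.1 (hτ j).1 hj2.1 hη'0.le (min_le_left _ _) _ _ _ _
      ((hstep (τ k) (hτ k).1 (c k) (hc k)).2 hk2.2 n)
      ((hstep (τ j) (hτ j).1 (c j) (hc j)).2 hj2.2 l)
      (fun s hs => (ht s hs).1) (fun s hs => (ht s hs).2)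
    refine e1.trans_eq ?_
    have p1 : 0 ≤ speed (τ k) (c k) (n + 1) := div_nonneg (size_nonneg _) (hτ k).1.le
    have p2 : 0 ≤ speed (τ j) (c j) (l + 1) := div_nonneg (size_nonneg _) (hτ j).1.le
    rw [← ENNReal.ofReal_one, ← ENNReal.ofReal_add zero_le_one p1,
      ← ENNReal.ofReal_add (by positivity) p2, ← ENNReal.ofReal_mul (by positivity)]
    rfl
  refine (lintegral_mono_ae hpt).trans ?_
  have m1 := measurable_step (fun n => ENNReal.ofReal (speed (τ k) (c k) n)) (τ k)
  have m2 := measurable_step (fun n => ENNReal.ofReal (speed (τ j) (c j) n)) (τ j)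
  rw [lintegral_const_mul' _ _ ENNReal.ofReal_ne_top, lintegral_add_right _ m2,
    lintegral_add_right _ m1, setLIntegral_const, one_mul, Real.volume_Ioo, sub_zero]
  have b1 := lintegral_speed_le hC' (hτ k).1 (hτ k).2.le hT (hsize (τ k) (hτ k).1 (c k) (hc k))
  have b2 := lintegral_speed_le hC' (hτ j).1 (hτ j).2.le hT (hsize (τ j) (hτ j).1 (c j) (hc j))
  have b3 : ENNReal.ofReal T + (∫⁻ t in Ioo 0 T, ENNReal.ofReal (speed (τ k) (c k) ⌈t / τ k⌉₊))
      + (∫⁻ t in Ioo 0 T, ENNReal.ofReal (speed (τ j) (c j) ⌈t / τ j⌉₊)) ≤ ENNReal.ofReal B := by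
    refine (add_le_add (add_le_add le_rfl b1) b2).trans_eq ?_
    rw [← ENNReal.ofReal_add hT.le (by positivity),
      ← ENNReal.ofReal_add (by positivity) (by positivity)]
    congr 1
    rw [hB]; ring
  calc _ ≤ ENNReal.ofReal (C * η') * ENNReal.ofReal B := by gcongr
    _ = ENNReal.ofReal (C * η' * B) := (ENNReal.ofReal_mul (by positivity)).symm
    _ ≤ ENNReal.ofReal e := by
      refine ENNReal.ofReal_le_ofReal ?_
      have := min_le_right η₀ (e / (C * B))
      rw [le_div_iff₀ (by positivity)] at this
      linarith
    _ = min η 1 := ENNReal.ofReal_toReal he1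
    _ ≤ η := min_le_left _ _


lemma enorm_le_c1HolderNorm (α : ℝ) (f : ℝ → Plane) {s : ℝ} (hs : s ∈ I) :
    ‖f s‖ₑ ≤ c1HolderNorm α f ∧ ‖ds f s‖ₑ ≤ c1HolderNorm α f :=
  ⟨le_add_right (le_add_right (le_iSup₂ (f := fun s (_ : s ∈ I) => ‖f s‖ₑ) s hs)),
    le_add_right (le_add_left (le_iSup₂ (f := fun s (_ : s ∈ I) => ‖ds f s‖ₑ) s hs))⟩

lemma norm_le_of_enorm_le_add {x y : Plane} {η : ℝ} {a b : ℝ≥0∞} (hη : 0 ≤ η)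
    (hx : ‖x‖ₑ ≤ a) (hy : ‖y‖ₑ ≤ b) (ha : a ≤ ENNReal.ofReal (η / 2))
    (hb : b ≤ ENNReal.ofReal (η / 2)) : ‖x - y‖ ≤ η := by
  rw [← ofReal_norm] at hx hy
  have h1 := (ENNReal.ofReal_le_ofReal_iff (by positivity)).1 (hx.trans ha)
  have h2 := (ENNReal.ofReal_le_ofReal_iff (by positivity)).1 (hy.trans hb)
  linarith [norm_sub_le x y]

section

variable {ε : ℝ} {γ₀ : ℝ → Plane} {τ : ℕ → ℝ} {c : ℕ → ℕ → ℝ → Plane}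

lemma measurable_step_pair (F : ℕ × ℕ → ℝ≥0∞) (σ σ' : ℝ) :
    Measurable fun t : ℝ => F (⌈t / σ⌉₊, ⌈t / σ'⌉₊) := by
  have h : Measurable fun t : ℝ => (⌈t / σ⌉₊, ⌈t / σ'⌉₊) :=
    (Nat.measurable_ceil.comp (measurable_id.div_const σ)).prodMk
      (Nat.measurable_ceil.comp (measurable_id.div_const σ'))
  have e : Measurable F := Measurable.of_discrete
  exact e.comp h

lemma measurable_h2NormSq_interp_sub (σ σ' : ℝ) (c c' : ℕ → ℝ → Plane) :
    Measurable fun t => h2NormSq (interp σ c t - interp σ' c' t) :=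
  measurable_step_pair (fun p => h2NormSq (c p.1 - c' p.2)) σ σ'

lemma lintegral_h2NormSq_interp_lt_top {σ : ℝ} (hσ : 0 < σ) {c : ℕ → ℝ → Plane}
    (hc : ∀ n, MemH2 (c n)) (T : ℝ) : ∫⁻ t in Ioo 0 T, h2NormSq (interp σ c t) < ∞ := by
  refine (lintegral_step_le (fun n => h2NormSq (c n)) hσ).trans_lt ?_
  exact ENNReal.sum_lt_top.2 fun i _ =>
    ENNReal.mul_lt_top ENNReal.ofReal_lt_top (h2NormSq_lt_top (hc _))

lemma TendstoLinftyC1.ae_le {α : ℝ} {u : ℕ → ℝ → ℝ → Plane} {γ : ℝ → ℝ → Plane}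
    (h : TendstoLinftyC1 α u γ) {T : ℝ} (hT : 0 < T) : ∃ a : ℕ → ℝ≥0∞, Tendsto a atTop (𝓝 0) ∧
      ∀ᵐ t ∂(volume.restrict (Ioo 0 T)), ∀ m, ∀ s ∈ I,
        ‖(u m t - γ t) s‖ₑ ≤ a m ∧ ‖ds (u m t - γ t) s‖ₑ ≤ a m := by
  refine ⟨_, h.2 T hT, ?_⟩
  filter_upwards [ae_all_iff.2 fun k => ENNReal.ae_le_essSup
    (μ := volume.restrict (Ioo 0 T)) fun t => c1HolderNorm α (u k t - γ t)] with t ht m s hs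
  have e := enorm_le_c1HolderNorm α (u m t - γ t) hs
  exact ⟨e.1.trans (ht m), e.2.trans (ht m)⟩

/-- Only the `C¹` part of the norm enters: both curves are compared with the common limit. -/
lemma TendstoLinftyC1.uniformly_cauchy {α : ℝ} {u : ℕ → ℝ → ℝ → Plane} {γ : ℝ → ℝ → Plane}
    (h : TendstoLinftyC1 α u γ) (hu : ∀ k t, MemH2 (u k t)) {T : ℝ} (hT : 0 < T) {η : ℝ}
    (hη : 0 < η) : ∃ K : ℕ, ∀ k ≥ K, ∀ j ≥ K, ∀ᵐ t ∂(volume.restrict (Ioo (0 : ℝ) T)),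
      ∀ s ∈ I, ‖u k t s - u j t s‖ ≤ η ∧ ‖ds (u k t) s - ds (u j t) s‖ ≤ η := by
  obtain ⟨a, ha, hae⟩ := h.ae_le hT
  obtain ⟨K, hK⟩ := ENNReal.tendsto_atTop_zero.1 ha (ENNReal.ofReal (η / 2))
    (ENNReal.ofReal_pos.2 (by positivity))
  refine ⟨K, fun k hk j hj => ?_⟩
  filter_upwards [hae, ae_Ioo_of_ae_Ioi h.1 T] with t ht hγ s hs
  have d1 := norm_le_of_enorm_le_add hη.le (ht k s hs).1 (ht j s hs).1 (hK k hk) (hK j hj)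
  have d2 := norm_le_of_enorm_le_add hη.le (ht k s hs).2 (ht j s hs).2 (hK k hk) (hK j hj)
  rw [ds_sub_of_contDiffOn (hu k t) hγ hs, ds_sub_of_contDiffOn (hu j t) hγ hs,
    sub_sub_sub_cancel_right] at d2
  rw [Pi.sub_apply, Pi.sub_apply, sub_sub_sub_cancel_right] at d1
  exact ⟨d1, d2⟩

theorem exists_subseq_tendstoL2H2_of_tendstoLinftyC1 (hε : 0 < ε) (h₀ : Admissible γ₀)
    (hτ : ∀ k, τ k ∈ Ioo (0 : ℝ) 1) (hτ0 : Tendsto τ atTop (𝓝 0))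
    (hc : ∀ k, IsMinimizingMovement ε (τ k) γ₀ (c k)) {α : ℝ} {γ : ℝ → ℝ → Plane}
    (h : TendstoLinftyC1 α (fun k => interp (τ k) (c k)) γ) :
    ∃ φ : ℕ → ℕ, StrictMono φ ∧ TendstoL2H2 (fun k => interp (τ (φ k)) (c (φ k))) γ := by
  have hmem : ∀ k n, MemH2 (c k n) := fun k n => ((hc k).admissible h₀ n).memH2
  have hu : ∀ k t, MemH2 (interp (τ k) (c k) t) := fun k t => hmem k _
  have hcau := cauchy_h2 hε h₀ hτ hτ0 hc fun T hT η hη => h.uniformly_cauchy hu hT hη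
  have hlim : ∀ᵐ t ∂(volume.restrict (Ioi (0 : ℝ))), ∃ a : ℕ → ℝ≥0∞, Tendsto a atTop (𝓝 0) ∧
      ∀ m, ∀ s ∈ I, ‖(interp (τ m) (c m) t - γ t) s‖ₑ ≤ a m ∧
        ‖ds (interp (τ m) (c m) t - γ t) s‖ₑ ≤ a m := by
    refine ae_Ioi_of_ae_Ioo fun N => ?_
    have hsub : Ioo (0 : ℝ) N ⊆ Ioo 0 ((N : ℝ) + 1) := Ioo_subset_Ioo le_rfl (by linarith)
    obtain ⟨a, ha, hae⟩ := h.ae_le (by positivity : (0 : ℝ) < N + 1)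
    filter_upwards [ae_restrict_of_ae_restrict_of_subset hsub hae] with t ht using ⟨a, ha, ht⟩
  exact exists_subseq_tendstoL2H2 (u := fun k => interp (τ k) (c k)) (fun k t _ => hu k t)
    (fun k j => measurable_h2NormSq_interp_sub _ _ _ _)
    (fun k => measurable_step (fun n => h2NormSq (c k n)) (τ k))
    (fun k T _ => lintegral_h2NormSq_interp_lt_top (hτ k).1 (hmem k) T) hcau h.1 hlim

/-! ### Compactness -/

lemma interp_zero (σ : ℝ) (c : ℕ → ℝ → Plane) : interp σ c 0 = c 0 := by
  simp [interp]

/-- Arzelà–Ascoli for functions with small jumps in time: convergence at countably many space-time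
grid points spreads to uniform Cauchyness through the Lipschitz bound in space and the bound `√(|t -
t'| + τ)` in time. -/
lemma exists_subseq_uniformly_cauchy (hε : 0 < ε) (h₀ : Admissible γ₀)
    (hτ : ∀ k, τ k ∈ Ioo (0 : ℝ) 1) (hτ0 : Tendsto τ atTop (𝓝 0))
    (hc : ∀ k, IsMinimizingMovement ε (τ k) γ₀ (c k)) :
    ∃ φ : ℕ → ℕ, StrictMono φ ∧ ∀ T > 0, ∀ η > 0, ∃ K : ℕ, ∀ k ≥ K, ∀ j ≥ K,
      ∀ t ∈ Icc (0 : ℝ) T, ∀ s ∈ I,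
        ‖interp (τ (φ k)) (c (φ k)) t s - interp (τ (φ j)) (c (φ j)) t s‖ ≤ η := by
  obtain ⟨m, hm, M, hM, τ₁, hτ₁, hstep⟩ := exists_minStep hε h₀
  obtain ⟨C, hC, hsize⟩ := exists_size_bound hε h₀
  have hMp : 0 < M := by linarith
  have htame : ∀ k n, Tame m M (c k n) := fun k => (hstep (τ k) (hτ k).1 (c k) (hc k)).1
  have hcont : ∀ k n, ContinuousOn (c k n) I :=
    fun k n => (htame k n).memH2.isPrimitive.continuousOn
  set u : ℕ → ℝ → ℝ → Plane := fun k => interp (τ k) (c k) with hu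
  have hut : ∀ k t, Tame m M (u k t) := fun k t => htame k _
  have hutime : ∀ k, ∀ t ≥ 0, ∀ t' ≥ 0,
      size (fun s => u k t s - u k t' s) ≤ C * √(|t - t'| + τ k) := fun k t ht t' ht' =>
    size_interp_sub_le (hcont k) hC (hτ k).1 (hsize _ (hτ k).1 _ (hc k)) ht ht'
  set tp : ℕ × ℕ × ℕ → ℝ := fun p => p.2.1 / ((p.1 : ℝ) + 1) with htp
  -- Truncation at `1` makes every index triple a valid grid point, so the product of balls can run
  -- over all triples.
  set sp : ℕ × ℕ × ℕ → ℝ := fun p => min (p.2.2 / ((p.1 : ℝ) + 1)) 1 with hsp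
  have htp0 : ∀ p, 0 ≤ tp p := fun p => by positivity
  have hspI : ∀ p, sp p ∈ I := fun p => ⟨by positivity, min_le_right _ _⟩
  have hbound : ∀ k p, u k (tp p) (sp p) ∈
      Metric.closedBall (0 : Plane) (M + C * √(tp p + 1) + ‖γ₀ 0‖) := by
    intro k p
    rw [mem_closedBall_zero_iff]
    have e1 := (hut k (tp p)).lipschitz zero_mem_I (hspI p)
    have e2 := hutime k (tp p) (htp0 p) 0 le_rfl
    rw [sub_zero, abs_of_nonneg (htp0 p)] at e2
    have e3 : ‖u k (tp p) 0 - u k 0 0‖ ≤ C * √(tp p + 1) := by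
      have f1 : ‖u k (tp p) 0 - u k 0 0‖ ≤ size (fun s => u k (tp p) s - u k 0 s) := by
        have : 0 ≤ ∫ s in (0 : ℝ)..1, ‖u k (tp p) s - u k 0 s‖ :=
          intervalIntegral.integral_nonneg zero_le_one fun _ _ => norm_nonneg _
        unfold size
        linarith [norm_nonneg (u k (tp p) 1 - u k 0 1)]
      refine f1.trans (e2.trans ?_)
      gcongr
      exact (hτ k).2.le
    have e4 : u k 0 0 = γ₀ 0 := by
      simp only [hu, interp_zero]
      exact (hc k).initial zero_mem_I
    have e5 : M * |sp p - 0| ≤ M := by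
      rw [sub_zero, abs_of_nonneg (hspI p).1]
      exact mul_le_of_le_one_right hMp.le (hspI p).2
    have e6 : u k (tp p) (sp p) = (u k (tp p) (sp p) - u k (tp p) 0)
        + (u k (tp p) 0 - u k 0 0) + γ₀ 0 := by rw [e4]; abel
    rw [e6]
    refine norm_add₃_le.trans ?_
    linarith
  -- Tychonoff over a countable index set replaces the diagonal extraction.
  obtain ⟨x, -, φ, hφ, hx⟩ := (isCompact_univ_pi fun p : ℕ × ℕ × ℕ =>
    isCompact_closedBall (0 : Plane) (M + C * √(tp p + 1) + ‖γ₀ 0‖)).tendsto_subseq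
      (x := fun k p => u k (tp p) (sp p)) (fun k p _ => hbound k p)
  rw [tendsto_pi_nhds] at hx
  refine ⟨φ, hφ, fun T hT η hη => ?_⟩
  obtain ⟨ρ, hρ, hsup⟩ := Tame.norm_sub_lt_of_size (m := m) hMp (by positivity : 0 < η / 5)
  -- Half for the distance to the grid time and half for the time step, so that the time estimate
  -- yields `C √(2 δ) = ρ`.
  set δ := (ρ / C) ^ 2 / 2 with hδ
  have hδ0 : 0 < δ := by positivity
  obtain ⟨N, hN⟩ := exists_nat_one_div_lt (lt_min hδ0 (by positivity : 0 < η / 5 / M))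
  obtain ⟨hN1, hN2⟩ := lt_min_iff.1 hN
  have hN0 : (0 : ℝ) < N + 1 := by positivity
  have hgrid : ∀ᶠ k in atTop, ∀ p ∈ ({N} : Finset ℕ) ×ˢ
      (Finset.range (⌊T * (N + 1)⌋₊ + 1) ×ˢ Finset.range (N + 2)),
      dist (u (φ k) (tp p) (sp p)) (x p) < η / 10 := by
    rw [Filter.eventually_all_finset]
    exact fun p _ => (Metric.tendsto_nhds.1 (hx p)) (η / 10) (by positivity)
  have hτφ : ∀ᶠ k in atTop, τ (φ k) ≤ δ :=
    (hτ0.comp hφ.tendsto_atTop).eventually (eventually_le_nhds hδ0)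
  obtain ⟨K, hK⟩ := eventually_atTop.1 (hgrid.and hτφ)
  refine ⟨K, fun k hk j hj t ht s hs => ?_⟩
  set p : ℕ × ℕ × ℕ := (N, ⌊t * (N + 1)⌋₊, ⌊s * (N + 1)⌋₊) with hp
  have hpm : p ∈ ({N} : Finset ℕ) ×ˢ
      (Finset.range (⌊T * (N + 1)⌋₊ + 1) ×ˢ Finset.range (N + 2)) := by
    simp only [hp, Finset.mem_product, Finset.mem_singleton, Finset.mem_range, true_and]
    refine ⟨Nat.lt_succ_of_le (Nat.floor_mono (by gcongr; exact ht.2)), ?_⟩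
    rw [Nat.floor_lt' (by omega)]
    push_cast
    nlinarith [hs.2]
  have hfl : ∀ r : ℝ, 0 ≤ r → |r - ⌊r * (N + 1)⌋₊ / ((N : ℝ) + 1)| ≤ 1 / ((N : ℝ) + 1) := by
    intro r hr
    have f1 := Nat.floor_le (mul_nonneg hr hN0.le)
    have f2 := Nat.lt_floor_add_one (r * (N + 1))
    have f3 : r - ⌊r * (N + 1)⌋₊ / ((N : ℝ) + 1) =
        (r * (N + 1) - ⌊r * (N + 1)⌋₊) / ((N : ℝ) + 1) := by field_simp
    rw [f3, abs_of_nonneg (by apply div_nonneg _ hN0.le; linarith)]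
    gcongr
    linarith
  have ht1 : |t - tp p| ≤ 1 / ((N : ℝ) + 1) := hfl t ht.1
  have hs1 : |s - sp p| ≤ 1 / ((N : ℝ) + 1) := by
    have f1 : sp p = ⌊s * (N + 1)⌋₊ / ((N : ℝ) + 1) := by
      simp only [hsp, hp]
      apply min_eq_left
      rw [div_le_one hN0]
      have := Nat.floor_le (mul_nonneg hs.1 hN0.le)
      nlinarith [hs.2]
    rw [f1]
    exact hfl s hs.1
  have hone : ∀ l ≥ K, ‖u (φ l) t s - x p‖ ≤ η / 2 := by
    intro l hl
    obtain ⟨g1, g2⟩ := hK l hl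
    have e1 : ‖u (φ l) t s - u (φ l) (tp p) s‖ ≤ η / 5 := by
      refine hsup _ _ (hut _ _) (hut _ _) ?_ s hs
      refine (hutime (φ l) t ht.1 (tp p) (htp0 p)).trans ?_
      have f1 : |t - tp p| + τ (φ l) ≤ (ρ / C) ^ 2 := by
        have : δ + δ = (ρ / C) ^ 2 := by rw [hδ]; ring
        linarith
      have f2 := Real.sqrt_le_sqrt f1
      rw [Real.sqrt_sq (by positivity), le_div_iff₀ hC] at f2
      linarith
    have e2 : ‖u (φ l) (tp p) s - u (φ l) (tp p) (sp p)‖ ≤ η / 5 := by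
      refine ((hut (φ l) (tp p)).lipschitz (hspI p) hs).trans ?_
      have := hs1.trans hN2.le
      rw [le_div_iff₀ hMp] at this
      linarith
    have e3 := (g1 p hpm).le
    rw [dist_eq_norm] at e3
    have e4 : u (φ l) t s - x p = (u (φ l) t s - u (φ l) (tp p) s)
        + (u (φ l) (tp p) s - u (φ l) (tp p) (sp p)) + (u (φ l) (tp p) (sp p) - x p) := by abel
    rw [e4]
    refine norm_add₃_le.trans ?_
    linarith
  have e := norm_sub_le (u (φ k) t s - x p) (u (φ j) t s - x p)
  rw [sub_sub_sub_cancel_right] at e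
  linarith [hone k hk, hone j hj]

/-- The Hölder seminorm of exponent `α` interpolates between the sup bound and the bound of exponent
`1/2`, by writing an increment `y` as `y ^ (1 - 2α) * y ^ (2α)`. -/
lemma c1HolderNorm_le {α η Q : ℝ} (hα0 : 0 < α) (hα : α < 1 / 2) (hη : 0 ≤ η) (hQ : 0 ≤ Q)
    {f : ℝ → Plane} (h1 : ∀ s ∈ I, ‖f s‖ ≤ η) (h2 : ∀ s ∈ I, ‖ds f s‖ ≤ η)
    (h3 : ∀ a ∈ I, ∀ b ∈ I, ‖ds f b - ds f a‖ ≤ Q * √|b - a|) :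
    c1HolderNorm α f ≤ ENNReal.ofReal (η + η + (2 * η) ^ (1 - 2 * α) * Q ^ (2 * α)) := by
  rw [ENNReal.ofReal_add (by positivity) (by positivity), ENNReal.ofReal_add hη hη]
  unfold c1HolderNorm
  refine add_le_add (add_le_add (iSup₂_le fun s hs => ?_) (iSup₂_le fun s hs => ?_))
    (iSup₂_le fun s hs => iSup₂_le fun r hr => ?_)
  · rw [← ofReal_norm]; exact ENNReal.ofReal_le_ofReal (h1 s hs)
  · rw [← ofReal_norm]; exact ENNReal.ofReal_le_ofReal (h2 s hs)
  · refine ENNReal.div_le_of_le_mul ?_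
    rw [← ENNReal.ofReal_mul (by positivity), ← ofReal_norm]
    refine ENNReal.ofReal_le_ofReal ?_
    set y := ‖ds f s - ds f r‖ with hy
    have hy0 : 0 ≤ y := norm_nonneg _
    have hy1 : y ≤ 2 * η := by linarith [norm_sub_le (ds f s) (ds f r), h2 s hs, h2 r hr]
    have hy2 : y ≤ Q * √|s - r| := h3 r hr s hs
    have e1 : y = y ^ (1 - 2 * α) * y ^ (2 * α) := by
      rw [← Real.rpow_add_of_nonneg hy0 (by linarith) (by linarith), sub_add_cancel,
        Real.rpow_one]
    have e2 : (Q * √|s - r|) ^ (2 * α) = Q ^ (2 * α) * |s - r| ^ α := by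
      rw [Real.mul_rpow hQ (Real.sqrt_nonneg _), Real.sqrt_eq_rpow, ← Real.rpow_mul (abs_nonneg _)]
      congr 2
      ring
    rw [e1, mul_assoc, ← e2]
    exact mul_le_mul (Real.rpow_le_rpow hy0 hy1 (by linarith))
      (Real.rpow_le_rpow hy0 hy2 (by linarith)) (by positivity) (by positivity)

lemma exists_c1_limit {m M : ℝ} (hM : 0 < M) {v : ℕ → ℝ → Plane} {γ w : ℝ → Plane}
    (hv : ∀ k, Tame m M (v k)) (h1 : ∀ s ∈ I, Tendsto (fun k => v k s) atTop (𝓝 (γ s)))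
    (h2 : ∀ s ∈ I, Tendsto (fun k => ds (v k) s) atTop (𝓝 (w s))) :
    ContDiffOn ℝ 1 γ I ∧ EqOn (ds γ) w I ∧
      ∀ a ∈ I, ∀ b ∈ I, ‖ds γ b - ds γ a‖ ≤ M ^ 2 * √|b - a| := by
  have hw : ∀ a ∈ I, ∀ b ∈ I, ‖w b - w a‖ ≤ M ^ 2 * √|b - a| := fun a ha b hb =>
    le_of_tendsto ((h2 b hb).sub (h2 a ha)).norm
      (Eventually.of_forall fun k => (hv k).ds_sub_le hM ha hb)
  have hwc : ContinuousOn w I := by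
    intro a ha
    rw [ContinuousWithinAt, tendsto_iff_norm_sub_tendsto_zero]
    have e : Tendsto (fun b : ℝ => M ^ 2 * √|b - a|) (𝓝[I] a) (𝓝 0) := by
      have : Continuous fun b : ℝ => M ^ 2 * √|b - a| := by fun_prop
      have h := this.tendsto a
      simp only [sub_self, abs_zero, Real.sqrt_zero, mul_zero] at h
      exact h.mono_left nhdsWithin_le_nhds
    refine tendsto_of_tendsto_of_tendsto_of_le_of_le' tendsto_const_nhds e
      (Eventually.of_forall fun _ => norm_nonneg _) ?_
    filter_upwards [self_mem_nhdsWithin] with b hb using hw a ha b hb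
  have hprim : IsPrimitive γ w := by
    refine ⟨hwc.intervalIntegrable_I, fun s hs => ?_⟩
    have e : Tendsto (fun k => ∫ r in (0 : ℝ)..s, ds (v k) r) atTop
        (𝓝 (∫ r in (0 : ℝ)..s, w r)) := by
      have hsub : ∀ r ∈ uIoc 0 s, r ∈ I := fun r hr => by
        rw [uIoc_of_le hs.1] at hr
        exact ⟨hr.1.le, hr.2.trans hs.2⟩
      refine intervalIntegral.tendsto_integral_filter_of_dominated_convergence (fun _ => M)
        (Eventually.of_forall fun k => ?_) (Eventually.of_forall fun k => ae_of_all _ fun r hr => ?_)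
        (by simp) (ae_of_all _ fun r hr => h2 r (hsub r hr))
      · exact (intervalIntegrable_iff.1 (intervalIntegrable_sub
          (hv k).memH2.isPrimitive.intervalIntegrable zero_mem_I hs)).aestronglyMeasurable
      · obtain ⟨θ, ω, hp, hc⟩ := hv k
        rw [hp.norm_ds (hsub r hr)]
        exact hc.length_le
    refine tendsto_nhds_unique (h1 s hs) (((h1 0 zero_mem_I).add e).congr fun k => ?_)
    exact ((hv k).memH2.isPrimitive.eq_integral s hs).symm
  have hds : EqOn (ds γ) w I := fun s hs =>
    ds_of_hasDerivWithinAt hs (hprim.hasDerivWithinAt hwc hs)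
  refine ⟨?_, hds, fun a ha b hb => ?_⟩
  · rw [contDiffOn_one_iff_derivWithin uniqueDiffOn_I]
    exact ⟨fun s hs => (hprim.hasDerivWithinAt hwc hs).differentiableWithinAt, hwc.congr hds⟩
  · rw [hds ha, hds hb]; exact hw a ha b hb

theorem exists_subseq_tendstoLinftyC1 (hε : 0 < ε) (h₀ : Admissible γ₀)
    (hτ : ∀ k, τ k ∈ Ioo (0 : ℝ) 1) (hτ0 : Tendsto τ atTop (𝓝 0))
    (hc : ∀ k, IsMinimizingMovement ε (τ k) γ₀ (c k)) :
    ∃ φ : ℕ → ℕ, StrictMono φ ∧ ∃ γ : ℝ → ℝ → Plane, ∀ α ∈ Ioo (0 : ℝ) (1 / 2),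
      TendstoLinftyC1 α (fun k => interp (τ (φ k)) (c (φ k))) γ := by
  obtain ⟨φ, hφ, hcau⟩ := exists_subseq_uniformly_cauchy hε h₀ hτ hτ0 hc
  obtain ⟨m, hm, M, hM, τ₁, hτ₁, hstep⟩ := exists_minStep hε h₀
  have hMp : 0 < M := by linarith
  set u : ℕ → ℝ → ℝ → Plane := fun k => interp (τ (φ k)) (c (φ k)) with hu
  have hut : ∀ k t, Tame m M (u k t) :=
    fun k t => (hstep (τ (φ k)) (hτ (φ k)).1 (c (φ k)) (hc (φ k))).1 _
  have hcau1 : ∀ T > 0, ∀ η > 0, ∃ K : ℕ, ∀ k ≥ K, ∀ j ≥ K, ∀ t ∈ Icc (0 : ℝ) T, ∀ s ∈ I,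
      ‖u k t s - u j t s‖ ≤ η ∧ ‖ds (u k t) s - ds (u j t) s‖ ≤ η := by
    intro T hT η hη
    obtain ⟨ρ, hρ, h1⟩ := Tame.norm_ds_sub_ds_le_of_norm (m := m) hMp hη
    obtain ⟨K, hK⟩ := hcau T hT (min ρ η) (lt_min hρ hη)
    refine ⟨K, fun k hk j hj t ht s hs => ⟨(hK k hk j hj t ht s hs).trans (min_le_right _ _), ?_⟩⟩
    exact h1 _ _ (hut k t) (hut j t)
      (fun r hr => (hK k hk j hj t ht r hr).trans (min_le_left _ _)) s hs
  have hlim : ∀ t ≥ 0, ∀ s ∈ I, CauchySeq (fun k => u k t s) ∧ CauchySeq fun k => ds (u k t) s := by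
    intro t ht s hs
    have htt : t ∈ Icc 0 (t + 1) := ⟨ht, by linarith⟩
    constructor
    · rw [Metric.cauchySeq_iff]
      intro η hη
      obtain ⟨K, hK⟩ := hcau1 (t + 1) (by linarith) (η / 2) (by positivity)
      refine ⟨K, fun k hk j hj => ?_⟩
      rw [dist_eq_norm]
      linarith [(hK k hk j hj t htt s hs).1]
    · rw [Metric.cauchySeq_iff]
      intro η hη
      obtain ⟨K, hK⟩ := hcau1 (t + 1) (by linarith) (η / 2) (by positivity)
      refine ⟨K, fun k hk j hj => ?_⟩
      rw [dist_eq_norm]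
      linarith [(hK k hk j hj t htt s hs).2]
  set γ : ℝ → ℝ → Plane := fun t s => limUnder atTop fun k => u k t s with hγ
  set w : ℝ → ℝ → Plane := fun t s => limUnder atTop fun k => ds (u k t) s with hw
  have hγl : ∀ t ≥ 0, ∀ s ∈ I, Tendsto (fun k => u k t s) atTop (𝓝 (γ t s)) :=
    fun t ht s hs => CauchySeq.tendsto_limUnder (hlim t ht s hs).1
  have hwl : ∀ t ≥ 0, ∀ s ∈ I, Tendsto (fun k => ds (u k t) s) atTop (𝓝 (w t s)) :=
    fun t ht s hs => CauchySeq.tendsto_limUnder (hlim t ht s hs).2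
  have hC1 : ∀ t ≥ 0, ContDiffOn ℝ 1 (γ t) I ∧ EqOn (ds (γ t)) (w t) I ∧
      ∀ a ∈ I, ∀ b ∈ I, ‖ds (γ t) b - ds (γ t) a‖ ≤ M ^ 2 * √|b - a| :=
    fun t ht => exists_c1_limit hMp (fun k => hut k t) (hγl t ht) (hwl t ht)
  refine ⟨φ, hφ, γ, fun α hα => ⟨?_, fun T hT => ?_⟩⟩
  · filter_upwards [ae_restrict_mem measurableSet_Ioi] with t ht using (hC1 t (le_of_lt ht)).1
  rw [ENNReal.tendsto_atTop_zero]
  intro e he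
  have hα1 : 0 < 1 - 2 * α := by linarith [hα.2]
  -- The exponent `1 - 2α` is positive, so the interpolated bound vanishes with `η`; this is where
  -- `α < 1 / 2` matters.
  have hcontin : Tendsto (fun η : ℝ => ENNReal.ofReal
      (η + η + (2 * η) ^ (1 - 2 * α) * (2 * M ^ 2) ^ (2 * α))) (𝓝[>] 0) (𝓝 0) := by
    have h1 : Continuous fun η : ℝ => ENNReal.ofReal
        (η + η + (2 * η) ^ (1 - 2 * α) * (2 * M ^ 2) ^ (2 * α)) := by
      refine ENNReal.continuous_ofReal.comp ((continuous_id.add continuous_id).add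
        (Continuous.mul ?_ continuous_const))
      exact (continuous_const.mul continuous_id).rpow_const fun _ => Or.inr hα1.le
    have h2 := h1.tendsto 0
    rw [mul_zero, Real.zero_rpow hα1.ne'] at h2
    simp only [add_zero, zero_mul, ENNReal.ofReal_zero] at h2
    exact h2.mono_left nhdsWithin_le_nhds
  obtain ⟨η, hηe, hη⟩ := ((hcontin.eventually (eventually_le_nhds he)).and
    self_mem_nhdsWithin).exists
  have hη0 : 0 < η := hη
  obtain ⟨K, hK⟩ := hcau1 T hT η hη0
  refine ⟨K, fun k hk => essSup_le_of_ae_le _ ?_⟩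
  filter_upwards [ae_restrict_mem measurableSet_Ioo] with t ht
  have ht0 : (0 : ℝ) ≤ t := ht.1.le
  have htI : t ∈ Icc 0 T := ⟨ht0, ht.2.le⟩
  obtain ⟨c1, c2, c3⟩ := hC1 t ht0
  have hds : ∀ s ∈ I, ds (u k t - γ t) s = ds (u k t) s - ds (γ t) s :=
    fun s hs => ds_sub_of_contDiffOn (hut k t).memH2 c1 hs
  refine le_trans (c1HolderNorm_le hα.1 hα.2 hη0.le (by positivity : 0 ≤ 2 * M ^ 2)
    (fun s hs => ?_) (fun s hs => ?_) (fun a ha b hb => ?_)) hηe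
  · refine le_of_tendsto (tendsto_const_nhds.sub (hγl t ht0 s hs)).norm ?_
    filter_upwards [eventually_ge_atTop K] with j hj using (hK k hk j hj t htI s hs).1
  · rw [hds s hs, c2 hs]
    refine le_of_tendsto (tendsto_const_nhds.sub (hwl t ht0 s hs)).norm ?_
    filter_upwards [eventually_ge_atTop K] with j hj using (hK k hk j hj t htI s hs).2
  · rw [hds a ha, hds b hb,
      show ds (u k t) b - ds (γ t) b - (ds (u k t) a - ds (γ t) a) =
        (ds (u k t) b - ds (u k t) a) - (ds (γ t) b - ds (γ t) a) by abel]
    linarith [norm_sub_le (ds (u k t) b - ds (u k t) a) (ds (γ t) b - ds (γ t) a),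
      c3 a ha b hb, (hut k t).ds_sub_le hMp ha hb]

lemma TendstoLinftyC1.comp_strictMono {α : ℝ} {u : ℕ → ℝ → ℝ → Plane} {γ : ℝ → ℝ → Plane}
    (h : TendstoLinftyC1 α u γ) {φ : ℕ → ℕ} (hφ : StrictMono φ) :
    TendstoLinftyC1 α (fun k => u (φ k)) γ :=
  ⟨h.1, fun T hT => (h.2 T hT).comp hφ.tendsto_atTop⟩

end

end ElasticFlow

theorem theorem2p6 (ε : ℝ) (hε : 0 < ε) (γ₀ : ℝ → Plane) (hγ₀ : Admissible γ₀)
    (c : ℝ → ℕ → ℝ → Plane)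
    (hc : ∀ τ ∈ Set.Ioo (0 : ℝ) 1, IsMinimizingMovement ε τ γ₀ (c τ))
    (τ : ℕ → ℝ) (hτ : ∀ k, τ k ∈ Set.Ioo (0 : ℝ) 1) (hτ0 : Filter.Tendsto τ Filter.atTop (𝓝 0)) :
    (∃ φ : ℕ → ℕ, StrictMono φ ∧ ∃ γ : ℝ → ℝ → Plane,
      (∀ α ∈ Set.Ioo (0 : ℝ) (1 / 2),
        TendstoLinftyC1 α (fun k => interp (τ (φ k)) (c (τ (φ k)))) γ) ∧
      TendstoL2H2 (fun k => interp (τ (φ k)) (c (τ (φ k)))) γ) ∧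
    (∀ γ : ℝ → ℝ → Plane,
      (∃ α ∈ Set.Ioo (0 : ℝ) (1 / 2), TendstoLinftyC1 α (fun k => interp (τ k) (c (τ k))) γ) →
      ∃ φ : ℕ → ℕ, StrictMono φ ∧
        TendstoL2H2 (fun k => interp (τ (φ k)) (c (τ (φ k)))) γ) := by
  have hc' : ∀ k, IsMinimizingMovement ε (τ k) γ₀ (c (τ k)) := fun k => hc _ (hτ k)
  refine ⟨?_, fun γ ⟨α, _, h⟩ =>
    exists_subseq_tendstoL2H2_of_tendstoLinftyC1 hε hγ₀ hτ hτ0 hc' h⟩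
  obtain ⟨φ, hφ, γ, h⟩ := exists_subseq_tendstoLinftyC1 hε hγ₀ hτ hτ0 hc'
  obtain ⟨ψ, hψ, h'⟩ := exists_subseq_tendstoL2H2_of_tendstoLinftyC1 hε hγ₀
    (fun k => hτ (φ k)) (hτ0.comp hφ.tendsto_atTop) (fun k => hc' (φ k))
    -- Any admissible exponent would do; the limit `γ` is the same for all of them.
    (h (1 / 4) ⟨by norm_num, by norm_num⟩)
  exact ⟨φ ∘ ψ, hφ.comp hψ, γ, fun α hα => (h α hα).comp_strictMono hψ, h'⟩
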